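/- **Theorem (Kapovich--Weidmann--Miasnikov, reformulated).** *Definitions.* A decorated group is a pair $(G,\{H_i\}_{i\in I})$ of a group $G$ (the vertex group) and a finite family of subgroups $H_i\le G$ (the edge groups). Decorated groups $(G,\{H_i\}_{i\in I})$ and $(K,\{L_j\}_{j\in J})$ are isomorphic if there are an isomorphism $\varphi\colon G\to K$, a bijection $\psi\colon I\to J$ and elements $k_j\in K$ $(j\in J)$ with $\varphi(H_i)=k_{\psi(i)}L_{\psi(i)}k_{\psi(i)}^{-1}$ for all $i\in I$. A subdecoration of $(G,\{H_i\}_{i\in I})$ is a pair $(G,\{H_j\}_{j\in J})$ with $J\subseteq I$. A finite decorated group presentation is a pair $(\langle A\mid R\rangle,\{\langle X_i\mid S_i\rangle,f_i\}_{i\in I})$ consisting of finite presentations, with $I$ finite, and monomorphisms $f_i\colon\langle X_i\mid S_i\rangle\to\langle A\mid R\rangle$ (given by words in $A$ representing the images of the generators); it is a presentation of every decorated group isomorphic to $(\langle A\mid R\rangle,\{\langle f_i(X_i)\rangle\}_{i\in I})$. The Membership Problem is solvable in a class $\mathcal C$ of groups if there is an algorithm which takes as input a finite presentation $\langle A\mid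 R\rangle$, words $w_1,\dots,w_k$ in $A$ and a word $z$ in $A$ and which, if $\langle A\mid R\rangle$ presents a group in $\mathcal C$, determines whether or not the element represented by $z$ lies in the subgroup generated by $w_1,\dots,w_k$. A finite connected graph of groups, with vertex groups $G_v$, edge groups $H_e$ and monomorphisms $i_e\colon H_e\to G_{i(e)}$ and $t_e\colon H_e\to G_{t(e)}$, is based on a class $\mathcal P$ of decorated groups if for every vertex $v$ the group $G_v$, decorated by the images of the edge groups of all edge ends at $v$ (the subgroups $i_e(H_e)$ for the edges $e$ with $i(e)=v$ and $t_e(H_e)$ for the edges $e$ with $t(e)=v$), is isomorphic to a subdecoration of a decorated group in $\mathcal P$. *Statement.* Let $\mathcal P$ be a class of decorated groups such that the following hold. 1. There is an algorithm which, for each finite decorated group presentation $(\langle A\mid R\rangle,\{\langle X_i\mid S_i\rangle,f_i\}_{i\in I})$ of a decorated group in $\mathcal P$, each $i\in I$, each finite set $Y$ of words in $A$ and each word $z$ in $A$, determines whether or not $z$ represents an element of the double coset $\langle f_i(X_i)\rangle\langle Y\rangle\subseteq\langle A\mid R\rangle$. 2. The Membership Problem is solvable in the class of all vertex groups appearing in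 $\mathcal P$. 3. Every edge group appearing in $\mathcal P$ is slender, i.e. all of its subgroups are finitely generated. 4. The Membership Problem is solvable in the class of all edge groups appearing in $\mathcal P$. 5. There is an algorithm which, for each finite decorated group presentation of a decorated group in $\mathcal P$ as above, each $i\in I$ and each finite set $Y$ of words in $A$, computes a finite generating set (as words in $A$) of the intersection $\langle f_i(X_i)\rangle\cap\langle Y\rangle\subseteq\langle A\mid R\rangle$. 6. $\mathcal P$ is recursively enumerable: some Turing machine outputs a list of finite decorated group presentations of decorated groups in $\mathcal P$ such that every decorated group in $\mathcal P$ is isomorphic to the decorated group defined by one of them. Then the Membership Problem is solvable in the class of fundamental groups of all finite connected graphs of groups based on $\mathcal P$. -/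

import Mathlib

universe u v

/-! ### Words, finite presentations, decision problems -/

/-- A word: `(k, true)` is the `k`-th generator and `(k, false)` its inverse. -/
abbrev Word : Type := List (ℕ × Bool)

/-- A finite presentation `⟨A | R⟩`: the number of generators and the list of relators. -/
abbrev FinPres : Type := ℕ × List Word

/-- The element of the free group on `n` generators spelled by a word.  (Letters which are not
among the `n` generators are ignored, so that every code is the code of some word.) -/
def Word.toFree (n : ℕ) (w : Word) : FreeGroup (Fin n) :=
  FreeGroup.lift (fun k : ℕ => if h : k < n then FreeGroup.of (⟨k, h⟩ : Fin n) else 1)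
    (FreeGroup.mk w)

namespace FinPres

/-- The set `R` of relators, in the free group `F(A)`. -/
def rels (p : FinPres) : Set (FreeGroup (Fin p.1)) :=
  {r | ∃ w ∈ p.2, r = Word.toFree p.1 w}

/-- The group `⟨A | R⟩`. -/
abbrev Pres (p : FinPres) : Type := PresentedGroup p.rels

/-- The element of `⟨A | R⟩` represented by a word in `A`. -/
def elt (p : FinPres) (w : Word) : p.Pres :=
  PresentedGroup.mk p.rels (Word.toFree p.1 w)

/-- The subgroup `⟨Y⟩` of `⟨A | R⟩` generated by a finite collection `Y` of words in `A`. -/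
def gen (p : FinPres) (Y : List Word) : Subgroup p.Pres :=
  Subgroup.closure {g | ∃ w ∈ Y, g = p.elt w}

/-- `p` is a finite presentation of a group in the class `C`. -/
def PresentsIn (p : FinPres) (C : Set GrpCat.{u}) : Prop :=
  ∃ G ∈ C, Nonempty (p.Pres ≃* G)

end FinPres

/-- There is an algorithm which, for every input `a` that satisfies the promise `dom a`, halts
and computes an output `b` with `spec a b`.  Nothing is required on other inputs. -/
def AlgorithmFor {α β : Type} [Primcodable α] [Primcodable β] (dom : α → Prop)
    (spec : α → β → Prop) : Prop :=
  ∃ f : α →. β, Partrec f ∧ ∀ a, dom a → ∃ b ∈ f a, spec a b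

/-- There is an algorithm which, for every input `a` that satisfies the promise `dom a`, halts
and determines whether or not `a` satisfies `q`. -/
def DecidableOn {α : Type} [Primcodable α] (dom q : α → Prop) : Prop :=
  AlgorithmFor dom (fun (a : α) (b : Bool) => b = true ↔ q a)

/-- The Membership Problem is solvable in the class `C`: an algorithm takes as input a finite
presentation `⟨A | R⟩`, words `w₁, …, w_k` in `A` and a word `z` in `A` and, if `⟨A | R⟩` presents
a group in `C`, determines whether or not `z` lies in the subgroup generated by the `w_i`. -/
def MembershipProblemSolvable (C : Set GrpCat.{u}) : Prop :=
  DecidableOn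
    (fun x : FinPres × List Word × Word => x.1.PresentsIn C)
    (fun x => x.1.elt x.2.2 ∈ x.1.gen x.2.1)

/-- A group is slender if each of its subgroups is finitely generated. -/
def IsSlender (G : Type u) [Group G] : Prop := ∀ K : Subgroup G, K.FG

/-! ### Decorated groups -/

/-- A decorated group `(G, {H_i}_{i ∈ I})`, with `I` finite. -/
structure DecoratedGroup where
  /-- the vertex group -/
  G : Type u
  [group : Group G]
  /-- the index set -/
  I : Type
  [finite : Finite I]
  /-- the edge groups -/
  H : I → Subgroup G

attribute [instance] DecoratedGroup.group DecoratedGroup.finite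

namespace DecoratedGroup

/-- Isomorphism of decorated groups: an isomorphism `φ` of the vertex groups and a bijection `ψ`
of the index sets such that `φ(H_i)` is conjugate to `L_{ψ(i)}` for all `i`. -/
def Isomorphic (D : DecoratedGroup.{u}) (D' : DecoratedGroup.{v}) : Prop :=
  ∃ (φ : D.G ≃* D'.G) (ψ : D.I ≃ D'.I) (k : D'.I → D'.G), ∀ i,
    (D.H i).map φ.toMonoidHom = (D'.H (ψ i)).map (MulAut.conj (k (ψ i))).toMonoidHom

/-- The subdecoration `(G, {H_j}_{j ∈ J})` for a subset `J` of the index set. -/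
def sub (D : DecoratedGroup.{u}) (J : Set D.I) : DecoratedGroup.{u} where
  G := D.G
  I := J
  H j := D.H j

/-- The class of all vertex groups appearing in `P`. -/
def vertexGroups (P : Set DecoratedGroup.{u}) : Set GrpCat.{u} :=
  {K | ∃ D ∈ P, Nonempty (K ≃* D.G)}

/-- The class of all edge groups appearing in `P`. -/
def edgeGroups (P : Set DecoratedGroup.{u}) : Set GrpCat.{u} :=
  {K | ∃ D ∈ P, ∃ i : D.I, Nonempty (K ≃* D.H i)}

end DecoratedGroup

/-- The data of a finite decorated group presentation `(⟨A | R⟩, {⟨X_i | S_i⟩, f_i}_{i ∈ I})`.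
The `i`-th entry of the list is the pair of `S_i` and of the list of words in `A` which represent
the images under `f_i` of the elements of `X_i`; thus `|X_i|` is the length of the latter list. -/
abbrev FinDecPres : Type := FinPres × List (List Word × List Word)

namespace FinDecPres

/-- The presentation `⟨X_i | S_i⟩`. -/
def edgePres (d : FinDecPres) (i : ℕ) : FinPres :=
  ((d.2.getD i ([], [])).2.length, (d.2.getD i ([], [])).1)

/-- The list of words `f_i(X_i)`. -/
def edgeWords (d : FinDecPres) (i : ℕ) : List Word := (d.2.getD i ([], [])).2

/-- The subgroup `⟨f_i(X_i)⟩` of `⟨A | R⟩`. -/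
def edgeSubgroup (d : FinDecPres) (i : ℕ) : Subgroup d.1.Pres := d.1.gen (d.edgeWords i)

/-- `d` is a finite decorated group presentation: for each `i` the prescribed images of the
generators define a monomorphism `f_i : ⟨X_i | S_i⟩ → ⟨A | R⟩`. -/
def IsValid (d : FinDecPres) : Prop :=
  ∀ i < d.2.length, ∃ f : (d.edgePres i).Pres →* d.1.Pres, Function.Injective f ∧
    ∀ k : Fin (d.edgeWords i).length,
      f (PresentedGroup.of (rels := (d.edgePres i).rels) k) = d.1.elt ((d.edgeWords i).get k)

/-- The decorated group `(⟨A | R⟩, {f_i(⟨X_i | S_i⟩)}_{i ∈ I})` defined by `d`. -/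
def toDecoratedGroup (d : FinDecPres) : DecoratedGroup.{0} where
  G := d.1.Pres
  I := Fin d.2.length
  H i := d.edgeSubgroup i

/-- `d` is a finite decorated group presentation of a decorated group in `P`. -/
def PresentsIn (d : FinDecPres) (P : Set DecoratedGroup.{u}) : Prop :=
  d.IsValid ∧ ∃ D ∈ P, d.toDecoratedGroup.Isomorphic D

end FinDecPres

/-- Some Turing machine outputs a (possibly finite or empty) list of finite decorated group
presentations of decorated groups in `P`, such that each decorated group in `P` is isomorphic to
one defined by an entry of the list. -/
def DecoratedGroup.RecursivelyEnumerable (P : Set DecoratedGroup.{u}) : Prop :=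
  ∃ f : ℕ → Option FinDecPres, Computable f ∧
    (∀ n, ∀ d ∈ f n, d.PresentsIn P) ∧
    ∀ D ∈ P, ∃ n, ∃ d ∈ f n, d.toDecoratedGroup.Isomorphic D

/-! ### Graphs of groups -/

/-- A finite graph of groups.  Each geometric edge `e` is listed once, with a chosen orientation,
and its group `H_e` is embedded in the groups of both of its endpoints. -/
structure GraphOfGroups where
  V : Type
  E : Type
  [finiteV : Finite V]
  [finiteE : Finite E]
  src : E → V
  tgt : E → V
  /-- vertex groups -/
  G : V → Type u
  /-- edge groups -/
  H : E → Type u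
  [groupG : ∀ v, Group (G v)]
  [groupH : ∀ e, Group (H e)]
  incSrc : ∀ e, H e →* G (src e)
  incTgt : ∀ e, H e →* G (tgt e)
  incSrc_injective : ∀ e, Function.Injective (incSrc e)
  incTgt_injective : ∀ e, Function.Injective (incTgt e)

attribute [instance] GraphOfGroups.finiteV GraphOfGroups.finiteE
  GraphOfGroups.groupG GraphOfGroups.groupH

namespace GraphOfGroups

variable (Γ : GraphOfGroups.{u})

/-- `T` is (the edge set of) a spanning tree of the underlying graph: there are no loops and no
parallel edges in `T`, and the resulting simple graph on all the vertices is a tree. -/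
def IsSpanningTree (T : Set Γ.E) : Prop :=
  (∀ e ∈ T, Γ.src e ≠ Γ.tgt e) ∧
  Set.InjOn (fun e => s(Γ.src e, Γ.tgt e)) T ∧
  (SimpleGraph.fromEdgeSet ((fun e => s(Γ.src e, Γ.tgt e)) '' T)).IsTree

/-- The free product of all vertex groups and of the free group on the edges. -/
abbrev BigProd : Type u := Monoid.Coprod (Monoid.CoprodI Γ.G) (FreeGroup Γ.E)

/-- The inclusion of a vertex group in the free product. -/
def vertex (x : Γ.V) : Γ.G x →* Γ.BigProd :=
  (Monoid.Coprod.inl : Monoid.CoprodI Γ.G →* Γ.BigProd).comp Monoid.CoprodI.of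

/-- The stable letter of an edge. -/
def stable (e : Γ.E) : Γ.BigProd :=
  (Monoid.Coprod.inr : FreeGroup Γ.E →* Γ.BigProd) (FreeGroup.of e)

/-- The relations `s_e t_e(h) s_e⁻¹ = i_e(h)` for all edges `e` and all `h ∈ H_e`, and `s_e = 1`
for all `e ∈ T`. -/
def relations (T : Set Γ.E) : Set Γ.BigProd :=
  {r | ∃ (e : Γ.E) (h : Γ.H e), r = Γ.stable e * Γ.vertex _ (Γ.incTgt e h) * (Γ.stable e)⁻¹ *
    (Γ.vertex _ (Γ.incSrc e h))⁻¹} ∪ {r | ∃ e ∈ T, r = Γ.stable e}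

/-- The fundamental group of a graph of groups with respect to a spanning tree `T`. -/
abbrev fundamentalGroup (T : Set Γ.E) : Type u :=
  Γ.BigProd ⧸ Subgroup.normalClosure (Γ.relations T)

/-- The decorated group at a vertex `x`: the vertex group, with the images of the edge groups of
all edge ends at `x` (an edge with both ends at `x` contributes two). -/
def decoratedGroupAt (x : Γ.V) : DecoratedGroup.{u} where
  G := Γ.G x
  I := {e : Γ.E // Γ.src e = x} ⊕ {e : Γ.E // Γ.tgt e = x}
  H := Sum.elim (fun e => e.2 ▸ (Γ.incSrc e.1).range) (fun e => e.2 ▸ (Γ.incTgt e.1).range)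

/-- `Γ` is based on `P`: the decorated group at each vertex is isomorphic to a subdecoration of a
decorated group in `P`. -/
def BasedOn (P : Set DecoratedGroup.{v}) : Prop :=
  ∀ x, ∃ D ∈ P, ∃ J : Set D.I, (Γ.decoratedGroupAt x).Isomorphic (D.sub J)

end GraphOfGroups

/-- The class of all fundamental groups of (connected, finite) graphs of groups based on `P`.
A graph has a spanning tree if and only if it is connected (and non-empty). -/
def fundamentalGroupsBasedOn (P : Set DecoratedGroup.{u}) : Set GrpCat.{u} :=
  {K | ∃ (Γ : GraphOfGroups.{u}) (T : Set Γ.E), Γ.BasedOn P ∧ Γ.IsSpanningTree T ∧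
    Nonempty (K ≃* Γ.fundamentalGroup T)}

/-!
Membership of an element of a finitely presented group in a finitely generated subgroup is always
semi-decidable, by the enumeration of consequences of the relators.  It therefore suffices to
semi-decide non-membership (`RecEnum.decidableOn`), which is done by means of finite certificates
(`IsSeparated`).

A certificate that `z` does not lie in `⟨Y⟩` in the group `K` consists of the code of a finite graph
of groups, whose vertices are decorated group presentations from the given enumeration, of a
homomorphism from `K` to the group generated by its vertex groups and stable letters, in which no
stable letter is required to be trivial, and of a finite *folded partial permutation
representation* (`PointCode.Folded`).  The latter is a finite set `X` of points which, for every
vertex `v`, is embedded in a finite disjoint union of coset spaces of finitely generated subgroups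
of the vertex group `M v`, together with partial bijections of `X` for the stable letters which are
compatible with the actions of the edge groups at both ends.  The words in `Y` have to fix the point
`0`, and `z` has to move it to another point of `X`.

Certificates are recursively enumerable (`recEnum_isSeparated`, `exists_recEnum_folded`): whether
points are distinct is a membership problem in a vertex group, whether two points lie in different
orbits of an edge group is a double coset problem, and whether the stabilisers of a point in an edge
group at both ends agree is checked on generators of the intersections of the edge subgroups with
the point stabilisers.

Certificates are sound (`IsSeparated.not_mem`) because a folded partial permutation representation
extends to a permutation representation (`exists_perm_extension`).  The coset spaces are enlarged to
`M v`-sets which contain all sets with an action of an edge group, up to some cardinality, and the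
partial bijections extend equivariantly by a Cantor–Bernstein argument (`exists_equivariant_equiv`).
This replaces the normal form theorem for graphs of groups.

Certificates are complete (`GraphOfGroups.IsSpanningTree.isSeparated`).  The fundamental group acts
on the cosets of `⟨Y⟩`, and finitely many points and relations witness that `Y` fixes the base point
and `z` does not.  The equivariant congruences on the free `M v`-sets over these points which the
relations generate are finitely generated, as the edge groups are slender
(`PointCong.exists_generating`, `exists_finitely_generated_partial_perm`); this yields the finitely
generated subgroups of a certificate.  The group of the code in which the stable letters of the
spanning tree survive retracts to the fundamental group, up to conjugation
(`GraphOfGroups.IsSpanningTree.exists_section`).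
-/

/-! ### Recursively enumerable predicates -/

attribute [fun_prop] Primrec
attribute [fun_prop] Primrec.id Primrec.const Primrec.fst Primrec.snd Primrec.pair Primrec.comp

section Primrec
variable {α β γ σ : Type} [Primcodable α] [Primcodable β] [Primcodable γ] [Primcodable σ]

@[fun_prop] theorem primrec_append {f g : α → List β} (hf : Primrec f) (hg : Primrec g) :
    Primrec fun a => f a ++ g a := Primrec.list_append.comp hf hg

@[fun_prop] theorem primrec_cons {f : α → β} {g : α → List β} (hf : Primrec f) (hg : Primrec g) :
    Primrec fun a => f a :: g a := Primrec.list_cons.comp hf hg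

@[fun_prop] theorem primrec_map {f : α → List β} {g : α → β → σ} (hf : Primrec f)
    (hg : Primrec fun x : α × β => g x.1 x.2) : Primrec fun a => (f a).map (g a) :=
  Primrec.list_map hf hg

@[fun_prop] theorem primrec_flatMap {f : α → List β} {g : α → β → List σ} (hf : Primrec f)
    (hg : Primrec fun x : α × β => g x.1 x.2) : Primrec fun a => (f a).flatMap (g a) :=
  Primrec.list_flatMap hf hg

@[fun_prop] theorem primrec_reverse {f : α → List β} (hf : Primrec f) :
    Primrec fun a => (f a).reverse := Primrec.list_reverse.comp hf

@[fun_prop] theorem primrec_length {f : α → List β} (hf : Primrec f) :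
    Primrec fun a => (f a).length := Primrec.list_length.comp hf

@[fun_prop] theorem primrec_getD {f : α → List β} {g : α → ℕ} {d : β} (hf : Primrec f)
    (hg : Primrec g) : Primrec fun a => (f a).getD (g a) d :=
  (Primrec.list_getD d).comp hf hg

@[fun_prop] theorem primrec_not {f : α → Bool} (hf : Primrec f) : Primrec fun a => !(f a) :=
  Primrec.not.comp hf

@[fun_prop] theorem primrec_cond {b : α → Bool} {f g : α → β} (hb : Primrec b) (hf : Primrec f)
    (hg : Primrec g) : Primrec fun a => bif b a then f a else g a := Primrec.cond hb hf hg

@[fun_prop] theorem primrec_inl {f : α → β} (hf : Primrec f) :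
    Primrec fun a => (Sum.inl (f a) : β ⊕ γ) := Primrec.sumInl.comp hf

@[fun_prop] theorem primrec_inr {f : α → β} (hf : Primrec f) :
    Primrec fun a => (Sum.inr (f a) : γ ⊕ β) := Primrec.sumInr.comp hf

@[fun_prop] theorem primrec_some {f : α → β} (hf : Primrec f) :
    Primrec fun a => some (f a) := Primrec.option_some.comp hf

end Primrec

/-- Recursive enumerability, in the normal form of a projection of a primitive recursive
predicate.  In this form closure under bounded universal quantifiers is elementary. -/
def RecEnum {α : Type} [Primcodable α] (p : α → Prop) : Prop :=
  ∃ q : α × ℕ → Prop, PrimrecPred q ∧ ∀ a, p a ↔ ∃ n, q (a, n)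

attribute [fun_prop] RecEnum

namespace RecEnum
variable {α β γ σ : Type} [Primcodable α] [Primcodable β] [Primcodable γ] [Primcodable σ]

theorem of_primrec {p : α → Prop} (hp : PrimrecPred p) : RecEnum p :=
  ⟨fun x => p x.1, hp.comp Primrec.fst, fun a => by simp⟩

theorem of_iff {p q : α → Prop} (hp : RecEnum p) (h : ∀ a, q a ↔ p a) : RecEnum q := by
  obtain rfl : q = p := funext fun a => propext (h a)
  exact hp

theorem comp {p : β → Prop} {f : α → β} (hp : RecEnum p) (hf : Primrec f) :
    RecEnum fun a => p (f a) := by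
  obtain ⟨q, hq, h⟩ := hp
  exact ⟨fun x => q (f x.1, x.2), hq.comp (by fun_prop), fun a => h _⟩

/-- The existential quantifier over ℕ is absorbed by a pairing function. -/
theorem exists_nat {p : α × ℕ → Prop} (hp : RecEnum p) : RecEnum fun a => ∃ n, p (a, n) := by
  obtain ⟨q, hq, h⟩ := hp
  refine ⟨fun x => q ((x.1, x.2.unpair.1), x.2.unpair.2), hq.comp ?_, fun a => ?_⟩
  · have h1 : Primrec Nat.unpair := Primrec.unpair
    fun_prop
  · constructor
    · rintro ⟨n, hn⟩
      obtain ⟨k, hk⟩ := (h _).1 hn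
      exact ⟨Nat.pair n k, by simpa using hk⟩
    · rintro ⟨n, hn⟩
      exact ⟨_, (h _).2 ⟨_, hn⟩⟩

@[fun_prop] theorem and {p q : α → Prop} (hp : RecEnum p) (hq : RecEnum q) :
    RecEnum fun a => p a ∧ q a := by
  obtain ⟨p', hp', h⟩ := hp
  obtain ⟨q', hq', h'⟩ := hq
  have h1 : Primrec Nat.unpair := Primrec.unpair
  refine ⟨fun x => p' (x.1, x.2.unpair.1) ∧ q' (x.1, x.2.unpair.2),
    (hp'.comp (by fun_prop)).and (hq'.comp (by fun_prop)), fun a => ?_⟩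
  simp only [h, h']
  constructor
  · rintro ⟨⟨n, hn⟩, ⟨k, hk⟩⟩
    exact ⟨Nat.pair n k, by simpa using ⟨hn, hk⟩⟩
  · rintro ⟨n, hn, hk⟩
    exact ⟨⟨_, hn⟩, ⟨_, hk⟩⟩

@[fun_prop] theorem or {p q : α → Prop} (hp : RecEnum p) (hq : RecEnum q) :
    RecEnum fun a => p a ∨ q a := by
  obtain ⟨p', hp', h⟩ := hp
  obtain ⟨q', hq', h'⟩ := hq
  exact ⟨fun x => p' x ∨ q' x, hp'.or hq', fun a => by simp only [h, h', exists_or]⟩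

@[fun_prop] theorem ex {p : α → β → Prop} (hp : RecEnum fun x : α × β => p x.1 x.2) :
    RecEnum fun a => ∃ b, p a b := by
  obtain ⟨q, hq, h⟩ := hp
  have h2 : RecEnum fun x : α × ℕ => ∃ n, ∃ b, Encodable.decode x.2 = some b ∧ q ((x.1, b), n) := by
    apply exists_nat (p := fun y : (α × ℕ) × ℕ =>
      ∃ b, Encodable.decode y.1.2 = some b ∧ q ((y.1.1, b), y.2))
    apply of_primrec
    classical
    have hdec : Primrec fun y : (α × ℕ) × ℕ =>
        ((Encodable.decode y.1.2 : Option β).casesOn false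
          fun b => decide (q ((y.1.1, b), y.2)) : Bool) := by
      refine Primrec.option_casesOn (Primrec.decode.comp (by fun_prop)) (Primrec.const _) ?_
      exact (PrimrecPred.decide hq).comp (by fun_prop)
    refine (Primrec.primrecPred (p := fun y => ((Encodable.decode y.1.2 : Option β).casesOn false
          fun b => decide (q ((y.1.1, b), y.2)) : Bool) = true) (by simpa using hdec)).of_eq ?_
    rintro ⟨⟨a, m⟩, n⟩
    dsimp only
    cases (Encodable.decode m : Option β) <;> simp
  refine (exists_nat (p := fun x => ∃ n, ∃ b, Encodable.decode x.2 = some b ∧ q ((x.1, b), n))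
    h2).of_iff fun a => ?_
  constructor
  · rintro ⟨b, hb⟩
    obtain ⟨n, hn⟩ := (h (a, b)).1 hb
    exact ⟨Encodable.encode b, n, b, by simp, hn⟩
  · rintro ⟨m, n, b, -, hn⟩
    exact ⟨b, (h (a, b)).2 ⟨n, hn⟩⟩

/-- Witnesses for finitely many instances may be searched for below a common bound. -/
theorem forall_mem {p : α → β → Prop} {l : α → List β} (hl : Primrec l)
    (hp : RecEnum fun x : α × β => p x.1 x.2) : RecEnum fun a => ∀ b ∈ l a, p a b := by
  obtain ⟨q, hq, h⟩ := hp
  have h0 : PrimrecRel fun (n : ℕ) (y : (α × β)) => q (y, n) := hq.comp (by fun_prop)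
  have h1 : PrimrecRel fun (b : β) (x : α × ℕ) => ∃ n ∈ List.range x.2, q ((x.1, b), n) :=
    have hr : Primrec List.range := Primrec.list_range
    PrimrecRel.comp (R := fun (N : List ℕ) (y : α × β) => ∃ n ∈ N, q (y, n))
      (f := fun z : β × α × ℕ => List.range z.2.2) (g := fun z : β × α × ℕ => (z.2.1, z.1))
      h0.exists_mem_list (by fun_prop) (by fun_prop)
  have h2 := h1.forall_mem_list
  refine ⟨fun x => ∀ b ∈ l x.1, ∃ n ∈ List.range x.2, q ((x.1, b), n),
    h2.comp (f := fun x : α × ℕ => l x.1) (g := fun x => x) (by fun_prop) (by fun_prop),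
    fun a => ?_⟩
  have key : ∀ L : List β, (∀ b ∈ L, p a b) → ∃ N, ∀ b ∈ L, ∃ n < N, q ((a, b), n) := by
    intro L
    induction L with
    | nil => simp
    | cons b L ih =>
      intro hL
      obtain ⟨N, hN⟩ := ih fun b hb => hL b (List.mem_cons_of_mem _ hb)
      obtain ⟨n, hn⟩ := (h (a, b)).1 (hL b List.mem_cons_self)
      refine ⟨max N (n + 1), fun c hc => ?_⟩
      rcases List.mem_cons.1 hc with rfl | hc
      · exact ⟨n, by omega, hn⟩
      · obtain ⟨k, hk, hq⟩ := hN c hc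
        exact ⟨k, by omega, hq⟩
  simp only [List.mem_range]
  refine ⟨key _, ?_⟩
  rintro ⟨N, hN⟩ b hb
  obtain ⟨n, -, hn⟩ := hN b hb
  exact (h (a, b)).2 ⟨n, hn⟩

theorem forall_lt {p : α → ℕ → Prop} {N : α → ℕ} (hN : Primrec N)
    (hp : RecEnum fun x : α × ℕ => p x.1 x.2) : RecEnum fun a => ∀ n < N a, p a n :=
  (forall_mem (l := fun a => List.range (N a)) (Primrec.list_range.comp hN) hp).of_iff
    fun a => by simp

@[fun_prop] theorem eq [DecidableEq β] {f g : α → β} (hf : Primrec f) (hg : Primrec g) :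
    RecEnum fun a => f a = g a :=
  of_primrec (Primrec.eq.comp hf hg)

@[fun_prop] theorem ne [DecidableEq β] {f g : α → β} (hf : Primrec f) (hg : Primrec g) :
    RecEnum fun a => f a ≠ g a :=
  of_primrec (PrimrecPred.not (Primrec.eq.comp hf hg))

@[fun_prop] theorem lt {f g : α → ℕ} (hf : Primrec f) (hg : Primrec g) :
    RecEnum fun a => f a < g a :=
  of_primrec (Primrec.nat_lt.comp hf hg)

@[fun_prop] theorem le {f g : α → ℕ} (hf : Primrec f) (hg : Primrec g) :
    RecEnum fun a => f a ≤ g a :=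
  of_primrec (Primrec.nat_le.comp hf hg)

@[fun_prop] theorem mem_list [DecidableEq β] {f : α → β} {l : α → List β} (hf : Primrec f)
    (hl : Primrec l) : RecEnum fun a => f a ∈ l a := by
  have h : PrimrecRel fun (L : List β) (b : β) => ∃ c ∈ L, c = b :=
    PrimrecRel.exists_mem_list (R := fun c b => c = b) Primrec.eq
  exact of_primrec ((h.comp hl hf).of_eq fun a => by simp)

/-- The graph of a partial recursive function is recursively enumerable. -/
theorem of_partrec {f : α →. β} (hf : Partrec f) : RecEnum fun x : α × β => x.2 ∈ f x.1 := by
  obtain ⟨c, hc⟩ := Nat.Partrec.Code.exists_code.1 hf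
  have h0 : Primrec fun x : (α × β) × ℕ =>
      Nat.Partrec.Code.evaln x.2 c (Encodable.encode x.1.1) := by
    have h1 : Primrec (Encodable.encode : α → ℕ) := Primrec.encode
    exact Nat.Partrec.Code.primrec_evaln.comp (by fun_prop :
      Primrec fun x : (α × β) × ℕ => ((x.2, c), Encodable.encode x.1.1))
  have h1 : Primrec (Encodable.encode : β → ℕ) := Primrec.encode
  refine ⟨fun x => Nat.Partrec.Code.evaln x.2 c (Encodable.encode x.1.1) =
    some (Encodable.encode x.1.2), Primrec.eq.comp h0 (by fun_prop), ?_⟩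
  rintro ⟨a, b⟩
  have := fun x => Nat.Partrec.Code.evaln_complete (c := c) (n := Encodable.encode a) (x := x)
  simp only [Option.mem_def] at this
  dsimp only
  rw [← this, hc]
  simp

/-- A predicate is decided on a promise by running in parallel semi-decision procedures for the
predicate and for its negation. -/
theorem decidableOn {dom q p r : α → Prop} (hp : RecEnum p) (hr : RecEnum r)
    (h1 : ∀ a, dom a → (p a ↔ q a)) (h2 : ∀ a, dom a → (r a ↔ ¬ q a)) : DecidableOn dom q := by
  obtain ⟨p', hp', h⟩ := hp
  obtain ⟨r', hr', h'⟩ := hr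
  classical
  let g : α → ℕ → Option Bool := fun a n =>
    bif decide (p' (a, n)) then some true else bif decide (r' (a, n)) then some false else none
  have hg : Primrec fun x : α × ℕ => g x.1 x.2 := by
    have e1 : Primrec fun x => decide (p' x) := hp'.decide
    have e2 : Primrec fun x => decide (r' x) := hr'.decide
    simp only [g]
    fun_prop
  refine ⟨fun a => Nat.rfindOpt (g a), Partrec.rfindOpt hg.to_comp, fun a ha => ?_⟩
  have hdom : (Nat.rfindOpt (g a)).Dom := by
    rw [Nat.rfindOpt_dom]
    by_cases hq : q a
    · obtain ⟨n, hn⟩ := (h a).1 ((h1 a ha).2 hq)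
      exact ⟨n, true, by simp [g, hn]⟩
    · obtain ⟨n, hn⟩ := (h' a).1 ((h2 a ha).2 hq)
      by_cases hp : p' (a, n)
      · exact ⟨n, true, by simp [g, hp]⟩
      · exact ⟨n, false, by simp [g, hp, hn]⟩
  refine ⟨_, Part.get_mem hdom, ?_⟩
  obtain ⟨n, hn⟩ := Nat.rfindOpt_spec (Part.get_mem hdom)
  generalize (Nat.rfindOpt (g a)).get hdom = b at hn
  by_cases hp : p' (a, n)
  · have : q a := (h1 a ha).1 ((h a).2 ⟨n, hp⟩)
    simp [g, hp] at hn
    simp [← hn, this]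
  · by_cases hr : r' (a, n)
    · have : ¬ q a := (h2 a ha).1 ((h' a).2 ⟨n, hr⟩)
      simp [g, hp, hr] at hn
      simp [← hn, this]
    · simp [g, hp, hr] at hn

end RecEnum

/-! ### Words and presentations -/

/-- Substitution of words for the letters of a word. -/
def wordSubst {κ μ : Type} (u : κ → List (μ × Bool)) (w : List (κ × Bool)) : List (μ × Bool) :=
  w.flatMap fun x => bif x.2 then u x.1 else FreeGroup.invRev (u x.1)

section Words
variable {κ μ : Type}

theorem mk_append (v w : List (κ × Bool)) :
    FreeGroup.mk (v ++ w) = FreeGroup.mk v * FreeGroup.mk w := by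
  rw [FreeGroup.mul_mk]

theorem mk_cons (x : κ × Bool) (w : List (κ × Bool)) :
    FreeGroup.mk (x :: w) = FreeGroup.mk [x] * FreeGroup.mk w := by
  rw [FreeGroup.mul_mk]; rfl

theorem mk_invRev (w : List (κ × Bool)) :
    FreeGroup.mk (FreeGroup.invRev w) = (FreeGroup.mk w)⁻¹ := FreeGroup.inv_mk.symm

theorem mk_singleton_true (k : κ) : FreeGroup.mk [(k, true)] = FreeGroup.of k := rfl

theorem mk_singleton_false (k : κ) : FreeGroup.mk [(k, false)] = (FreeGroup.of k)⁻¹ := rfl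

theorem mk_wordSubst (u : κ → List (μ × Bool)) (w : List (κ × Bool)) :
    FreeGroup.mk (wordSubst u w) =
      FreeGroup.lift (fun k => FreeGroup.mk (u k)) (FreeGroup.mk w) := by
  induction w with
  | nil => rfl
  | cons x w ih =>
    obtain ⟨k, b⟩ := x
    have : wordSubst u ((k, b) :: w) =
        (bif b then u k else FreeGroup.invRev (u k)) ++ wordSubst u w := rfl
    rw [this, mk_append, mk_cons, map_mul, ih]
    cases b <;> simp [mk_invRev, mk_singleton_true, mk_singleton_false, -FreeGroup.inv_mk]

theorem lift_mk_wordSubst {G : Type*} [Group G] (a : μ → G) (u : κ → List (μ × Bool))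
    (w : List (κ × Bool)) : FreeGroup.lift a (FreeGroup.mk (wordSubst u w)) =
      FreeGroup.lift (fun k => FreeGroup.lift a (FreeGroup.mk (u k))) (FreeGroup.mk w) := by
  rw [mk_wordSubst]
  exact DFunLike.congr_fun (f := (FreeGroup.lift a).comp (FreeGroup.lift _))
    (FreeGroup.ext_hom _ _ (by intro k; simp)) (FreeGroup.mk w)

theorem exists_mk_eq (g : FreeGroup κ) : ∃ w, FreeGroup.mk w = g := Quot.exists_rep g

end Words

section PrimrecWords
variable {α κ μ : Type} [Primcodable α] [Primcodable κ] [Primcodable μ]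

@[fun_prop] theorem primrec_invRev {f : α → List (κ × Bool)} (hf : Primrec f) :
    Primrec fun a => FreeGroup.invRev (f a) := by
  unfold FreeGroup.invRev
  fun_prop

@[fun_prop] theorem primrec_wordSubst {f : α → List (κ × Bool)} {u : α → κ → List (μ × Bool)}
    (hf : Primrec f) (hu : Primrec fun x : α × κ => u x.1 x.2) :
    Primrec fun a => wordSubst (u a) (f a) := by
  unfold wordSubst
  have h : Primrec fun x : α × κ × Bool => u x.1 x.2.1 :=
    hu.comp (by fun_prop : Primrec fun x : α × κ × Bool => (x.1, x.2.1))
  fun_prop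

theorem primrec_reduce [DecidableEq κ] :
    Primrec (FreeGroup.reduce : List (κ × Bool) → List (κ × Bool)) := by
  let step : (κ × Bool) × List (κ × Bool) → List (κ × Bool) := fun x =>
    List.casesOn x.2 [x.1] fun hd tl => if x.1.1 = hd.1 ∧ x.1.2 = !hd.2 then tl else x.1 :: hd :: tl
  have h : Primrec step := by
    refine Primrec.list_casesOn (f := fun x => x.2)
      (h := fun (x : (κ × Bool) × List (κ × Bool)) y =>
        if x.1.1 = y.1.1 ∧ x.1.2 = !y.1.2 then y.2 else x.1 :: y.1 :: y.2)
      (by fun_prop) (g := fun x => [x.1]) (by fun_prop) ?_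
    refine Primrec.ite (c := fun z : ((κ × Bool) × List (κ × Bool)) × (κ × Bool) ×
      List (κ × Bool) => z.1.1.1 = z.2.1.1 ∧ z.1.1.2 = !z.2.1.2) ?_ (by fun_prop) (by fun_prop)
    exact (Primrec.eq.comp (f := fun z : ((κ × Bool) × List (κ × Bool)) × (κ × Bool) ×
      List (κ × Bool) => z.1.1.1) (by fun_prop) (by fun_prop)).and
      (Primrec.eq.comp (f := fun z : ((κ × Bool) × List (κ × Bool)) × (κ × Bool) ×
      List (κ × Bool) => z.1.1.2) (by fun_prop) (by fun_prop))
  refine (Primrec.list_foldr (f := fun w : List (κ × Bool) => w) (g := fun _ => [])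
    (h := fun _ x => step x)
    (by fun_prop) (by fun_prop) (h.comp Primrec.snd)).of_eq fun w => ?_
  induction w with
  | nil => rfl
  | cons x w ih =>
    rw [List.foldr_cons, FreeGroup.reduce.cons, ih]

/-- Membership in the subgroup of a free group generated by a recursively enumerable set. -/
theorem recEnum_mem_closure [DecidableEq κ] {S : α → List (κ × Bool) → Prop}
    (hS : RecEnum fun x : α × List (κ × Bool) => S x.1 x.2) :
    RecEnum fun x : α × List (κ × Bool) =>
      FreeGroup.mk x.2 ∈ Subgroup.closure {g | ∃ u, S x.1 u ∧ g = FreeGroup.mk u} := by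
  have hr : Primrec (FreeGroup.reduce : List (κ × Bool) → List (κ × Bool)) := primrec_reduce
  have h : RecEnum fun x : α × List (κ × Bool) => ∃ l : List (List (κ × Bool) × Bool),
      (∀ y ∈ l, S x.1 y.1) ∧ FreeGroup.reduce x.2 =
        FreeGroup.reduce (l.flatMap fun y => bif y.2 then y.1 else FreeGroup.invRev y.1) := by
    apply RecEnum.ex
    apply RecEnum.and
    · apply RecEnum.forall_mem (by fun_prop)
      exact hS.comp (by fun_prop :
        Primrec fun x : ((α × List (κ × Bool)) × List (List (κ × Bool) × Bool)) ×
          (List (κ × Bool) × Bool) => (x.1.1.1, x.2.1))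
    · fun_prop
  refine h.of_iff ?_
  rintro ⟨a, w⟩
  dsimp only
  constructor
  · intro hw
    suffices ∀ g ∈ Subgroup.closure {g | ∃ u, S a u ∧ g = FreeGroup.mk u},
        ∃ l : List (List (κ × Bool) × Bool), (∀ y ∈ l, S a y.1) ∧ g =
          FreeGroup.mk (l.flatMap fun y => bif y.2 then y.1 else FreeGroup.invRev y.1) by
      obtain ⟨l, hl, e⟩ := this _ hw
      exact ⟨l, hl, FreeGroup.reduce.sound e⟩
    intro g hg
    induction hg using Subgroup.closure_induction with
    | mem x hx =>
      obtain ⟨u, hu, rfl⟩ := hx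
      exact ⟨[(u, true)], by simpa using hu, by simp⟩
    | one => exact ⟨[], by simp, rfl⟩
    | mul x y _ _ hx hy =>
      obtain ⟨l, hl, rfl⟩ := hx
      obtain ⟨m, hm, rfl⟩ := hy
      refine ⟨l ++ m, ?_, by simp [mk_append, -FreeGroup.mul_mk]⟩
      simp only [List.mem_append]
      rintro y (hy | hy)
      exacts [hl _ hy, hm _ hy]
    | inv x hx' hx =>
      clear hx'
      obtain ⟨l, hl, rfl⟩ := hx
      refine ⟨(l.map fun y => (y.1, !y.2)).reverse, ?_, ?_⟩
      · simp only [List.mem_reverse, List.mem_map]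
        rintro _ ⟨y, hy, rfl⟩
        exact hl y hy
      · clear hl
        induction l with
        | nil => rfl
        | cons y l ih =>
          obtain ⟨u, b⟩ := y
          rw [List.flatMap_cons, mk_append, mul_inv_rev, ih, List.map_cons, List.reverse_cons,
            List.flatMap_append, mk_append]
          cases b <;> simp [mk_invRev, -FreeGroup.inv_mk]
  · rintro ⟨l, hl, e⟩
    have e' : FreeGroup.mk w =
        FreeGroup.mk (l.flatMap fun y => bif y.2 then y.1 else FreeGroup.invRev y.1) := by
      rw [← FreeGroup.reduce.self, e, FreeGroup.reduce.self]
    rw [e']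
    clear e e'
    induction l with
    | nil => exact one_mem _
    | cons y l ih =>
      obtain ⟨u, b⟩ := y
      rw [List.flatMap_cons, mk_append]
      have hu := Subgroup.subset_closure (k := {g | ∃ u, S a u ∧ g = FreeGroup.mk u})
        ⟨u, hl _ List.mem_cons_self, rfl⟩
      refine mul_mem ?_ (ih fun y hy => hl y (List.mem_cons_of_mem _ hy))
      cases b
      · simpa [mk_invRev, -FreeGroup.inv_mk] using hu
      · simpa using hu

/-- The word problem for recursively presented groups is recursively enumerable. -/
theorem recEnum_mem_normalClosure [DecidableEq κ] {R : α → List (κ × Bool) → Prop}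
    (hR : RecEnum fun x : α × List (κ × Bool) => R x.1 x.2) :
    RecEnum fun x : α × List (κ × Bool) =>
      FreeGroup.mk x.2 ∈ Subgroup.normalClosure {g | ∃ u, R x.1 u ∧ g = FreeGroup.mk u} := by
  have h : RecEnum fun x : α × List (κ × Bool) => ∃ c r, R x.1 r ∧
      x.2 = c ++ r ++ FreeGroup.invRev c := by
    apply RecEnum.ex
    apply RecEnum.ex
    apply RecEnum.and _ (by fun_prop)
    exact hR.comp (by fun_prop : Primrec fun x : ((α × List (κ × Bool)) × List (κ × Bool)) ×
      List (κ × Bool) => (x.1.1.1, x.2))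
  refine (recEnum_mem_closure (S := fun a u => ∃ c r, R a r ∧
    u = c ++ r ++ FreeGroup.invRev c) h).of_iff ?_
  rintro ⟨a, w⟩
  have : Group.conjugatesOfSet {g | ∃ u, R a u ∧ g = FreeGroup.mk u} =
      {g | ∃ u, (∃ c r, R a r ∧ u = c ++ r ++ FreeGroup.invRev c) ∧ g = FreeGroup.mk u} := by
    ext g
    simp only [Group.mem_conjugatesOfSet_iff, isConj_iff, Set.mem_ofPred_eq]
    constructor
    · rintro ⟨_, ⟨r, hr, rfl⟩, c, rfl⟩
      obtain ⟨c, rfl⟩ := exists_mk_eq c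
      exact ⟨_, ⟨c, r, hr, rfl⟩, by
        simp [mk_append, mk_invRev, mul_assoc, -FreeGroup.mul_mk, -FreeGroup.inv_mk]⟩
    · rintro ⟨_, ⟨c, r, hr, rfl⟩, rfl⟩
      exact ⟨_, ⟨r, hr, rfl⟩, FreeGroup.mk c, by
        simp [mk_append, mk_invRev, mul_assoc, -FreeGroup.mul_mk, -FreeGroup.inv_mk]⟩
  dsimp only
  rw [Subgroup.normalClosure, this]

end PrimrecWords

namespace FinPres

/-- The quotient map from the free group on all letters to a finitely presented group. -/
def hom (p : FinPres) : FreeGroup ℕ →* p.Pres :=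
  (PresentedGroup.mk p.rels).comp
    (FreeGroup.lift (fun k : ℕ => if h : k < p.1 then FreeGroup.of (⟨k, h⟩ : Fin p.1) else 1))

theorem elt_eq (p : FinPres) (w : Word) : p.elt w = p.hom (FreeGroup.mk w) := rfl

theorem elt_surjective (p : FinPres) : Function.Surjective p.elt := by
  intro g
  obtain ⟨x, rfl⟩ := PresentedGroup.mk_surjective p.rels g
  obtain ⟨y, hy⟩ : ∃ y : FreeGroup ℕ, FreeGroup.lift (fun k : ℕ => if h : k < p.1 then
      FreeGroup.of (⟨k, h⟩ : Fin p.1) else 1) y = x := by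
    refine ⟨FreeGroup.map Fin.val x, ?_⟩
    rw [← MonoidHom.comp_apply]
    conv_rhs => rw [← MonoidHom.id_apply (FreeGroup (Fin p.1)) x]
    congr 1
    ext k
    simp
  obtain ⟨w, rfl⟩ := exists_mk_eq y
  exact ⟨w, by rw [elt_eq]; simp only [hom, MonoidHom.comp_apply, hy]⟩

@[simp] theorem elt_nil (p : FinPres) : p.elt [] = 1 := p.hom.map_one

@[simp] theorem elt_append (p : FinPres) (v w : Word) : p.elt (v ++ w) = p.elt v * p.elt w := by
  rw [elt_eq, mk_append, map_mul]; rfl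

@[simp] theorem elt_invRev (p : FinPres) (w : Word) : p.elt (FreeGroup.invRev w) = (p.elt w)⁻¹ := by
  rw [elt_eq, mk_invRev, map_inv]; rfl

theorem elt_wordSubst (p : FinPres) (u : ℕ → Word) (w : Word) : p.elt (wordSubst u w) =
    FreeGroup.lift (fun k => p.elt (u k)) (FreeGroup.mk w) := by
  rw [elt_eq, mk_wordSubst]
  exact DFunLike.congr_fun (f := p.hom.comp (FreeGroup.lift _))
    (FreeGroup.ext_hom _ _ (by intro k; simp; rfl)) (FreeGroup.mk w)

/-- A homomorphism is determined by the images of the generators. -/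
theorem map_elt {G : Type*} [Group G] (p : FinPres) (f : p.Pres →* G) (w : Word) :
    f (p.elt w) = FreeGroup.lift (fun k => f (p.elt [(k, true)])) (FreeGroup.mk w) := by
  rw [elt_eq]
  exact DFunLike.congr_fun (f := f.comp p.hom)
    (FreeGroup.ext_hom _ _ (by intro k; simp; rfl)) (FreeGroup.mk w)

theorem elt_eq_one_of_le (p : FinPres) {k : ℕ} (h : p.1 ≤ k) : p.elt [(k, true)] = 1 := by
  rw [elt_eq, mk_singleton_true]
  simp [hom, Nat.not_lt.2 h]

theorem elt_eq_one_of_mem (p : FinPres) {r : Word} (h : r ∈ p.2) : p.elt r = 1 :=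
  (PresentedGroup.one_of_mem (rels := p.rels) ⟨r, h, rfl⟩)

theorem of_eq_elt (p : FinPres) (k : Fin p.1) :
    PresentedGroup.of (rels := p.rels) k = p.elt [((k : ℕ), true)] := by
  rw [elt_eq, mk_singleton_true]
  simp [hom]
  rfl

/-- The universal property of a finite presentation, in terms of words. -/
theorem exists_hom {G : Type*} [Group G] (p : FinPres) (a : ℕ → G) (ha : ∀ k, p.1 ≤ k → a k = 1)
    (h : ∀ r ∈ p.2, FreeGroup.lift a (FreeGroup.mk r) = 1) :
    ∃ f : p.Pres →* G, ∀ w, f (p.elt w) = FreeGroup.lift a (FreeGroup.mk w) := by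
  have key : ∀ x : FreeGroup ℕ, FreeGroup.lift (fun k : Fin p.1 => a k)
      (FreeGroup.lift (fun k : ℕ => if h : k < p.1 then
        FreeGroup.of (⟨k, h⟩ : Fin p.1) else 1) x) = FreeGroup.lift a x := fun x =>
    DFunLike.congr_fun (f := (FreeGroup.lift _).comp (FreeGroup.lift _)) (FreeGroup.ext_hom _ _ (by
      intro k
      by_cases hk : k < p.1
      · simp [hk]
      · simp [hk, ha k (not_lt.1 hk)])) x
  refine ⟨PresentedGroup.toGroup (f := fun k : Fin p.1 => a k) ?_, fun w => key _⟩
  rintro _ ⟨w, hw, rfl⟩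
  exact (key _).trans (h w hw)

theorem hom_ext {G : Type*} [Group G] {p : FinPres} {f g : p.Pres →* G}
    (h : ∀ k < p.1, f (p.elt [(k, true)]) = g (p.elt [(k, true)])) : f = g := by
  refine PresentedGroup.ext fun k => ?_
  rw [of_eq_elt]
  exact h k k.2

/-- The word problem, in the free group on all letters: the letters which are not among the
generators are additional relators. -/
theorem elt_eq_one_iff (p : FinPres) (w : Word) : p.elt w = 1 ↔ FreeGroup.mk w ∈
    Subgroup.normalClosure {g | ∃ u, (u ∈ p.2 ∨ ∃ k, p.1 ≤ k ∧ u = [(k, true)]) ∧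
      g = FreeGroup.mk u} := by
  set N := Subgroup.normalClosure {g | ∃ u, (u ∈ p.2 ∨ ∃ k, p.1 ≤ k ∧ u = [(k, true)]) ∧
      g = FreeGroup.mk u}
  constructor
  · intro h
    have e : ∀ x : FreeGroup ℕ, FreeGroup.lift (fun k => QuotientGroup.mk' N (FreeGroup.of k)) x =
        QuotientGroup.mk' N x := fun x =>
      DFunLike.congr_fun (FreeGroup.ext_hom _ _ (by intro k; simp)) x
    obtain ⟨f, hf⟩ := p.exists_hom (fun k => QuotientGroup.mk' N (FreeGroup.of k)) (by
        intro k hk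
        exact (QuotientGroup.eq_one_iff _).2
          (Subgroup.subset_normalClosure ⟨_, Or.inr ⟨k, hk, rfl⟩, rfl⟩)) (by
        intro r hr
        rw [e]
        exact (QuotientGroup.eq_one_iff _).2
          (Subgroup.subset_normalClosure ⟨_, Or.inl hr, rfl⟩))
    have := hf w
    rw [h, map_one, e] at this
    exact (QuotientGroup.eq_one_iff _).1 this.symm
  · intro h
    have : N ≤ p.hom.ker := Subgroup.normalClosure_le_normal (by
      rintro _ ⟨u, hu | ⟨k, hk, rfl⟩, rfl⟩
      · exact p.elt_eq_one_of_mem hu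
      · exact p.elt_eq_one_of_le hk)
    exact this h

/-- Membership in a subgroup, in terms of words: the word is equal to a product of generators. -/
theorem mem_gen_iff (p : FinPres) (Y : List Word) (w : Word) : p.elt w ∈ p.gen Y ↔
    ∃ u, FreeGroup.mk u ∈ Subgroup.closure {g | ∃ y, y ∈ Y ∧ g = FreeGroup.mk y} ∧
      p.elt (FreeGroup.invRev u ++ w) = 1 := by
  have e : p.gen Y = (Subgroup.closure {g | ∃ y, y ∈ Y ∧ g = FreeGroup.mk y}).map p.hom := by
    rw [gen, MonoidHom.map_closure]
    congr 1
    ext g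
    constructor
    · rintro ⟨w, hw, rfl⟩
      exact ⟨_, ⟨w, hw, rfl⟩, rfl⟩
    · rintro ⟨_, ⟨w, hw, rfl⟩, rfl⟩
      exact ⟨w, hw, rfl⟩
  rw [e]
  constructor
  · rintro ⟨x, hx, h⟩
    obtain ⟨u, rfl⟩ := exists_mk_eq x
    refine ⟨u, hx, ?_⟩
    rw [elt_append, elt_invRev, ← h, elt_eq]
    simp
  · rintro ⟨u, hu, h⟩
    refine ⟨_, hu, ?_⟩
    rw [elt_append, elt_invRev, inv_mul_eq_one] at h
    exact h

section
variable {α : Type} [Primcodable α]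

theorem recEnum_elt_eq_one : RecEnum fun x : FinPres × Word => x.1.elt x.2 = 1 := by
  have h : RecEnum fun x : FinPres × Word =>
      x.2 ∈ x.1.2 ∨ ∃ k, x.1.1 ≤ k ∧ x.2 = [(k, true)] := by fun_prop
  exact (recEnum_mem_normalClosure (R := fun (p : FinPres) (u : Word) =>
    u ∈ p.2 ∨ ∃ k, p.1 ≤ k ∧ u = [(k, true)]) h).of_iff fun x => elt_eq_one_iff _ _

@[fun_prop] theorem recEnum_elt_eq {p : α → FinPres} {v w : α → Word} (hp : Primrec p)
    (hv : Primrec v) (hw : Primrec w) : RecEnum fun a => (p a).elt (v a) = (p a).elt (w a) :=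
  (recEnum_elt_eq_one.comp (by fun_prop :
    Primrec fun a => (p a, FreeGroup.invRev (v a) ++ w a))).of_iff fun a => by
      simp [inv_mul_eq_one]

@[fun_prop] theorem recEnum_mem_gen {p : α → FinPres} {Y : α → List Word} {w : α → Word}
    (hp : Primrec p) (hY : Primrec Y) (hw : Primrec w) :
    RecEnum fun a => (p a).elt (w a) ∈ (p a).gen (Y a) := by
  have h1 : RecEnum fun x : List Word × Word =>
      FreeGroup.mk x.2 ∈ Subgroup.closure {g | ∃ y, y ∈ x.1 ∧ g = FreeGroup.mk y} :=
    recEnum_mem_closure (S := fun (Y : List Word) y => y ∈ Y) (by fun_prop)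
  have h : RecEnum fun a => ∃ u,
      FreeGroup.mk u ∈ Subgroup.closure {g | ∃ y, y ∈ Y a ∧ g = FreeGroup.mk y} ∧
        (p a).elt (FreeGroup.invRev u ++ w a) = 1 := by
    apply RecEnum.ex
    apply RecEnum.and
    · exact RecEnum.comp (f := fun x : α × Word => (Y x.1, x.2)) h1 (by fun_prop)
    · exact RecEnum.comp (f := fun x : α × Word => (p x.1, FreeGroup.invRev x.2 ++ w x.1))
        recEnum_elt_eq_one (by fun_prop)
  exact h.of_iff fun a => mem_gen_iff _ _ _

end

end FinPres

/-! ### Extending partial permutation representations -/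

/-- A bijective relation is the graph of an equivalence. -/
theorem exists_equiv_of_rel {A B : Type} (E : A → B → Prop) (h1 : ∀ a, ∃ b, E a b)
    (h2 : ∀ b, ∃ a, E a b) (h3 : ∀ a b b', E a b → E a b' → b = b')
    (h4 : ∀ a a' b, E a b → E a' b → a = a') : ∃ e : A ≃ B, ∀ a b, E a b → e a = b := by
  choose f hf using h1
  refine ⟨Equiv.ofBijective f ⟨fun a a' h => h4 _ _ _ (hf a) (h ▸ hf a'), fun b => ?_⟩,
    fun a b h => h3 _ _ _ (hf a) h⟩
  obtain ⟨a, ha⟩ := h2 b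
  exact ⟨a, h3 _ _ _ (hf a) ha⟩

section CantorBernstein
variable {H A B : Type} [Group H] [MulAction H A] [MulAction H B]

/-- The points outside the domain of `D` whose backward orbit under the two injections `f`, `g` of a
Cantor–Bernstein situation stops in `A`. -/
inductive StopsLeft (D : A → B → Prop) (f : A → B) (g : B → A) : A → Prop
  | base (a : A) (ha : ¬ ∃ b, D a b) (hg : ∀ b, (¬ ∃ a, D a b) → g b ≠ a) : StopsLeft D f g a
  | step (a : A) (ha : StopsLeft D f g a) : StopsLeft D f g (g (f a))

/-- An equivariant Cantor–Bernstein theorem, relative to a partial equivariant bijection `D`. -/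
theorem exists_equivariant_equiv (D : A → B → Prop)
    (hD : ∀ (h : H) a b, D a b → D (h • a) (h • b)) (hD1 : ∀ a b b', D a b → D a b' → b = b')
    (hD2 : ∀ a a' b, D a b → D a' b → a = a') (f : A → B) (hf : Function.Injective f)
    (hfe : ∀ (h : H) a, f (h • a) = h • f a) (hfD : ∀ a a', ¬ D a' (f a)) (g : B → A)
    (hg : Function.Injective g) (hge : ∀ (h : H) b, g (h • b) = h • g b)
    (hgD : ∀ b b', ¬ D (g b) b') :
    ∃ e : A ≃ B, (∀ (h : H) a, e (h • a) = h • e a) ∧ ∀ a b, D a b → e a = b := by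
  have hD' : ∀ (h : H) a b, D (h • a) (h • b) → D a b := fun h a b hab => by
    simpa using hD h⁻¹ _ _ hab
  have hdom : ∀ (h : H) a, (∃ b, D (h • a) b) → ∃ b, D a b := fun h a ⟨b, hb⟩ =>
    ⟨h⁻¹ • b, hD' h _ _ (by simpa using hb)⟩
  have hran : ∀ (h : H) b, (∃ a, D a (h • b)) → ∃ a, D a b := fun h b ⟨a, ha⟩ =>
    ⟨h⁻¹ • a, hD' h _ _ (by simpa using ha)⟩
  have hleft : ∀ (h : H) a, StopsLeft D f g a → StopsLeft D f g (h • a) := by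
    intro h a ha
    induction ha with
    | base a ha hb =>
      refine .base _ (fun hd => ha (hdom h a hd)) fun b hbD e => ?_
      refine hb (h⁻¹ • b) (fun hr => hbD (hran _ _ hr)) ?_
      rw [hge, e, inv_smul_smul]
    | step a _ ih => rw [← hge, ← hfe]; exact .step _ ih
  have hleft' : ∀ (h : H) a, StopsLeft D f g (h • a) → StopsLeft D f g a := fun h a ha => by
    simpa using hleft h⁻¹ _ ha
  have hnd : ∀ a, StopsLeft D f g a → ¬ ∃ b, D a b := by
    rintro a (⟨_, ha, _⟩ | ⟨a, _⟩)
    · exact ha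
    · exact fun ⟨b, hb⟩ => hgD _ _ hb
  let E : A → B → Prop := fun a b => D a b ∨ (StopsLeft D f g a ∧ f a = b) ∨
    ((¬ ∃ b, D a b) ∧ (¬ ∃ a, D a b) ∧ ¬ StopsLeft D f g a ∧ g b = a)
  obtain ⟨e, he⟩ := exists_equiv_of_rel E (by
      intro a
      by_cases h1 : ∃ b, D a b
      · exact ⟨_, Or.inl h1.choose_spec⟩
      · by_cases h2 : StopsLeft D f g a
        · exact ⟨_, Or.inr (Or.inl ⟨h2, rfl⟩)⟩
        · by_contra hcon
          refine h2 (.base a h1 fun b hb e => hcon ⟨b, Or.inr (Or.inr ⟨h1, hb, h2, e⟩)⟩)) (by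
      intro b
      by_cases h1 : ∃ a, D a b
      · exact ⟨_, Or.inl h1.choose_spec⟩
      · by_cases h2 : StopsLeft D f g (g b)
        · generalize hx : g b = x at h2
          cases h2 with
          | base _ _ h => exact absurd hx (h b h1)
          | step a ha => exact ⟨a, Or.inr (Or.inl ⟨ha, (hg hx).symm⟩)⟩
        · exact ⟨g b, Or.inr (Or.inr ⟨fun ⟨b', h⟩ => hgD _ _ h, h1, h2, rfl⟩)⟩) (by
      rintro a b b' (h | ⟨h1, h⟩ | ⟨h1, h2, h3, h⟩) (h' | ⟨h1', h'⟩ | ⟨h1', h2', h3', h'⟩)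
      · exact hD1 _ _ _ h h'
      · exact absurd ⟨_, h⟩ (hnd _ h1')
      · exact absurd ⟨_, h⟩ h1'
      · exact absurd ⟨_, h'⟩ (hnd _ h1)
      · exact h.symm.trans h'
      · exact absurd h1 h3'
      · exact absurd ⟨_, h'⟩ h1
      · exact absurd h1' h3
      · exact hg (h.trans h'.symm)) (by
      rintro a a' b (h | ⟨h1, h⟩ | ⟨h1, h2, h3, h⟩) (h' | ⟨h1', h'⟩ | ⟨h1', h2', h3', h'⟩)
      · exact hD2 _ _ _ h h'
      · subst h'; exact absurd h (hfD _ _)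
      · exact absurd ⟨_, h⟩ h2'
      · subst h; exact absurd h' (hfD _ _)
      · exact hf (h.trans h'.symm)
      · subst h; subst h'; exact absurd (.step a h1) h3'
      · exact absurd ⟨_, h'⟩ h2
      · subst h'; subst h; exact absurd (.step a' h1') h3
      · exact h.symm.trans h')
  refine ⟨e, fun h a => ?_, fun a b h => he _ _ (Or.inl h)⟩
  have hE : ∀ a, E a (e a) := by
    intro a
    obtain ⟨b, hb⟩ : ∃ b, E a b := by
      by_cases h1 : ∃ b, D a b
      · exact ⟨_, Or.inl h1.choose_spec⟩
      · by_cases h2 : StopsLeft D f g a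
        · exact ⟨_, Or.inr (Or.inl ⟨h2, rfl⟩)⟩
        · by_contra hcon
          refine h2 (.base a h1 fun b hb e => hcon ⟨b, Or.inr (Or.inr ⟨h1, hb, h2, e⟩)⟩)
    rw [he _ _ hb]
    exact hb
  refine he _ _ ?_
  rcases hE a with h' | ⟨h1', h'⟩ | ⟨h1', h2', h3', h'⟩
  · exact Or.inl (hD _ _ _ h')
  · exact Or.inr (Or.inl ⟨hleft _ _ h1', by rw [hfe, h']⟩)
  · exact Or.inr (Or.inr ⟨fun hd => h1' (hdom _ _ hd), fun hr => h2' (hran _ _ hr),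
      fun hs => h3' (hleft' _ _ hs), by rw [hge, h']⟩)

end CantorBernstein

section Universal
open scoped Pointwise
variable {H A M W : Type} [Group H] [Group M] [MulAction H A]

/-- Copies of the power set of `M`, indexed by a set `W` which is at least as large as `A`, contain
every `H`-set `A`, for every subgroup `H` of `M`: a point is sent to the set of all `h` that move
the representative of its orbit to the point. -/
theorem exists_equivariant_embedding (ι : H →* M) (hι : Function.Injective ι) (κ : A → W)
    (hκ : Function.Injective κ) : ∃ f : A → (Σ _ : W, Set M), Function.Injective f ∧
      ∀ (h : H) a, f (h • a) = ι h • f a := by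
  let r : A → A := fun a => (Quotient.mk (MulAction.orbitRel H A) a).out
  have hr : ∀ a, ∃ h : H, h • r a = a := fun a =>
    MulAction.orbitRel_apply.1 ((MulAction.orbitRel H A).symm
      (Quotient.mk_out (s := MulAction.orbitRel H A) a))
  have hr' : ∀ (h : H) a, r (h • a) = r a := by
    intro h a
    have : (Quotient.mk (MulAction.orbitRel H A) (h • a)) = Quotient.mk _ a :=
      Quotient.sound (MulAction.orbitRel_apply.2 ⟨h, rfl⟩)
    simp only [r, this]
  refine ⟨fun a => ⟨κ (r a), ι '' {h | h • r a = a}⟩, fun a a' e => ?_, fun h a => ?_⟩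
  · simp only [Sigma.mk.injEq, heq_eq_eq] at e
    obtain ⟨e1, e2⟩ := e
    obtain ⟨h, hh⟩ := hr a
    have : ι h ∈ ι '' {h | h • r a' = a'} := e2 ▸ ⟨h, hh, rfl⟩
    obtain ⟨k, hk, e⟩ := this
    obtain rfl := hι e
    rw [← hh, ← hk, hκ e1]
  · simp only [hr', Sigma.smul_mk]
    congr 1
    ext m
    simp only [Set.mem_smul_set, Set.mem_image, Set.mem_ofPred_eq, exists_exists_and_eq_and]
    constructor
    · rintro ⟨k, hk, rfl⟩
      refine ⟨h⁻¹ * k, by rw [mul_smul, hk, inv_smul_smul], by simp⟩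
    · rintro ⟨k, hk, rfl⟩
      exact ⟨h * k, by rw [mul_smul, hk], by simp⟩

end Universal

section Completion
open scoped Pointwise
open Cardinal
variable {V E X : Type} {M Q : V → Type} {H : E → Type} [∀ v, Group (M v)] [∀ e, Group (H e)]
  [∀ v, MulAction (M v) (Q v)] {src tgt : E → V}

/-- A folded partial permutation representation of a graph of groups extends to a permutation
representation.  Here `X` is a set of points, which for every vertex is embedded in a set with an
action of the vertex group, and `L e x x'` says that the stable letter of `e` maps `x` to `x'`. -/
theorem exists_perm_extension (α : ∀ e, H e →* M (src e)) (β : ∀ e, H e →* M (tgt e))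
    (hα : ∀ e, Function.Injective (α e)) (hβ : ∀ e, Function.Injective (β e))
    (ι : ∀ v, X → Q v) (hι : ∀ v, Function.Injective (ι v)) (L : E → X → X → Prop)
    (hL : ∀ e x x' y y' c, L e x x' → L e y y' →
      (β e c • ι (tgt e) x = ι (tgt e) y ↔ α e c • ι (src e) x' = ι (src e) y')) :
    ∃ (S : Type) (ρ : ∀ v, M v →* Equiv.Perm S) (σ : E → Equiv.Perm S) (j : X → S),
      Function.Injective j ∧ (∀ e c, σ e * ρ _ (β e c) = ρ _ (α e c) * σ e) ∧
      (∀ v x y g, g • ι v x = ι v y → ρ v g (j x) = j y) ∧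
      ∀ e x x', L e x x' → σ e (j x) = j x' := by
  -- Enlarge every `Q v` by copies of the power set of `M v`, indexed by a common infinite set `W`.
  -- The complements of the images of `X` then all have the cardinality of `W`.
  let W : Type := (Σ v, Q v) ⊕ (Σ v, Set (M v)) ⊕ ℕ
  let S' : V → Type := fun v => Q v ⊕ (Σ _ : W, Set (M v))
  have hW : ℵ₀ ≤ #W := by rw [Cardinal.aleph0_le_mk_iff]; infer_instance
  have hS' : ∀ v, #(S' v) ≤ #W := by
    intro v
    have h1 : #(Q v) ≤ #W :=
      mk_le_of_injective (f := fun q => (Sum.inl ⟨v, q⟩ : W)) fun a b h => by cases h; rfl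
    have h2 : #(Set (M v)) ≤ #W :=
      mk_le_of_injective (f := fun q => (Sum.inr (Sum.inl ⟨v, q⟩) : W)) fun a b h => by cases h; rfl
    calc #(S' v) = #(Q v) + #W * #(Set (M v)) := by simp [S']
      _ ≤ #W + #W * #W := by gcongr
      _ = #W := by rw [mul_eq_self hW, add_eq_self hW]
  let ι' : ∀ v, X → S' v := fun v x => Sum.inl (ι v x)
  have hι' : ∀ v, Function.Injective (ι' v) := fun v => Sum.inl_injective.comp (hι v)
  have hτ : ∀ v, ∃ τ : X ⊕ W ≃ S' v, ∀ x, τ (Sum.inl x) = ι' v x := by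
    intro v
    have hc : #W = #((Set.range (ι' v))ᶜ : Set (S' v)) := by
      refine le_antisymm ?_ ((mk_set_le _).trans (hS' v))
      refine mk_le_of_injective (f := fun w => (⟨Sum.inr ⟨w, ∅⟩, by simp [ι']⟩ :
        ((Set.range (ι' v))ᶜ : Set (S' v)))) fun a b h => by cases h; rfl
    obtain ⟨c⟩ := Cardinal.eq.1 hc
    classical
    refine ⟨((Equiv.ofInjective _ (hι' v)).sumCongr c).trans
      (Equiv.Set.sumCompl (Set.range (ι' v))), fun x => ?_⟩
    simp
  choose τ hτ using hτ
  have hσ : ∀ e, ∃ s : S' (tgt e) ≃ S' (src e), (∀ c a, s (β e c • a) = α e c • s a) ∧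
      ∀ x x', L e x x' → s (ι' _ x) = ι' _ x' := by
    intro e
    let i1 : MulAction (H e) (S' (tgt e)) := MulAction.compHom _ (β e)
    let i2 : MulAction (H e) (S' (src e)) := MulAction.compHom _ (α e)
    have e1 : ∀ (c : H e) (a : S' (tgt e)), c • a = β e c • a := fun _ _ => rfl
    have e2 : ∀ (c : H e) (a : S' (src e)), c • a = α e c • a := fun _ _ => rfl
    obtain ⟨κ1⟩ := hS' (tgt e)
    obtain ⟨κ2⟩ := hS' (src e)
    obtain ⟨f, hf, hfe⟩ := exists_equivariant_embedding (A := S' (tgt e)) (α e) (hα e) κ1 κ1.2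
    obtain ⟨g, hg, hge⟩ := exists_equivariant_embedding (A := S' (src e)) (β e) (hβ e) κ2 κ2.2
    -- the `H e`-equivariant partial bijection which is generated by `L e`
    let D : S' (tgt e) → S' (src e) → Prop := fun a b => ∃ (x x' : X) (c : H e), L e x x' ∧
      c • ι' _ x = a ∧ c • ι' _ x' = b
    have key : ∀ (x x' y y' : X) (c : H e), L e x x' → L e y y' →
        (c • ι' (tgt e) x = ι' _ y ↔ c • ι' (src e) x' = ι' _ y') := by
      intro x x' y y' c h h'
      have := hL e x x' y y' c h h'
      rw [e1, e2]
      exact ⟨fun h => congrArg Sum.inl (this.1 (Sum.inl.inj h)),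
        fun h => congrArg Sum.inl (this.2 (Sum.inl.inj h))⟩
    have key' : ∀ (x x' y y' : X) (c d : H e), L e x x' → L e y y' →
        (c • ι' (tgt e) x = d • ι' _ y ↔ c • ι' (src e) x' = d • ι' _ y') := by
      intro x x' y y' c d h h'
      have := key x x' y y' (d⁻¹ * c) h h'
      rwa [mul_smul, mul_smul, inv_smul_eq_iff, inv_smul_eq_iff] at this
    obtain ⟨s, hs1, hs2⟩ := exists_equivariant_equiv (H := H e) D (by
        rintro h _ _ ⟨x, x', c, hl, rfl, rfl⟩
        exact ⟨x, x', h * c, hl, mul_smul _ _ _, mul_smul _ _ _⟩) (by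
        rintro _ _ _ ⟨x, x', c, hl, rfl, rfl⟩ ⟨y, y', d, hl', h, rfl⟩
        exact ((key' _ _ _ _ _ _ hl' hl).1 h).symm) (by
        rintro _ _ _ ⟨x, x', c, hl, rfl, rfl⟩ ⟨y, y', d, hl', rfl, h⟩
        exact ((key' _ _ _ _ _ _ hl' hl).2 h).symm)
      (fun a => Sum.inr (f a)) (Sum.inr_injective.comp hf)
      (fun h a => congrArg Sum.inr (hfe h a)) (by
        rintro a a' ⟨x, x', c, hl, -, h⟩
        cases h)
      (fun a => Sum.inr (g a)) (Sum.inr_injective.comp hg)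
      (fun h a => congrArg Sum.inr (hge h a)) (by
        rintro a a' ⟨x, x', c, hl, h, -⟩
        cases h)
    exact ⟨s, hs1, fun x x' h => hs2 _ _ ⟨x, x', 1, h, one_smul _ _, one_smul _ _⟩⟩
  choose s hs1 hs2 using hσ
  refine ⟨X ⊕ W, fun v => (τ v).symm.permCongrHom.toMonoidHom.comp
      (MulAction.toPermHom (M v) (S' v)),
    fun e => ((τ (tgt e)).trans (s e)).trans (τ (src e)).symm, Sum.inl, Sum.inl_injective,
    ?_, ?_, ?_⟩
  · intro e c
    ext1 a
    simp [Equiv.permCongrHom, hs1]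
  · intro v x y g h
    simp only [Equiv.permCongrHom, MonoidHom.comp_apply, MulEquiv.toMonoidHom_eq_coe,
      MonoidHom.coe_coe, MulEquiv.coe_mk, Equiv.permCongr_apply, Equiv.symm_symm,
      MulAction.toPermHom_apply, MulAction.toPerm_apply, Equiv.symm_apply_eq, hτ]
    exact congrArg Sum.inl h
  · intro e x x' h
    simp [hτ, hs2 e x x' h, Equiv.symm_apply_eq]

end Completion

/-! ### Finitely generated partial permutation representations -/

section Congruence
variable {V E X : Type} {M : V → Type} {H : E → Type} [∀ v, Group (M v)] [∀ e, Group (H e)]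
  {src tgt : E → V}

/-- The finest family of equivariant equivalence relations on the free `M v`-sets `X × M v` which
identifies `(x, g)` and `(x', 1)` for `(x, g, x') ∈ St v` and which is compatible with the partial
maps `L e` from the points at the target to the points at the source of an edge `e`. -/
inductive PointCong (α : ∀ e, H e →* M (src e)) (β : ∀ e, H e →* M (tgt e))
    (St : ∀ v, Set (X × M v × X)) (L : E → X → X → Prop) : ∀ v, X → M v → X → M v → Prop
  | refl (v x g) : PointCong α β St L v x g x g
  | symm {v x g y h} : PointCong α β St L v x g y h → PointCong α β St L v y h x g
  | trans {v x g y h z k} : PointCong α β St L v x g y h → PointCong α β St L v y h z k →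
      PointCong α β St L v x g z k
  | smul {v x g y h} (m : M v) : PointCong α β St L v x g y h →
      PointCong α β St L v x (m * g) y (m * h)
  | step {v x g x'} : (x, g, x') ∈ St v → PointCong α β St L v x g x' 1
  | fwd {e x x' y y' c} : L e x x' → L e y y' → PointCong α β St L (tgt e) x (β e c) y 1 →
      PointCong α β St L (src e) x' (α e c) y' 1
  | bwd {e x x' y y' c} : L e x x' → L e y y' → PointCong α β St L (src e) x' (α e c) y' 1 →
      PointCong α β St L (tgt e) x (β e c) y 1

theorem mem_of_inv_mul_mem_closure {H M : Type} [Group H] [Group M] (ψ : H →* M) (B : Subgroup M)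
    (t s : M) (F : Set H) (hF : ∀ k ∈ F, (ψ k * t)⁻¹ * t ∈ B) (c c₀ : H)
    (h0 : (ψ c₀ * t)⁻¹ * s ∈ B) (h : c₀⁻¹ * c ∈ Subgroup.closure F) : (ψ c * t)⁻¹ * s ∈ B := by
  have h1 : Subgroup.closure F ≤ B.comap ((MulAut.conj t⁻¹).toMonoidHom.comp ψ) := by
    rw [Subgroup.closure_le]
    intro k hk
    have := B.inv_mem (hF k hk)
    simpa [mul_assoc] using this
  have h2 : t⁻¹ * ψ (c₀⁻¹ * c) * t ∈ B := by simpa using h1 h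
  have h3 := B.mul_mem (B.inv_mem h2) h0
  convert h3 using 1
  simp [mul_assoc]

variable {S : Type*} {α : ∀ e, H e →* M (src e)} {β : ∀ e, H e →* M (tgt e)}
  {St : ∀ v, Set (X × M v × X)} {L : E → X → X → Prop}

/-- The congruence holds in every permutation representation of the graph of groups in which its
generating relations hold. -/
theorem PointCong.eq_of_perm {ρ : ∀ v, M v →* Equiv.Perm S} {σ : E → Equiv.Perm S} {j : X → S}
    (hσ : ∀ e c, σ e * ρ _ (β e c) = ρ _ (α e c) * σ e)
    (hSt : ∀ v x g x', (x, g, x') ∈ St v → ρ v g (j x) = j x')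
    (hL : ∀ e x x', L e x x' → σ e (j x) = j x') {v x g y h}
    (hc : PointCong α β St L v x g y h) : ρ v g (j x) = ρ v h (j y) := by
  induction hc with
  | refl => rfl
  | symm _ ih => exact ih.symm
  | trans _ _ ih ih' => exact ih.trans ih'
  | smul m _ ih => rw [map_mul, map_mul, Equiv.Perm.mul_apply, Equiv.Perm.mul_apply, ih]
  | step h => simpa using hSt _ _ _ _ h
  | @fwd e x x' y y' c h h' _ ih =>
    have := DFunLike.congr_fun (hσ e c) (j x)
    rw [Equiv.Perm.mul_apply, Equiv.Perm.mul_apply, ih, hL _ _ _ h] at this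
    rw [← this]
    simp [hL _ _ _ h']
  | @bwd e x x' y y' c h h' _ ih =>
    apply (σ e).injective
    have := DFunLike.congr_fun (hσ e c) (j x)
    rw [Equiv.Perm.mul_apply, Equiv.Perm.mul_apply, hL _ _ _ h, ih] at this
    rw [this]
    simp [hL _ _ _ h']

/-- The stabiliser of `(x, 1)` modulo the congruence. -/
def PointCong.stab (α : ∀ e, H e →* M (src e)) (β : ∀ e, H e →* M (tgt e))
    (St : ∀ v, Set (X × M v × X)) (L : E → X → X → Prop) (v : V) (x : X) : Subgroup (M v) where
  carrier := {m | PointCong α β St L v x m x 1}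
  one_mem' := .refl _ _ _
  mul_mem' {a b} ha hb := by
    have := PointCong.smul a hb
    rw [mul_one] at this
    exact this.trans ha
  inv_mem' {a} ha := by
    have := PointCong.smul a⁻¹ ha
    rw [mul_one, inv_mul_cancel] at this
    exact this.symm

theorem PointCong.shift {v x g y h} :
    PointCong α β St L v x g y h ↔ PointCong α β St L v x (h⁻¹ * g) y 1 := by
  constructor
  · intro H
    simpa using PointCong.smul h⁻¹ H
  · intro H
    simpa using PointCong.smul h H

/-- If the edge groups are slender, then the congruence on the free `M v`-set is finitely
generated, for every `v`.  For an edge `e` and points `x`, `y`, the elements of `H e` which move `x`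
to `y` form a coset of the stabiliser of `x` in `H e`; one element of this coset and finitely many
generators of the stabiliser express all consequences of the compatibility with `e`.  Generation is
expressed by the maps to disjoint unions of coset spaces of `M v`. -/
theorem PointCong.exists_generating [Finite E] [Finite X] (hH : ∀ e, IsSlender (H e))
    (hfin : ∀ v, (St v).Finite) : ∃ P : ∀ v, Set (X × M v × X), (∀ v, (P v).Finite) ∧
      (∀ v p, p ∈ P v → PointCong α β St L v p.1 p.2.1 p.2.2 1) ∧
      ∀ (r : V → X → X) (t : ∀ v, X → M v) (B : ∀ v, X → Subgroup (M v)),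
        (∀ v x y, (∃ g h, PointCong α β St L v x g y h) → r v x = r v y) →
        (∀ v p, p ∈ P v → (p.2.1 * t v p.1)⁻¹ * t v p.2.2 ∈ B v (r v p.1)) →
        ∀ v x g y h, PointCong α β St L v x g y h → (g * t v x)⁻¹ * (h * t v y) ∈ B v (r v x) := by
  let C := PointCong α β St L
  let K : ∀ e, X → Subgroup (H e) := fun e x =>
    (PointCong.stab α β St L (tgt e) x).comap (β e)
  have hK : ∀ e x c, c ∈ K e x ↔ C (tgt e) x (β e c) x 1 := fun _ _ _ => Iff.rfl
  -- this is the only place where slenderness is used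
  choose F hF using fun e x => hH e (K e x)
  have hFmem : ∀ e x c, c ∈ F e x → c ∈ K e x := fun e x c hc => by
    rw [← hF]; exact Subgroup.subset_closure hc
  have hc0 : ∀ e x y, ∃ c₀ : H e, (∃ c, C (tgt e) x (β e c) y 1) → C (tgt e) x (β e c₀) y 1 := by
    intro e x y
    by_cases h : ∃ c, C (tgt e) x (β e c) y 1
    · exact ⟨_, fun _ => h.choose_spec⟩
    · exact ⟨1, fun h' => absurd h' h⟩
  choose c0 hc0 using hc0
  have hcK : ∀ e x y c, C (tgt e) x (β e c) y 1 → (c0 e x y)⁻¹ * c ∈ K e x := by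
    intro e x y c h
    have h' := hc0 e x y ⟨c, h⟩
    rw [hK]
    have := PointCong.smul (β e (c0 e x y))⁻¹ (h.trans h'.symm)
    simpa using this
  let Pt : ∀ e, Set (X × M (tgt e) × X) := fun e =>
    {p | C (tgt e) p.1 p.2.1 p.2.2 1 ∧ ∃ x y, p = (x, β e (c0 e x y), y)} ∪
    {p | ∃ x, ∃ c ∈ F e x, p = (x, β e c, x)}
  let Ps : ∀ e, Set (X × M (src e) × X) := fun e =>
    {p | C (src e) p.1 p.2.1 p.2.2 1 ∧ ∃ x y x' y', p = (x', α e (c0 e x y), y')} ∪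
    {p | ∃ x x', L e x x' ∧ ∃ c ∈ F e x, p = (x', α e c, x')}
  have hPt : ∀ e, (Pt e).Finite := by
    intro e
    refine Set.Finite.union ?_ ?_
    · refine (Set.finite_range fun q : X × X => (q.1, β e (c0 e q.1 q.2), q.2)).subset ?_
      rintro _ ⟨-, x, y, rfl⟩
      exact ⟨(x, y), rfl⟩
    · refine (Set.finite_iUnion fun x =>
        (F e x).finite_toSet.image fun c => (x, β e c, x)).subset ?_
      rintro _ ⟨x, c, hc, rfl⟩
      exact Set.mem_iUnion.2 ⟨x, c, hc, rfl⟩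
  have hPs : ∀ e, (Ps e).Finite := by
    intro e
    refine Set.Finite.union ?_ ?_
    · refine (Set.finite_range fun q : X × X × X × X =>
        (q.2.2.1, α e (c0 e q.1 q.2.1), q.2.2.2)).subset ?_
      rintro _ ⟨-, x, y, x', y', rfl⟩
      exact ⟨(x, y, x', y'), rfl⟩
    · refine (Set.finite_iUnion fun q : X × X =>
        (F e q.1).finite_toSet.image fun c => (q.2, α e c, q.2)).subset ?_
      rintro _ ⟨x, x', -, c, hc, rfl⟩
      exact Set.mem_iUnion.2 ⟨(x, x'), c, hc, rfl⟩
  let P : ∀ v, Set (X × M v × X) := fun v => St v ∪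
    ((⋃ e, ⋃ h : tgt e = v, h ▸ Pt e) ∪ (⋃ e, ⋃ h : src e = v, h ▸ Ps e))
  have hPtP : ∀ e p, p ∈ Pt e → p ∈ P (tgt e) := fun e p hp =>
    Or.inr (Or.inl (Set.mem_iUnion₂.2 ⟨e, rfl, hp⟩))
  have hPsP : ∀ e p, p ∈ Ps e → p ∈ P (src e) := fun e p hp =>
    Or.inr (Or.inr (Set.mem_iUnion₂.2 ⟨e, rfl, hp⟩))
  refine ⟨P, fun v => ?_, fun v p hp => ?_, fun r t B hr hB v x g y h hc => ?_⟩
  · refine (hfin v).union (Set.Finite.union ?_ ?_)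
    · refine Set.finite_iUnion fun e => Set.finite_iUnion fun h => ?_
      subst h
      exact hPt e
    · refine Set.finite_iUnion fun e => Set.finite_iUnion fun h => ?_
      subst h
      exact hPs e
  · rcases hp with hp | hp | hp
    · exact .step hp
    · obtain ⟨e, rfl, hp⟩ := Set.mem_iUnion₂.1 hp
      rcases hp with hp | ⟨x, c, hc, rfl⟩
      · exact hp.1
      · exact hFmem _ _ _ hc
    · obtain ⟨e, rfl, hp⟩ := Set.mem_iUnion₂.1 hp
      rcases hp with hp | ⟨x, x', hl, c, hc, rfl⟩
      · exact hp.1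
      · exact .fwd hl hl (hFmem _ _ _ hc)
  · induction hc with
    | refl => simp [one_mem]
    | symm hc ih =>
      rw [← hr _ _ _ ⟨_, _, hc⟩]
      simpa [mul_assoc] using inv_mem ih
    | trans hc _ ih ih' =>
      rw [← hr _ _ _ ⟨_, _, hc⟩] at ih'
      simpa [mul_assoc] using mul_mem ih ih'
    | smul m _ ih => simpa [mul_assoc] using ih
    | step h =>
      rw [one_mul]
      exact hB _ _ (Or.inl h)
    | @fwd e x x' y y' c hl hl' hc _ =>
      rw [one_mul]
      refine mem_of_inv_mul_mem_closure (α e) _ _ _ (F e x) (fun k hk => ?_) c (c0 e x y) ?_ ?_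
      · exact hB _ _ (hPsP e (x', α e k, x') (Or.inr ⟨x, x', hl, k, hk, rfl⟩))
      · have : C (src e) x' (α e (c0 e x y)) y' 1 := .fwd hl hl' (hc0 e x y ⟨c, hc⟩)
        exact hB _ _ (hPsP e _ (Or.inl ⟨this, x, y, x', y', rfl⟩))
      · rw [hF]
        exact hcK _ _ _ _ hc
    | @bwd e x x' y y' c hl hl' hc _ =>
      have hc := PointCong.bwd hl hl' hc
      rw [one_mul]
      refine mem_of_inv_mul_mem_closure (β e) _ _ _ (F e x) (fun k hk => ?_) c (c0 e x y) ?_ ?_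
      · exact hB _ _ (hPtP e (x, β e k, x) (Or.inr ⟨x, k, hk, rfl⟩))
      · exact hB _ _ (hPtP e _ (Or.inl ⟨hc0 e x y ⟨c, hc⟩, x, y, rfl⟩))
      · rw [hF]
        exact hcK _ _ _ _ hc

/-- For `ι x = (r x, t x B (r x))` in the disjoint union of the coset spaces `M / B y`, the relation
`g • ι x = ι y`. -/
def CosetRel {X Y M : Type} [Group M] (r : X → Y) (t : X → M) (B : Y → Subgroup M) (x : X) (g : M)
    (y : X) : Prop :=
  r x = r y ∧ (g * t x)⁻¹ * t y ∈ B (r x)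

/-- A finite set of points in a permutation representation of a finite graph of groups with slender
edge groups, and finitely many relations between the points, lie in a folded partial representation
with finitely generated point stabilisers. -/
theorem exists_finitely_generated_partial_perm [Finite E] [Finite X] (hH : ∀ e, IsSlender (H e))
    (hfin : ∀ v, (St v).Finite) (ρ : ∀ v, M v →* Equiv.Perm S) (σ : E → Equiv.Perm S) (j : X → S)
    (hj : Function.Injective j) (hσ : ∀ e c, σ e * ρ _ (β e c) = ρ _ (α e c) * σ e)
    (hSt : ∀ v x g x', (x, g, x') ∈ St v → ρ v g (j x) = j x')
    (hL : ∀ e x x', L e x x' → σ e (j x) = j x') :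
    ∃ (r : V → X → X) (t : ∀ v, X → M v) (B : ∀ v, X → Subgroup (M v)),
      (∀ v x, (B v x).FG) ∧
      (∀ v x g y, (x, g, y) ∈ St v → CosetRel (r v) (t v) (B v) x g y) ∧
      (∀ v x y, CosetRel (r v) (t v) (B v) x 1 y → x = y) ∧
      ∀ e x x' y y' c, L e x x' → L e y y' →
        (CosetRel (r (tgt e)) (t _) (B _) x (β e c) y ↔
          CosetRel (r (src e)) (t _) (B _) x' (α e c) y') := by
  obtain ⟨P, hPfin, hP, hgen⟩ := PointCong.exists_generating (α := α) (β := β) (L := L) hH hfin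
  let C := PointCong α β St L
  -- The quotient of `X × M v` by the congruence is the disjoint union over representatives `y` of
  -- its orbits of the coset spaces of the stabilisers `B v y`.
  let s : ∀ v : V, Setoid X := fun v =>
    { r := fun x y => ∃ g, C v x g y 1
      iseqv := ⟨fun x => ⟨1, .refl _ _ _⟩, fun ⟨g, h⟩ => ⟨_, PointCong.shift.1 h.symm⟩, by
        rintro x y z ⟨g, h⟩ ⟨k, h'⟩
        have := PointCong.smul k h
        rw [mul_one] at this
        exact ⟨_, this.trans h'⟩⟩ }
  let r : V → X → X := fun v x => (Quotient.mk (s v) x).out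
  have hr : ∀ v x, ∃ t, C v x 1 (r v x) t := by
    intro v x
    obtain ⟨g, hg⟩ := (s v).symm (Quotient.mk_out (s := s v) x)
    exact ⟨_, PointCong.shift.2 (by simpa using hg : C v x (g⁻¹⁻¹ * 1) (r v x) 1)⟩
  choose t ht using hr
  have hrr : ∀ v x y, (∃ g h, C v x g y h) → r v x = r v y := by
    rintro v x y ⟨g, h, hc⟩
    have : Quotient.mk (s v) x = Quotient.mk (s v) y := Quotient.sound ⟨_, PointCong.shift.1 hc⟩
    simp only [r, this]
  have ht' : ∀ v x g, C v x g (r v x) (g * t v x) := fun v x g => by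
    simpa using PointCong.smul g (ht v x)
  let B : ∀ v, X → Subgroup (M v) := fun v y => Subgroup.closure
    {m | ∃ p ∈ P v, r v p.1 = y ∧ m = (p.2.1 * t v p.1)⁻¹ * t v p.2.2}
  have hB1 : ∀ v x g y h, C v x g y h → (g * t v x)⁻¹ * (h * t v y) ∈ B v (r v x) :=
    hgen r t B hrr fun v p hp => Subgroup.subset_closure ⟨p, hp, rfl, rfl⟩
  have hB2 : ∀ v y m, m ∈ B v y → C v y m y 1 := by
    intro v y
    suffices B v y ≤ PointCong.stab α β St L v y from fun m hm => this hm
    rw [Subgroup.closure_le]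
    rintro _ ⟨p, hp, rfl, rfl⟩
    have h1 := hP v p hp
    have h2 := ((ht' v p.1 p.2.1).symm.trans h1).trans (ht' v p.2.2 1)
    rw [← hrr v p.1 p.2.2 ⟨_, _, h1⟩, one_mul] at h2
    have h3 := PointCong.shift.1 h2.symm
    change C v _ _ _ 1
    simpa only [mul_assoc, mul_inv_rev] using h3
  have hrel : ∀ v x g y, CosetRel (r v) (t v) (B v) x g y ↔ C v x g y 1 := by
    intro v x g y
    constructor
    · rintro ⟨h1, h2⟩
      have h3 := PointCong.smul (g * t v x) (hB2 _ _ _ h2)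
      rw [mul_inv_cancel_left, mul_one] at h3
      refine (ht' v x g).trans (h3.symm.trans ?_)
      rw [h1]
      exact (ht v y).symm
    · intro h
      have := hB1 _ _ _ _ _ h
      rw [one_mul] at this
      exact ⟨hrr _ _ _ ⟨_, _, h⟩, this⟩
  refine ⟨r, t, B, fun v x => ?_, fun v x g y h => (hrel _ _ _ _).2 (.step h), fun v x y h => ?_,
    fun e x x' y y' c h h' => ?_⟩
  · rw [Subgroup.fg_iff]
    refine ⟨_, rfl, ((hPfin v).image fun p => (p.2.1 * t v p.1)⁻¹ * t v p.2.2).subset ?_⟩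
    rintro _ ⟨p, hp, -, rfl⟩
    exact ⟨p, hp, rfl⟩
  · exact hj (by simpa using PointCong.eq_of_perm hσ hSt hL ((hrel _ _ _ _).1 h))
  · rw [hrel, hrel]
    exact ⟨.fwd h h', .bwd h h'⟩

end Congruence

/-! ### Fundamental groups of graphs of groups -/

section Potential
variable {V F : Type*} [Group F] {G : SimpleGraph V}

/-- The product of the labels along a walk. -/
def walkProd (l : V → V → F) : ∀ {u v : V}, G.Walk u v → F
  | _, _, .nil => 1
  | u, _, .cons (v := w) _ p => l u w * walkProd l p

theorem walkProd_concat (l : V → V → F) {u v w : V} (p : G.Walk u v) (h : G.Adj v w) :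
    walkProd l (p.concat h) = walkProd l p * l v w := by
  induction p with
  | nil => simp [walkProd, SimpleGraph.Walk.concat]
  | cons h' p ih => rw [SimpleGraph.Walk.concat_cons, walkProd, walkProd, ih, mul_assoc]

/-- Group labels of the edges of a tree are the coboundary of a function on the vertices. -/
theorem SimpleGraph.IsTree.exists_potential (hG : G.IsTree) (l : V → V → F)
    (hl : ∀ u v, G.Adj u v → l u v * l v u = 1) :
    ∃ γ : V → F, ∀ u v, G.Adj u v → γ v = γ u * l u v := by
  obtain ⟨o⟩ := hG.1.nonempty
  choose p hp _ using hG.existsUnique_path o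
  refine ⟨fun v => walkProd l (p v), fun u v h => ?_⟩
  dsimp only
  by_cases hv : u ∈ (p v).support
  · rw [hG.2.path_concat (hp u) (hp v) h hv, walkProd_concat]
  · have hu := hG.2.mem_support_of_ne_mem_support_of_adj_of_isPath (hp u) (hp v) h hv
    rw [hG.2.path_concat (hp v) (hp u) h.symm hu, walkProd_concat, mul_assoc, hl v u h.symm,
      mul_one]

end Potential

namespace GraphOfGroups
variable (Γ : GraphOfGroups.{u}) {T : Set Γ.E}

/-- Group labels of the edges in a spanning tree are the coboundary of a function on the
vertices. -/
theorem IsSpanningTree.exists_potential {Γ : GraphOfGroups.{u}} {T : Set Γ.E}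
    (hT : Γ.IsSpanningTree T) {F : Type*} [Group F] (a : Γ.E → F) :
    ∃ γ : Γ.V → F, ∀ e ∈ T, γ (Γ.tgt e) = γ (Γ.src e) * a e := by
  classical
  obtain ⟨h1, h2, h3⟩ := hT
  let l : Γ.V → Γ.V → F := fun u v =>
    if h : ∃ e ∈ T, Γ.src e = u ∧ Γ.tgt e = v then a h.choose else
    if h : ∃ e ∈ T, Γ.src e = v ∧ Γ.tgt e = u then (a h.choose)⁻¹ else 1
  have l1 : ∀ e ∈ T, l (Γ.src e) (Γ.tgt e) = a e := by
    intro e he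
    have h : ∃ e' ∈ T, Γ.src e' = Γ.src e ∧ Γ.tgt e' = Γ.tgt e := ⟨e, he, rfl, rfl⟩
    have he' : h.choose = e := h2 h.choose_spec.1 he
      (by dsimp only; rw [h.choose_spec.2.1, h.choose_spec.2.2])
    simp only [l, dif_pos h, he']
  have l2 : ∀ e ∈ T, l (Γ.tgt e) (Γ.src e) = (a e)⁻¹ := by
    intro e he
    have h : ∃ e' ∈ T, Γ.src e' = Γ.src e ∧ Γ.tgt e' = Γ.tgt e := ⟨e, he, rfl, rfl⟩
    have h' : ¬ ∃ e' ∈ T, Γ.src e' = Γ.tgt e ∧ Γ.tgt e' = Γ.src e := by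
      rintro ⟨e', he', e1, e2⟩
      obtain rfl : e' = e := h2 he' he (by dsimp only; rw [e1, e2, Sym2.eq_swap])
      exact h1 e' he' e1
    have he' : h.choose = e := h2 h.choose_spec.1 he
      (by dsimp only; rw [h.choose_spec.2.1, h.choose_spec.2.2])
    simp only [l, dif_neg h', dif_pos h, he']
  obtain ⟨γ, hγ⟩ := h3.exists_potential l (by
    intro u v huv
    rw [SimpleGraph.fromEdgeSet_adj] at huv
    obtain ⟨⟨e, he, huv⟩, -⟩ := huv
    rcases Sym2.eq_iff.1 huv with ⟨rfl, rfl⟩ | ⟨rfl, rfl⟩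
    · rw [l1 e he, l2 e he, mul_inv_cancel]
    · rw [l1 e he, l2 e he, inv_mul_cancel])
  refine ⟨γ, fun e he => ?_⟩
  rw [hγ _ _ (by rw [SimpleGraph.fromEdgeSet_adj]; exact ⟨⟨e, he, rfl⟩, h1 e he⟩), l1 e he]

theorem IsSpanningTree.eq_of_forall {Γ : GraphOfGroups.{u}} {T : Set Γ.E}
    (hT : Γ.IsSpanningTree T) {A : Type*} (f : Γ.V → A)
    (hf : ∀ e ∈ T, f (Γ.tgt e) = f (Γ.src e)) (u v : Γ.V) : f u = f v := by
  obtain ⟨w⟩ := hT.2.2.1 u v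
  induction w with
  | nil => rfl
  | cons h _ ih =>
    rw [← ih]
    rw [SimpleGraph.fromEdgeSet_adj] at h
    obtain ⟨⟨e, he, huv⟩, -⟩ := h
    rcases Sym2.eq_iff.1 huv with ⟨rfl, rfl⟩ | ⟨rfl, rfl⟩
    · exact (hf e he).symm
    · exact hf e he

/-- The image of an element of a vertex group in the fundamental group. -/
def vertexHom (T : Set Γ.E) (x : Γ.V) : Γ.G x →* Γ.fundamentalGroup T :=
  (QuotientGroup.mk' _).comp (Γ.vertex x)

/-- The image of a stable letter in the fundamental group. -/
def stableElt (T : Set Γ.E) (e : Γ.E) : Γ.fundamentalGroup T :=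
  QuotientGroup.mk' _ (Γ.stable e)

theorem stableElt_mul (e : Γ.E) (h : Γ.H e) : Γ.stableElt T e * Γ.vertexHom T _ (Γ.incTgt e h) =
    Γ.vertexHom T _ (Γ.incSrc e h) * Γ.stableElt T e := by
  have : QuotientGroup.mk' (Subgroup.normalClosure (Γ.relations T))
      (Γ.stable e * Γ.vertex _ (Γ.incTgt e h) * (Γ.stable e)⁻¹ *
        (Γ.vertex _ (Γ.incSrc e h))⁻¹) = 1 :=
    (QuotientGroup.eq_one_iff _).2 (Subgroup.subset_normalClosure (Or.inl ⟨e, h, rfl⟩))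
  rw [map_mul, map_mul, map_mul, map_inv, map_inv, mul_inv_eq_one, mul_inv_eq_iff_eq_mul] at this
  exact this

theorem stableElt_eq_one {e : Γ.E} (he : e ∈ T) : Γ.stableElt T e = 1 :=
  (QuotientGroup.eq_one_iff _).2 (Subgroup.subset_normalClosure (Or.inr ⟨e, he, rfl⟩))

/-- Let `F` be a group in which the vertex groups are represented and which contains elements `a e`
satisfying the relations of the stable letters, except that those in the tree need not be trivial.
If `F` maps compatibly to the fundamental group, then this map has a section, up to conjugation.
It sends an element to the product along the corresponding closed path. -/
theorem IsSpanningTree.exists_section {Γ : GraphOfGroups.{u}} {T : Set Γ.E}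
    (hT : Γ.IsSpanningTree T) {F : Type*} [Group F] (η : ∀ x, Γ.G x →* F) (a : Γ.E → F)
    (ha : ∀ e h, a e * η _ (Γ.incTgt e h) = η _ (Γ.incSrc e h) * a e)
    (Φ : F →* Γ.fundamentalGroup T) (hη : ∀ x g, Φ (η x g) = Γ.vertexHom T x g)
    (hΦ : ∀ e, Φ (a e) = Γ.stableElt T e) :
    ∃ (Ψ : Γ.fundamentalGroup T →* F) (c : Γ.fundamentalGroup T), ∀ g, Φ (Ψ g) = c * g * c⁻¹ := by
  obtain ⟨γ, hγ⟩ := hT.exists_potential a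
  obtain ⟨o⟩ := hT.2.2.1.nonempty
  let Ψ' : Γ.BigProd →* F := Monoid.Coprod.lift
    (Monoid.CoprodI.lift fun x => (MulAut.conj (γ x)).toMonoidHom.comp (η x))
    (FreeGroup.lift fun e => γ (Γ.src e) * a e * (γ (Γ.tgt e))⁻¹)
  have h1 : ∀ x g, Ψ' (Γ.vertex x g) = γ x * η x g * (γ x)⁻¹ := by
    intro x g
    simp [Ψ', vertex]
  have h2 : ∀ e, Ψ' (Γ.stable e) = γ (Γ.src e) * a e * (γ (Γ.tgt e))⁻¹ := by
    intro e
    simp [Ψ', stable]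
  have hker : Subgroup.normalClosure (Γ.relations T) ≤ Ψ'.ker := by
    refine Subgroup.normalClosure_le_normal ?_
    rintro _ (⟨e, h, rfl⟩ | ⟨e, he, rfl⟩)
    · change Ψ' _ = 1
      have := ha e h
      rw [map_mul, map_mul, map_mul, map_inv, map_inv, h1, h1, h2, mul_inv_eq_one,
        mul_inv_eq_iff_eq_mul]
      calc _ = γ (Γ.src e) * (a e * η _ (Γ.incTgt e h)) * (γ (Γ.tgt e))⁻¹ := by group
        _ = _ := by rw [this]; group
    · change Ψ' _ = 1
      rw [h2, hγ e he]
      group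
  -- the stable letters of the tree become trivial under `Φ`, so that `Φ ∘ γ` is constant
  have hconst : ∀ x, Φ (γ x) = Φ (γ o) := fun x => hT.eq_of_forall (fun x => Φ (γ x)) (by
    intro e he
    rw [hγ e he, map_mul, hΦ, Γ.stableElt_eq_one he, mul_one]) x o
  refine ⟨QuotientGroup.lift _ Ψ' hker, Φ (γ o), fun g => ?_⟩
  obtain ⟨g, rfl⟩ := QuotientGroup.mk'_surjective _ g
  have key : Φ.comp Ψ' = (MulAut.conj (Φ (γ o))).toMonoidHom.comp (QuotientGroup.mk' _) := by
    refine Monoid.Coprod.hom_ext (Monoid.CoprodI.ext_hom _ _ fun x => ?_)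
      (FreeGroup.ext_hom _ _ fun e => ?_)
    · ext g
      have := congrArg Φ (h1 x g)
      rw [map_mul, map_mul, map_inv, hconst, hη] at this
      exact this
    · have := congrArg Φ (h2 e)
      rw [map_mul, map_mul, map_inv, hconst (Γ.src e), hconst (Γ.tgt e), hΦ] at this
      exact this
  exact DFunLike.congr_fun key g

end GraphOfGroups

/-! ### Codes of graphs of groups -/

namespace FinPres

/-- The words `vs` define a homomorphism. -/
def IsHomVia (p q : FinPres) (vs : List Word) : Prop :=
  ∃ θ : p.Pres →* q.Pres, ∀ c, θ (p.elt c) = q.elt (wordSubst (fun k => vs.getD k []) c)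

/-- The words `vs` define an isomorphism. -/
def IsIsoVia (p q : FinPres) (vs : List Word) : Prop :=
  ∃ θ : p.Pres ≃* q.Pres, ∀ c, θ (p.elt c) = q.elt (wordSubst (fun k => vs.getD k []) c)

theorem wordSubst_singleton_true {κ μ : Type} (u : κ → List (μ × Bool)) (k : κ) :
    wordSubst u [(k, true)] = u k := by simp [wordSubst]

/-- The second condition says that superfluous words represent the trivial element, like the letters
to which they belong. -/
theorem isHomVia_iff (p q : FinPres) (vs : List Word) : p.IsHomVia q vs ↔
    (∀ r ∈ p.2, q.elt (wordSubst (fun k => vs.getD k []) r) = q.elt []) ∧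
      ∀ k < vs.length, k < p.1 ∨ q.elt (vs.getD k []) = q.elt [] := by
  simp only [elt_nil]
  constructor
  · rintro ⟨θ, h⟩
    refine ⟨fun r hr => by rw [← h, p.elt_eq_one_of_mem hr, map_one], fun k _ => ?_⟩
    by_cases hk : k < p.1
    · exact Or.inl hk
    · have := h [(k, true)]
      rw [p.elt_eq_one_of_le (not_lt.1 hk), map_one, wordSubst_singleton_true] at this
      exact Or.inr this.symm
  · rintro ⟨h1, h2⟩
    obtain ⟨θ, hθ⟩ := p.exists_hom (fun k => q.elt (vs.getD k [])) (by
        intro k hk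
        by_cases hk' : k < vs.length
        · exact (h2 k hk').resolve_left (not_lt.2 hk)
        · rw [List.getD_eq_default _ _ (not_lt.1 hk'), elt_nil]) (by
        intro r hr
        rw [← elt_wordSubst]
        exact h1 r hr)
    exact ⟨θ, fun c => by rw [hθ, elt_wordSubst]⟩

/-- Images of the generators, chosen as words, define a homomorphism on words. -/
theorem map_elt_of_ofFn (p q : FinPres) (θ : p.Pres →* q.Pres) (u : Fin p.1 → Word)
    (hu : ∀ k : Fin p.1, q.elt (u k) = θ (p.elt [((k : ℕ), true)])) (c : Word) :
    θ (p.elt c) = q.elt (wordSubst (fun k => (List.ofFn u).getD k []) c) := by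
  rw [map_elt, elt_wordSubst]
  congr 2
  ext1 k
  by_cases hk : k < p.1
  · rw [List.getD_eq_getElem _ _ (by simpa using hk), List.getElem_ofFn, hu]
  · rw [List.getD_eq_default _ _ (by simpa using hk), elt_nil,
      p.elt_eq_one_of_le (not_lt.1 hk), map_one]

theorem isIsoVia_iff (p q : FinPres) (vs : List Word) : p.IsIsoVia q vs ↔
    p.IsHomVia q vs ∧ ∃ vs' : List Word, q.IsHomVia p vs' ∧
      (∀ k < p.1, p.elt (wordSubst (fun k => vs'.getD k []) (vs.getD k [])) = p.elt [(k, true)]) ∧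
      ∀ k < q.1, q.elt (wordSubst (fun k => vs.getD k []) (vs'.getD k [])) = q.elt [(k, true)] := by
  constructor
  · rintro ⟨θ, h⟩
    choose u hu using fun k : Fin q.1 => p.elt_surjective (θ.symm (q.elt [((k : ℕ), true)]))
    have h' := q.map_elt_of_ofFn p θ.symm.toMonoidHom u hu
    refine ⟨⟨θ.toMonoidHom, h⟩, List.ofFn u, ⟨θ.symm.toMonoidHom, h'⟩, fun k _ => ?_, fun k _ => ?_⟩
    · rw [← h', MulEquiv.toMonoidHom_eq_coe, MonoidHom.coe_coe, MulEquiv.symm_apply_eq, h,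
        wordSubst_singleton_true]
    · have := h' [(k, true)]
      rw [wordSubst_singleton_true] at this
      rw [← h, ← MulEquiv.eq_symm_apply]
      exact this.symm
  · rintro ⟨⟨f, hf⟩, vs', ⟨g, hg⟩, h1, h2⟩
    refine ⟨MonoidHom.toMulEquiv f g (hom_ext fun k hk => ?_) (hom_ext fun k hk => ?_), hf⟩
    · rw [MonoidHom.comp_apply, hf, wordSubst_singleton_true, hg, h1 k hk, MonoidHom.id_apply]
    · rw [MonoidHom.comp_apply, hg, wordSubst_singleton_true, hf, h2 k hk, MonoidHom.id_apply]

section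
variable {α : Type} [Primcodable α] {p q : α → FinPres} {vs : α → List Word}

@[fun_prop] theorem recEnum_isHomVia (hp : Primrec p) (hq : Primrec q) (hvs : Primrec vs) :
    RecEnum fun a => (p a).IsHomVia (q a) (vs a) := by
  simp only [isHomVia_iff]
  refine RecEnum.and (RecEnum.forall_mem (by fun_prop) (by fun_prop))
    (RecEnum.forall_lt (by fun_prop) (by fun_prop))

@[fun_prop] theorem recEnum_isIsoVia (hp : Primrec p) (hq : Primrec q) (hvs : Primrec vs) :
    RecEnum fun a => (p a).IsIsoVia (q a) (vs a) := by
  simp only [isIsoVia_iff]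
  refine RecEnum.and (by fun_prop) (RecEnum.ex (RecEnum.and (by fun_prop) (RecEnum.and
    (RecEnum.forall_lt (by fun_prop) (by fun_prop))
    (RecEnum.forall_lt (by fun_prop) (by fun_prop)))))

end
end FinPres

namespace FinDecPres

/-- The image under `f_i` of a word in the generators `X_i`. -/
def edgeWord (d : FinDecPres) (i : ℕ) (c : Word) : Word :=
  wordSubst (fun k => (d.edgeWords i).getD k []) c

theorem IsValid.exists_edgeHom {d : FinDecPres} (hd : d.IsValid) {i : ℕ} (hi : i < d.2.length) :
    ∃ f : (d.edgePres i).Pres →* d.1.Pres, Function.Injective f ∧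
      (∀ c, f ((d.edgePres i).elt c) = d.1.elt (d.edgeWord i c)) ∧ f.range = d.edgeSubgroup i := by
  obtain ⟨f, hf, h⟩ := hd i hi
  have hgen : ∀ k, f ((d.edgePres i).elt [(k, true)]) = d.1.elt ((d.edgeWords i).getD k []) := by
    intro k
    by_cases hk : k < (d.edgeWords i).length
    · rw [List.getD_eq_getElem _ _ hk]
      exact (congrArg f ((d.edgePres i).of_eq_elt ⟨k, hk⟩)).symm.trans (h ⟨k, hk⟩)
    · rw [FinPres.elt_eq_one_of_le _ (by simpa [edgePres, edgeWords] using hk), map_one,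
        List.getD_eq_default _ _ (not_lt.1 hk), FinPres.elt_nil]
  have hw : ∀ c, f ((d.edgePres i).elt c) = d.1.elt (d.edgeWord i c) := by
    intro c
    rw [edgeWord, FinPres.elt_wordSubst, FinPres.map_elt]
    simp only [hgen]
  refine ⟨f, hf, hw, le_antisymm ?_ ?_⟩
  · rintro _ ⟨g, rfl⟩
    obtain ⟨c, rfl⟩ := (d.edgePres i).elt_surjective g
    rw [hw, edgeWord, FinPres.elt_wordSubst]
    generalize FreeGroup.mk c = x
    have : (FreeGroup.lift fun k => d.1.elt ((d.edgeWords i).getD k [])).range ≤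
        d.edgeSubgroup i := by
      refine FreeGroup.range_lift_le ?_
      rintro _ ⟨k, rfl⟩
      by_cases hk : k < (d.edgeWords i).length
      · exact Subgroup.subset_closure ⟨_, by rw [List.getD_eq_getElem _ _ hk]; simp, rfl⟩
      · dsimp only
        rw [List.getD_eq_default _ _ (not_lt.1 hk), FinPres.elt_nil]
        exact one_mem _
    exact this ⟨x, rfl⟩
  · rw [edgeSubgroup, FinPres.gen, Subgroup.closure_le]
    rintro _ ⟨w, hw', rfl⟩
    obtain ⟨k, hk, rfl⟩ := List.mem_iff_getElem.1 hw'
    refine ⟨(d.edgePres i).elt [(k, true)], ?_⟩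
    rw [hgen, List.getD_eq_getElem _ _ hk]

section
variable {α : Type} [Primcodable α] {d : α → FinDecPres} {i : α → ℕ}

@[fun_prop] theorem primrec_edgeWords (hd : Primrec d) (hi : Primrec i) :
    Primrec fun a => (d a).edgeWords (i a) := by unfold edgeWords; fun_prop

@[fun_prop] theorem primrec_edgePres (hd : Primrec d) (hi : Primrec i) :
    Primrec fun a => (d a).edgePres (i a) := by unfold edgePres; fun_prop

@[fun_prop] theorem primrec_edgeWord {c : α → Word} (hd : Primrec d) (hi : Primrec i)
    (hc : Primrec c) : Primrec fun a => (d a).edgeWord (i a) (c a) := by unfold edgeWord; fun_prop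

end
end FinDecPres

/-- The code `((v, i), (w, j), vs)` of an edge from `v` to `w`.  Its group is the `i`-th edge group
of the decorated group at `v`, and it is identified by means of the words `vs` with the `j`-th edge
group of the decorated group at `w`. -/
abbrev EdgeCode : Type := (ℕ × ℕ) × (ℕ × ℕ) × List Word

/-- The code of a graph of groups: the lists of its vertices and of its edges. -/
abbrev GraphCode : Type := List FinDecPres × List EdgeCode

/-- The generators of the vertex groups and the stable letters. -/
abbrev Letter : Type := (ℕ × ℕ) ⊕ ℕ

/-- A word in the generators of a vertex group, as a word in all letters. -/
def vertexWord (v : ℕ) (u : Word) : List (Letter × Bool) := u.map fun x => (Sum.inl (v, x.1), x.2)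

theorem mk_vertexWord (v : ℕ) (u : Word) : FreeGroup.mk (vertexWord v u) =
    FreeGroup.lift (fun k => FreeGroup.of (Sum.inl (v, k) : Letter)) (FreeGroup.mk u) := by
  have : vertexWord v u = wordSubst (fun k => [(Sum.inl (v, k), true)]) u := by
    rw [vertexWord, wordSubst, List.map_eq_flatMap]
    congr 1
    ext1 ⟨k, b⟩
    cases b <;> rfl
  rw [this, mk_wordSubst]
  rfl

namespace GraphCode
variable (g : GraphCode)

/-- The code of the decorated group at a vertex; a default value if there is no such vertex. -/
def vert (v : ℕ) : FinDecPres := g.1.getD v ((0, []), [])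

/-- The code of an edge; a default value if there is no such edge. -/
def edge (e : ℕ) : EdgeCode := g.2.getD e ((0, 0), (0, 0), [])

/-- The source of an edge. -/
def src (e : ℕ) : ℕ := (g.edge e).1.1

/-- The target of an edge. -/
def tgt (e : ℕ) : ℕ := (g.edge e).2.1.1

/-- The number of the edge group in the decoration of the source of the edge. -/
def srcIdx (e : ℕ) : ℕ := (g.edge e).1.2

/-- The number of the edge group in the decoration of the target of the edge. -/
def tgtIdx (e : ℕ) : ℕ := (g.edge e).2.1.2

/-- The presentation of the group of an edge. -/
def edgeGp (e : ℕ) : FinPres := (g.vert (g.src e)).edgePres (g.srcIdx e)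

/-- The embedding of an edge group at the source of the edge, on words. -/
def srcWord (e : ℕ) (c : Word) : Word := (g.vert (g.src e)).edgeWord (g.srcIdx e) c

/-- The embedding of an edge group at the target of the edge, on words. -/
def tgtWord (e : ℕ) (c : Word) : Word := (g.vert (g.tgt e)).edgeWord (g.tgtIdx e)
  (wordSubst (fun k => (g.edge e).2.2.getD k []) c)

/-- The vertices are coded by elements of `S`, and the edges are coded correctly. -/
def ValidIn (S : FinDecPres → Prop) : Prop :=
  (∀ v < g.1.length, S (g.vert v)) ∧ ∀ e < g.2.length, g.src e < g.1.length ∧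
    g.tgt e < g.1.length ∧ g.srcIdx e < (g.vert (g.src e)).2.length ∧
    g.tgtIdx e < (g.vert (g.tgt e)).2.length ∧
    (g.edgeGp e).IsIsoVia ((g.vert (g.tgt e)).edgePres (g.tgtIdx e)) (g.edge e).2.2

/-- The relations of the vertex groups, and the relations `s_e t_e(h) s_e⁻¹ = i_e(h)` of the stable
letters.  No stable letter is required to be trivial. -/
def Relator (u : List (Letter × Bool)) : Prop :=
  (∃ v, v < g.1.length ∧ ∃ u', (g.vert v).1.elt u' = (g.vert v).1.elt [] ∧ u = vertexWord v u') ∨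
  ∃ e, e < g.2.length ∧ ∃ c, u = [(Sum.inr e, true)] ++ vertexWord (g.tgt e) (g.tgtWord e c) ++
    [(Sum.inr e, false)] ++ FreeGroup.invRev (vertexWord (g.src e) (g.srcWord e c))

/-- The normal closure of the relators. -/
def relations : Subgroup (FreeGroup Letter) :=
  Subgroup.normalClosure {x | ∃ u, g.Relator u ∧ x = FreeGroup.mk u}

instance : g.relations.Normal := Subgroup.normalClosure_normal

section
variable {α : Type} [Primcodable α] {g : α → GraphCode} {v e : α → ℕ} {c : α → Word}

@[fun_prop] theorem primrec_vertexWord (hv : Primrec v) (hc : Primrec c) :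
    Primrec fun a => vertexWord (v a) (c a) := by unfold vertexWord; fun_prop

@[fun_prop] theorem primrec_vert (hg : Primrec g) (hv : Primrec v) :
    Primrec fun a => (g a).vert (v a) := by unfold vert; fun_prop

@[fun_prop] theorem primrec_edge (hg : Primrec g) (he : Primrec e) :
    Primrec fun a => (g a).edge (e a) := by unfold edge; fun_prop

@[fun_prop] theorem primrec_src (hg : Primrec g) (he : Primrec e) :
    Primrec fun a => (g a).src (e a) := by unfold src; fun_prop

@[fun_prop] theorem primrec_tgt (hg : Primrec g) (he : Primrec e) :
    Primrec fun a => (g a).tgt (e a) := by unfold tgt; fun_prop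

@[fun_prop] theorem primrec_srcIdx (hg : Primrec g) (he : Primrec e) :
    Primrec fun a => (g a).srcIdx (e a) := by unfold srcIdx; fun_prop

@[fun_prop] theorem primrec_tgtIdx (hg : Primrec g) (he : Primrec e) :
    Primrec fun a => (g a).tgtIdx (e a) := by unfold tgtIdx; fun_prop

@[fun_prop] theorem primrec_edgeGp (hg : Primrec g) (he : Primrec e) :
    Primrec fun a => (g a).edgeGp (e a) := by unfold edgeGp; fun_prop

@[fun_prop] theorem primrec_srcWord (hg : Primrec g) (he : Primrec e) (hc : Primrec c) :
    Primrec fun a => (g a).srcWord (e a) (c a) := by unfold srcWord; fun_prop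

@[fun_prop] theorem primrec_tgtWord (hg : Primrec g) (he : Primrec e) (hc : Primrec c) :
    Primrec fun a => (g a).tgtWord (e a) (c a) := by unfold tgtWord; fun_prop

theorem recEnum_validIn {S : FinDecPres → Prop} (hS : RecEnum S) :
    RecEnum fun g : GraphCode => g.ValidIn S := by
  unfold ValidIn
  refine RecEnum.and (RecEnum.forall_lt (by fun_prop) ?_)
    (RecEnum.forall_lt (by fun_prop) (by fun_prop))
  exact RecEnum.comp (f := fun x : GraphCode × ℕ => x.1.vert x.2) hS (by fun_prop)

@[fun_prop] theorem recEnum_mem_relations {u : α → List (Letter × Bool)} (hg : Primrec g)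
    (hu : Primrec u) : RecEnum fun a => FreeGroup.mk (u a) ∈ (g a).relations := by
  have h : RecEnum fun x : GraphCode × List (Letter × Bool) => x.1.Relator x.2 := by
    unfold Relator
    fun_prop
  exact RecEnum.comp (f := fun a => (g a, u a)) (recEnum_mem_normalClosure
    (R := fun (g : GraphCode) u => g.Relator u) h) (by fun_prop)

end
end GraphCode

/-! ### Codes of partial permutation representations -/

/-- The code of a disjoint union of coset spaces `M_v / B` for every vertex `v`, together with a map
from points (natural numbers) to this union for every `v`. -/
abbrev PointCode : Type := List (List (ℕ × Word)) × List (List (List Word))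

namespace PointCode
variable (q : PointCode)

/-- The index of the coset space which contains the point `x`. -/
def rep (v x : ℕ) : ℕ := ((q.1.getD v []).getD x (0, [])).1

/-- A representative of the coset to which the point `x` is mapped. -/
def shift (v x : ℕ) : Word := ((q.1.getD v []).getD x (0, [])).2

/-- Generators of the subgroup which defines the `y`-th coset space at `v`. -/
def stab (v y : ℕ) : List Word := (q.2.getD v []).getD y []

/-- Generators of the stabiliser of the point `x`. -/
def stabAt (v x : ℕ) : List Word :=
  (q.stab v (q.rep v x)).map fun b => q.shift v x ++ b ++ FreeGroup.invRev (q.shift v x)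

/-- The element represented by `u` maps the point `x` to the point `y`. -/
def Rel (g : GraphCode) (v x : ℕ) (u : Word) (y : ℕ) : Prop :=
  q.rep v x = q.rep v y ∧ (g.vert v).1.elt (FreeGroup.invRev (u ++ q.shift v x) ++ q.shift v y) ∈
    (g.vert v).1.gen (q.stab v (q.rep v x))

/-- The elements of a vertex group that represent the positions of the points in their cosets. -/
def pos (g : GraphCode) (v x : ℕ) : (g.vert v).1.Pres := (g.vert v).1.elt (q.shift v x)

/-- The subgroups of a vertex group that define the coset spaces. -/
def grp (g : GraphCode) (v y : ℕ) : Subgroup (g.vert v).1.Pres := (g.vert v).1.gen (q.stab v y)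

theorem rel_iff (g : GraphCode) (v x : ℕ) (u : Word) (y : ℕ) : q.Rel g v x u y ↔
    CosetRel (q.rep v) (q.pos g v) (q.grp g v) x ((g.vert v).1.elt u) y := by
  simp [Rel, CosetRel, pos, grp, mul_assoc]

/-- A finite set `{0, …, m - 1}` of points, with a list `l` of triples `(e, x, x')` which say that
the stable letter of `e` maps `x` to `x'`, is a folded partial permutation representation. -/
def Folded (g : GraphCode) (m : ℕ) (l : List (ℕ × ℕ × ℕ)) : Prop :=
  (∀ v < g.1.length, ∀ x < m, ∀ y < m, q.Rel g v x [] y → x = y) ∧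
  (∀ a ∈ l, a.1 < g.2.length ∧ a.2.1 < m ∧ a.2.2 < m) ∧
  ∀ a ∈ l, ∀ b ∈ l, a.1 = b.1 → ∀ c, (q.Rel g (g.tgt a.1) a.2.1 (g.tgtWord a.1 c) b.2.1 ↔
    q.Rel g (g.src a.1) a.2.2 (g.srcWord a.1 c) b.2.2)

/-- The letter `s` maps the point `x` to the point `y`.  Letters which do not occur in the graph of
groups act trivially. -/
def Step (g : GraphCode) (l : List (ℕ × ℕ × ℕ)) (s : Letter × Bool) (x y : ℕ) : Prop :=
  (∃ v k b, s = (Sum.inl (v, k), b) ∧ ((g.1.length ≤ v ∧ x = y) ∨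
    (v < g.1.length ∧ q.Rel g v x [(k, b)] y))) ∨
  ∃ e b, s = (Sum.inr e, b) ∧ ((g.2.length ≤ e ∧ x = y) ∨ (e < g.2.length ∧
    ((b = true ∧ (e, x, y) ∈ l) ∨ (b = false ∧ (e, y, x) ∈ l))))

/-- The word `w` maps the point `x` to the point `y`.  The list `o` contains the images of `x` under
the suffixes of `w`. -/
def Run (g : GraphCode) (m : ℕ) (l : List (ℕ × ℕ × ℕ)) (w : List (Letter × Bool)) (x y : ℕ) :
    Prop :=
  ∃ o : List ℕ, o.getD w.length 0 = x ∧ o.getD 0 0 = y ∧ (∀ i < w.length + 1, o.getD i 0 < m) ∧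
    ∀ i < w.length, q.Step g l (w.getD i (Sum.inr 0, true)) (o.getD (i + 1) 0) (o.getD i 0)

section
variable {α : Type} [Primcodable α] {g : α → GraphCode} {q : α → PointCode} {v x y m : α → ℕ}
  {u : α → Word} {l : α → List (ℕ × ℕ × ℕ)}

@[fun_prop] theorem primrec_rep (hq : Primrec q) (hv : Primrec v) (hx : Primrec x) :
    Primrec fun a => (q a).rep (v a) (x a) := by unfold rep; fun_prop

@[fun_prop] theorem primrec_shift (hq : Primrec q) (hv : Primrec v) (hx : Primrec x) :
    Primrec fun a => (q a).shift (v a) (x a) := by unfold shift; fun_prop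

@[fun_prop] theorem primrec_stab (hq : Primrec q) (hv : Primrec v) (hx : Primrec x) :
    Primrec fun a => (q a).stab (v a) (x a) := by unfold stab; fun_prop

@[fun_prop] theorem primrec_stabAt (hq : Primrec q) (hv : Primrec v) (hx : Primrec x) :
    Primrec fun a => (q a).stabAt (v a) (x a) := by unfold stabAt; fun_prop

@[fun_prop] theorem recEnum_rel (hq : Primrec q) (hg : Primrec g) (hv : Primrec v) (hx : Primrec x)
    (hu : Primrec u) (hy : Primrec y) :
    RecEnum fun a => (q a).Rel (g a) (v a) (x a) (u a) (y a) := by unfold Rel; fun_prop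

@[fun_prop] theorem recEnum_step {s : α → Letter × Bool} (hq : Primrec q) (hg : Primrec g)
    (hl : Primrec l) (hs : Primrec s) (hx : Primrec x) (hy : Primrec y) :
    RecEnum fun a => (q a).Step (g a) (l a) (s a) (x a) (y a) := by unfold Step; fun_prop

@[fun_prop] theorem recEnum_run {w : α → List (Letter × Bool)} (hq : Primrec q) (hg : Primrec g)
    (hm : Primrec m) (hl : Primrec l) (hw : Primrec w) (hx : Primrec x) (hy : Primrec y) :
    RecEnum fun a => (q a).Run (g a) (m a) (l a) (w a) (x a) (y a) := by
  unfold Run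
  have hsucc : Primrec Nat.succ := Primrec.succ
  refine RecEnum.ex (RecEnum.and (by fun_prop) (RecEnum.and (by fun_prop) (RecEnum.and
    (RecEnum.forall_lt ?_ (by fun_prop)) (RecEnum.forall_lt (by fun_prop) ?_))))
  · exact hsucc.comp (by fun_prop)
  · change RecEnum fun z : (α × List ℕ) × ℕ => (q z.1.1).Step (g z.1.1) (l z.1.1)
      ((w z.1.1).getD z.2 (Sum.inr 0, true)) (z.1.2.getD (Nat.succ z.2) 0) (z.1.2.getD z.2 0)
    fun_prop

end
end PointCode

section Cosets
variable {X Y M : Type} [Group M] {r : X → Y} {t : X → M} {B : Y → Subgroup M} {x y : X}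

/-- If `m₀` moves `x` to `y`, then `m` moves `x` to `y` if and only if `m₀⁻¹ * m` stabilises `x`. -/
theorem CosetRel.iff_of_rel {m₀ m : M} (h : CosetRel r t B x m₀ y) :
    CosetRel r t B x m y ↔ CosetRel r t B x (m₀⁻¹ * m) x := by
  obtain ⟨h1, h2⟩ := h
  have e : (m * t x)⁻¹ * t y = ((m₀⁻¹ * m) * t x)⁻¹ * t x * ((m₀ * t x)⁻¹ * t y) := by group
  simp only [CosetRel, h1, true_and] at h2 ⊢
  rw [e]
  exact Subgroup.mul_mem_cancel_right _ h2

theorem cosetRel_self_iff {m : M} :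
    CosetRel r t B x m x ↔ m ∈ (B (r x)).map (MulAut.conj (t x)).toMonoidHom := by
  simp only [CosetRel, true_and, Subgroup.mem_map, MulEquiv.toMonoidHom_eq_coe, MonoidHom.coe_coe,
    MulAut.conj_apply]
  constructor
  · intro h
    exact ⟨_, inv_mem h, by group⟩
  · rintro ⟨b, hb, rfl⟩
    convert inv_mem hb using 1
    group

/-- Two points are in different orbits of a subgroup if and only if they are in different coset
spaces or a certain element does not lie in a double coset. -/
theorem not_exists_cosetRel_iff {H : Type} [Group H] (β : H →* M) :
    (¬ ∃ c, CosetRel r t B x (β c) y) ↔ r x ≠ r y ∨ ¬ ∃ a ∈ β.range,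
      ∃ b ∈ (B (r x)).map (MulAut.conj (t x)).toMonoidHom, t y * (t x)⁻¹ = a * b := by
  rw [← not_iff_not]
  push Not
  constructor
  · rintro ⟨c, h1, h2⟩
    refine ⟨h1, β c, ⟨c, rfl⟩, _, ⟨_, h2, rfl⟩, ?_⟩
    simp
    group
  · rintro ⟨h1, _, ⟨c, rfl⟩, _, ⟨b, hb, rfl⟩, e⟩
    refine ⟨c, h1, ?_⟩
    have e' : t y = β c * t x * b := by
      rw [mul_inv_eq_iff_eq_mul] at e
      rw [e]
      simp [mul_assoc]
    rw [e']
    simpa [mul_assoc] using hb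

variable {X' Y' M' H : Type} [Group M'] [Group H] {r' : X' → Y'} {t' : X' → M'}
  {B' : Y' → Subgroup M'} {x' y' : X'}

/-- Two translates of the orbits of an edge group are glued in the same way at both ends if this
holds for the stabilisers and for a single element. -/
theorem forall_cosetRel_iff (β : H →* M) (α : H →* M')
    (h : ∀ c, CosetRel r t B x (β c) x ↔ CosetRel r' t' B' x' (α c) x') :
    (∀ c, CosetRel r t B x (β c) y ↔ CosetRel r' t' B' x' (α c) y') ↔
      (∃ c, CosetRel r t B x (β c) y ∧ CosetRel r' t' B' x' (α c) y') ∨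
      ((¬ ∃ c, CosetRel r t B x (β c) y) ∧ ¬ ∃ c, CosetRel r' t' B' x' (α c) y') := by
  constructor
  · intro H
    by_cases hc : ∃ c, CosetRel r t B x (β c) y
    · obtain ⟨c, hc⟩ := hc
      exact Or.inl ⟨c, hc, (H c).1 hc⟩
    · exact Or.inr ⟨hc, fun ⟨c, h'⟩ => hc ⟨c, (H c).2 h'⟩⟩
  · rintro (⟨c₀, h1, h2⟩ | ⟨h1, h2⟩) c
    · rw [h1.iff_of_rel, h2.iff_of_rel, ← map_inv, ← map_inv, ← map_mul, ← map_mul]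
      exact h _
    · exact ⟨fun h => absurd ⟨_, h⟩ h1, fun h => absurd ⟨_, h⟩ h2⟩

/-- An inclusion of subgroups may be checked on generators of an intersection. -/
theorem forall_mem_imp_iff (β : H →* M) (hβ : Function.Injective β) (α : H →* M')
    (K : Subgroup M) (K' : Subgroup M') (Z : Set M) (hZ : Subgroup.closure Z = β.range ⊓ K) :
    (∀ c, β c ∈ K → α c ∈ K') ↔ ∀ z ∈ Z, ∃ c, β c = z ∧ α c ∈ K' := by
  constructor
  · intro h z hz
    obtain ⟨⟨c, rfl⟩, hz'⟩ := (hZ ▸ Subgroup.subset_closure hz : z ∈ β.range ⊓ K)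
    exact ⟨c, rfl, h c hz'⟩
  · intro h c hc
    have h1 : Subgroup.closure Z ≤ (K'.comap α).map β := by
      rw [Subgroup.closure_le]
      intro z hz
      obtain ⟨c, rfl, hc⟩ := h z hz
      exact ⟨c, hc, rfl⟩
    have h2 : β c ∈ Subgroup.closure Z := by
      rw [hZ]
      exact ⟨⟨c, rfl⟩, hc⟩
    obtain ⟨d, hd, e⟩ := h1 h2
    rw [← hβ e]
    exact hd

end Cosets

theorem FinPres.gen_map_conj (p : FinPres) (t : Word) (Y : List Word) :
    p.gen (Y.map fun b => t ++ b ++ FreeGroup.invRev t) =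
      (p.gen Y).map (MulAut.conj (p.elt t)).toMonoidHom := by
  rw [gen, gen, MonoidHom.map_closure]
  congr 1
  ext g
  simp only [List.mem_map, Set.mem_ofPred_eq, Set.mem_image]
  constructor
  · rintro ⟨_, ⟨b, hb, rfl⟩, rfl⟩
    exact ⟨_, ⟨b, hb, rfl⟩, by simp [mul_assoc]⟩
  · rintro ⟨_, ⟨b, hb, rfl⟩, rfl⟩
    exact ⟨_, ⟨b, hb, rfl⟩, by simp [mul_assoc]⟩

/-- The embeddings of an edge group in the groups of the two ends of the edge. -/
theorem GraphCode.ValidIn.exists_edgeHoms {S : FinDecPres → Prop} (hS : ∀ d, S d → d.IsValid)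
    {g : GraphCode} (hg : g.ValidIn S) {e : ℕ} (he : e < g.2.length) :
    ∃ (α : (g.edgeGp e).Pres →* (g.vert (g.src e)).1.Pres)
      (β : (g.edgeGp e).Pres →* (g.vert (g.tgt e)).1.Pres),
      Function.Injective α ∧ Function.Injective β ∧
      (∀ c, α ((g.edgeGp e).elt c) = (g.vert (g.src e)).1.elt (g.srcWord e c)) ∧
      (∀ c, β ((g.edgeGp e).elt c) = (g.vert (g.tgt e)).1.elt (g.tgtWord e c)) ∧
      α.range = (g.vert (g.src e)).edgeSubgroup (g.srcIdx e) ∧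
      β.range = (g.vert (g.tgt e)).edgeSubgroup (g.tgtIdx e) := by
  obtain ⟨h1, h2, h3, h4, θ, hθ⟩ := hg.2 e he
  obtain ⟨α, a1, a2, a3⟩ := (hS _ (hg.1 _ h1)).exists_edgeHom h3
  obtain ⟨β, b1, b2, b3⟩ := (hS _ (hg.1 _ h2)).exists_edgeHom h4
  refine ⟨α, β.comp θ.toMonoidHom, a1, b1.comp θ.injective, a2, fun c => ?_, a3, ?_⟩
  · exact (congrArg β (hθ c)).trans (b2 _)
  · rw [← b3]
    ext x
    constructor
    · rintro ⟨y, rfl⟩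
      exact ⟨_, rfl⟩
    · rintro ⟨y, rfl⟩
      obtain ⟨z, rfl⟩ := θ.surjective y
      exact ⟨z, rfl⟩

/-- Foldedness of a code is semi-decidable, as non-membership in double cosets and in subgroups can
be semi-decided and generators of intersections with edge groups can be computed. -/
theorem exists_recEnum_folded {S : FinDecPres → Prop} (hS : ∀ d, S d → d.IsValid)
    {N : FinPres × List Word × Word → Prop} (hN : RecEnum N)
    (hN' : ∀ d, S d → ∀ Y z, N (d.1, Y, z) ↔ d.1.elt z ∉ d.1.gen Y)
    {D : FinDecPres × ℕ × List Word × Word → Prop} (hD : RecEnum D)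
    (hD' : ∀ d, S d → ∀ i < d.2.length, ∀ Y z, D (d, i, Y, z) ↔
      ¬ ∃ a ∈ d.edgeSubgroup i, ∃ b ∈ d.1.gen Y, d.1.elt z = a * b)
    {I : (FinDecPres × ℕ × List Word) × List Word → Prop} (hI : RecEnum I)
    (hI' : ∀ d, S d → ∀ i < d.2.length, ∀ Y, ∃ Z, I ((d, i, Y), Z))
    (hI'' : ∀ d, S d → ∀ i < d.2.length, ∀ Y Z, I ((d, i, Y), Z) →
      d.1.gen Z = d.edgeSubgroup i ⊓ d.1.gen Y) :
    ∃ R : PointCode × GraphCode × ℕ × List (ℕ × ℕ × ℕ) → Prop, RecEnum R ∧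
      ∀ q g m l, g.ValidIn S → (R (q, g, m, l) ↔ q.Folded g m l) := by
  have hNf : ∀ {α : Type} [Primcodable α] {f : α → FinPres} {h : α → List Word} {k : α → Word},
      Primrec f → Primrec h → Primrec k → RecEnum fun a => N (f a, h a, k a) :=
    fun hf hh hk => RecEnum.comp (f := fun a => (_, _, _)) hN (hf.pair (hh.pair hk))
  have hDf : ∀ {α : Type} [Primcodable α] {f : α → FinDecPres} {i : α → ℕ} {h : α → List Word}
      {k : α → Word}, Primrec f → Primrec i → Primrec h → Primrec k →
      RecEnum fun a => D (f a, i a, h a, k a) :=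
    fun hf hi hh hk => RecEnum.comp (f := fun a => (_, _, _, _)) hD (hf.pair (hi.pair (hh.pair hk)))
  have hIf : ∀ {α : Type} [Primcodable α] {f : α → FinDecPres} {i : α → ℕ} {h : α → List Word}
      {k : α → List Word}, Primrec f → Primrec i → Primrec h → Primrec k →
      RecEnum fun a => I ((f a, i a, h a), k a) :=
    fun hf hi hh hk => RecEnum.comp (f := fun a => ((_, _, _), _)) hI
      ((hf.pair (hi.pair hh)).pair hk)
  -- distinct points are mapped to distinct elements of the coset spaces
  let R1 : PointCode → GraphCode → ℕ → Prop := fun q g m => ∀ v < g.1.length, ∀ x < m, ∀ y < m,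
    x = y ∨ q.rep v x ≠ q.rep v y ∨ N ((g.vert v).1, q.stab v (q.rep v x),
      FreeGroup.invRev ([] ++ q.shift v x) ++ q.shift v y)
  -- the stabilisers in the edge group at both ends agree
  let R2 : PointCode → GraphCode → ℕ × ℕ × ℕ → Prop := fun q g a =>
    (∃ Z, I ((g.vert (g.tgt a.1), g.tgtIdx a.1, q.stabAt (g.tgt a.1) a.2.1), Z) ∧
      ∀ z ∈ Z, ∃ c,
        (g.vert (g.tgt a.1)).1.elt (g.tgtWord a.1 c) = (g.vert (g.tgt a.1)).1.elt z ∧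
        (g.vert (g.src a.1)).1.elt (g.srcWord a.1 c) ∈
          (g.vert (g.src a.1)).1.gen (q.stabAt (g.src a.1) a.2.2)) ∧
    (∃ Z, I ((g.vert (g.src a.1), g.srcIdx a.1, q.stabAt (g.src a.1) a.2.2), Z) ∧
      ∀ z ∈ Z, ∃ c,
        (g.vert (g.src a.1)).1.elt (g.srcWord a.1 c) = (g.vert (g.src a.1)).1.elt z ∧
        (g.vert (g.tgt a.1)).1.elt (g.tgtWord a.1 c) ∈
          (g.vert (g.tgt a.1)).1.gen (q.stabAt (g.tgt a.1) a.2.1))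
  -- two points are glued by a common element at both ends, or lie in different orbits at both ends
  let R3 : PointCode → GraphCode → ℕ × ℕ × ℕ → ℕ × ℕ × ℕ → Prop := fun q g a b =>
    (∃ c, q.Rel g (g.tgt a.1) a.2.1 (g.tgtWord a.1 c) b.2.1 ∧
      q.Rel g (g.src a.1) a.2.2 (g.srcWord a.1 c) b.2.2) ∨
    ((q.rep (g.tgt a.1) a.2.1 ≠ q.rep (g.tgt a.1) b.2.1 ∨
        D (g.vert (g.tgt a.1), g.tgtIdx a.1, q.stabAt (g.tgt a.1) a.2.1,
          q.shift (g.tgt a.1) b.2.1 ++ FreeGroup.invRev (q.shift (g.tgt a.1) a.2.1))) ∧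
      (q.rep (g.src a.1) a.2.2 ≠ q.rep (g.src a.1) b.2.2 ∨
        D (g.vert (g.src a.1), g.srcIdx a.1, q.stabAt (g.src a.1) a.2.2,
          q.shift (g.src a.1) b.2.2 ++ FreeGroup.invRev (q.shift (g.src a.1) a.2.2))))
  refine ⟨fun x => R1 x.1 x.2.1 x.2.2.1 ∧
    (∀ a ∈ x.2.2.2, (a.1 < x.2.1.2.length ∧ a.2.1 < x.2.2.1 ∧ a.2.2 < x.2.2.1) ∧
      R2 x.1 x.2.1 a) ∧
    ∀ a ∈ x.2.2.2, ∀ b ∈ x.2.2.2, a.1 ≠ b.1 ∨ R3 x.1 x.2.1 a b, ?_, ?_⟩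
  · refine RecEnum.and ?_ (RecEnum.and ?_ ?_)
    · refine RecEnum.forall_lt (by fun_prop) (RecEnum.forall_lt (by fun_prop)
        (RecEnum.forall_lt (by fun_prop) (RecEnum.or (by fun_prop) (RecEnum.or (by fun_prop) ?_))))
      exact hNf (by fun_prop) (by fun_prop) (by fun_prop)
    · refine RecEnum.forall_mem (by fun_prop) (RecEnum.and (by fun_prop) (RecEnum.and ?_ ?_)) <;>
      refine RecEnum.ex (RecEnum.and ?_ (RecEnum.forall_mem (by fun_prop) (by fun_prop))) <;>
      exact hIf (by fun_prop) (by fun_prop) (by fun_prop) (by fun_prop)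
    · refine RecEnum.forall_mem (by fun_prop) (RecEnum.forall_mem (by fun_prop)
        (RecEnum.or (by fun_prop) (RecEnum.or (by fun_prop) (RecEnum.and ?_ ?_)))) <;>
      refine RecEnum.or (by fun_prop) ?_ <;>
      exact hDf (by fun_prop) (by fun_prop) (by fun_prop) (by fun_prop)
  · intro q g m l hg
    have h1 : R1 q g m ↔ ∀ v < g.1.length, ∀ x < m, ∀ y < m, q.Rel g v x [] y → x = y := by
      refine forall₂_congr fun v hv => forall₂_congr fun x _ => forall₂_congr fun y _ => ?_
      rw [hN' _ (hg.1 v hv), PointCode.Rel]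
      tauto
    have hstab : ∀ v x, (g.vert v).1.gen (q.stabAt v x) =
        (q.grp g v (q.rep v x)).map (MulAut.conj (q.pos g v x)).toMonoidHom := fun v x =>
      FinPres.gen_map_conj _ _ _
    have h2 : ∀ a : ℕ × ℕ × ℕ, a.1 < g.2.length → (R2 q g a ↔ ∀ c,
        (q.Rel g (g.tgt a.1) a.2.1 (g.tgtWord a.1 c) a.2.1 ↔
          q.Rel g (g.src a.1) a.2.2 (g.srcWord a.1 c) a.2.2)) := by
      rintro ⟨e, x, x'⟩ he
      dsimp only at he ⊢
      obtain ⟨v1, v2, v3, v4, -⟩ := hg.2 e he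
      obtain ⟨α, β, a1, b1, a2, b2, a3, b3⟩ := hg.exists_edgeHoms hS he
      have key : ∀ c, (q.Rel g (g.tgt e) x (g.tgtWord e c) x ↔ β ((g.edgeGp e).elt c) ∈
          (g.vert (g.tgt e)).1.gen (q.stabAt (g.tgt e) x)) := by
        intro c
        rw [hstab, ← cosetRel_self_iff, PointCode.rel_iff, b2]
      have key' : ∀ c, (q.Rel g (g.src e) x' (g.srcWord e c) x' ↔ α ((g.edgeGp e).elt c) ∈
          (g.vert (g.src e)).1.gen (q.stabAt (g.src e) x')) := by
        intro c
        rw [hstab, ← cosetRel_self_iff, PointCode.rel_iff, a2]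
      have hsurj := (g.edgeGp e).elt_surjective
      have c1 := fun Z hZ => forall_mem_imp_iff β b1 α _
        ((g.vert (g.src e)).1.gen (q.stabAt (g.src e) x')) _
        (b3 ▸ hI'' _ (hg.1 _ v2) _ v4 (q.stabAt (g.tgt e) x) Z hZ)
      have c2 := fun Z hZ => forall_mem_imp_iff α a1 β _
        ((g.vert (g.tgt e)).1.gen (q.stabAt (g.tgt e) x)) _
        (a3 ▸ hI'' _ (hg.1 _ v1) _ v3 (q.stabAt (g.src e) x') Z hZ)
      simp only [hsurj.forall, hsurj.exists, Set.mem_ofPred_eq, forall_exists_index, and_imp]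
        at c1 c2
      simp only [key, key', R2, ← a2, ← b2]
      constructor
      · rintro ⟨⟨Z, hZ, h⟩, ⟨Z', hZ', h'⟩⟩ c
        refine ⟨(c1 Z hZ).2 ?_ c, (c2 Z' hZ').2 ?_ c⟩
        · rintro _ z hz rfl
          exact h z hz
        · rintro _ z hz rfl
          exact h' z hz
      · intro h
        obtain ⟨Z, hZ⟩ := hI' _ (hg.1 _ v2) _ v4 (q.stabAt (g.tgt e) x)
        obtain ⟨Z', hZ'⟩ := hI' _ (hg.1 _ v1) _ v3 (q.stabAt (g.src e) x')
        exact ⟨⟨Z, hZ, fun z hz => (c1 Z hZ).1 (fun c => (h c).1) _ z hz rfl⟩,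
          ⟨Z', hZ', fun z hz => (c2 Z' hZ').1 (fun c => (h c).2) _ z hz rfl⟩⟩
    have h3 : ∀ a b : ℕ × ℕ × ℕ, a.1 < g.2.length → (∀ c,
        (q.Rel g (g.tgt a.1) a.2.1 (g.tgtWord a.1 c) a.2.1 ↔
          q.Rel g (g.src a.1) a.2.2 (g.srcWord a.1 c) a.2.2)) → (R3 q g a b ↔ ∀ c,
        (q.Rel g (g.tgt a.1) a.2.1 (g.tgtWord a.1 c) b.2.1 ↔
          q.Rel g (g.src a.1) a.2.2 (g.srcWord a.1 c) b.2.2)) := by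
      rintro ⟨e, x, x'⟩ ⟨-, y, y'⟩ he h
      dsimp only at he h ⊢
      obtain ⟨v1, v2, v3, v4, -⟩ := hg.2 e he
      obtain ⟨α, β, a1, b1, a2, b2, a3, b3⟩ := hg.exists_edgeHoms hS he
      have hsurj := (g.edgeGp e).elt_surjective
      simp only [PointCode.rel_iff, ← a2, ← b2] at h
      rw [← hsurj.forall (p := fun c => CosetRel (q.rep (g.tgt e)) (q.pos g (g.tgt e))
        (q.grp g (g.tgt e)) x (β c) x ↔ CosetRel (q.rep (g.src e)) (q.pos g (g.src e))
        (q.grp g (g.src e)) x' (α c) x')] at h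
      have := forall_cosetRel_iff (y := y) (y' := y') β α h
      rw [not_exists_cosetRel_iff, not_exists_cosetRel_iff, ← hstab, ← hstab, a3, b3] at this
      rw [hsurj.forall, hsurj.exists] at this
      simp only [PointCode.rel_iff, ← a2, ← b2, R3]
      rw [this, hD' _ (hg.1 _ v2) _ v4, hD' _ (hg.1 _ v1) _ v3]
      simp only [PointCode.pos, FinPres.elt_append, FinPres.elt_invRev]
    dsimp only
    rw [h1, PointCode.Folded]
    refine and_congr_right fun _ => ?_
    constructor
    · rintro ⟨ha, hb⟩
      refine ⟨fun a h => (ha a h).1, fun a h b h' e => ?_⟩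
      exact (h3 a b (ha a h).1.1 ((h2 a (ha a h).1.1).1 (ha a h).2)).1
        ((hb a h b h').resolve_left (not_not.2 e))
    · rintro ⟨ha, hb⟩
      refine ⟨fun a h => ⟨ha a h, (h2 a (ha a h).1).2 (hb a h a h rfl)⟩, fun a h b h' => ?_⟩
      by_cases e : a.1 = b.1
      · exact Or.inr ((h3 a b (ha a h).1 (hb a h a h rfl)).2 (hb a h b h' e))
      · exact Or.inl e

/-! ### Certificates of non-membership -/

/-- A certificate that `z` is not in the subgroup generated by `Y`: words `us` for the generators of
`p`, which define a homomorphism to the group of a graph of groups, and a folded partial permutation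
representation in which `Y` fixes the point `0`, but `z` does not. -/
def IsSeparated (S : FinDecPres → Prop) (p : FinPres) (Y : List Word) (z : Word) : Prop :=
  ∃ (g : GraphCode) (us : List (List (Letter × Bool))) (m : ℕ) (q : PointCode)
    (l : List (ℕ × ℕ × ℕ)), g.ValidIn S ∧ (us.length ≤ p.1 ∧
      ∀ r ∈ p.2, FreeGroup.mk (wordSubst (fun k => us.getD k []) r) ∈ g.relations) ∧
    q.Folded g m l ∧ (∀ w ∈ Y, q.Run g m l (wordSubst (fun k => us.getD k []) w) 0 0) ∧
    ∃ x, x ≠ 0 ∧ q.Run g m l (wordSubst (fun k => us.getD k []) z) 0 x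

theorem recEnum_isSeparated {S : FinDecPres → Prop} (hS : RecEnum S)
    (h : ∃ R : PointCode × GraphCode × ℕ × List (ℕ × ℕ × ℕ) → Prop, RecEnum R ∧
      ∀ q g m l, g.ValidIn S → (R (q, g, m, l) ↔ q.Folded g m l)) :
    RecEnum fun x : FinPres × List Word × Word => IsSeparated S x.1 x.2.1 x.2.2 := by
  obtain ⟨R, hR, h⟩ := h
  have : RecEnum fun x : FinPres × List Word × Word =>
      ∃ (g : GraphCode) (us : List (List (Letter × Bool))) (m : ℕ) (q : PointCode)
      (l : List (ℕ × ℕ × ℕ)), g.ValidIn S ∧ (us.length ≤ x.1.1 ∧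
        ∀ r ∈ x.1.2, FreeGroup.mk (wordSubst (fun k => us.getD k []) r) ∈ g.relations) ∧
      R (q, g, m, l) ∧ (∀ w ∈ x.2.1, q.Run g m l (wordSubst (fun k => us.getD k []) w) 0 0) ∧
      ∃ x', x' ≠ 0 ∧ q.Run g m l (wordSubst (fun k => us.getD k []) x.2.2) 0 x' := by
    refine RecEnum.ex (RecEnum.ex (RecEnum.ex (RecEnum.ex (RecEnum.ex (RecEnum.and ?_
      (RecEnum.and (RecEnum.and (by fun_prop) (RecEnum.forall_mem (by fun_prop) (by fun_prop)))
        (RecEnum.and ?_ (RecEnum.and (RecEnum.forall_mem (by fun_prop) (by fun_prop))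
          (by fun_prop)))))))))
    · exact RecEnum.comp (f := fun x : (((((FinPres × List Word × Word) × GraphCode) ×
        List (List (Letter × Bool))) × ℕ) × PointCode) × List (ℕ × ℕ × ℕ) => x.1.1.1.1.2)
        (GraphCode.recEnum_validIn hS) (by fun_prop)
    · exact RecEnum.comp (f := fun x : (((((FinPres × List Word × Word) × GraphCode) ×
        List (List (Letter × Bool))) × ℕ) × PointCode) × List (ℕ × ℕ × ℕ) =>
        (x.1.2, x.1.1.1.1.2, x.1.1.2, x.2)) hR (by fun_prop)
  refine this.of_iff fun x => ?_
  unfold IsSeparated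
  refine exists_congr fun g => exists_congr fun us => exists_congr fun m => exists_congr fun q =>
    exists_congr fun l => and_congr_right fun hg => and_congr_right fun _ => ?_
  rw [h q g m l hg]

theorem smul_sigma_mk_eq_iff {X Y M : Type} [Group M] (r : X → Y) (t : X → M)
    (B : Y → Subgroup M) (x : X) (m : M) (y : X) :
    m • (⟨r x, (t x : M ⧸ B (r x))⟩ : Σ y, M ⧸ B y) = ⟨r y, (t y : M ⧸ B (r y))⟩ ↔
      CosetRel r t B x m y := by
  have key : ∀ (a b : Y) (s s' : M), (⟨a, (s : M ⧸ B a)⟩ : Σ y, M ⧸ B y) = ⟨b, (s' : M ⧸ B b)⟩ ↔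
      a = b ∧ s⁻¹ * s' ∈ B a := by
    intro a b s s'
    constructor
    · intro h
      obtain rfl : a = b := congrArg Sigma.fst h
      exact ⟨rfl, QuotientGroup.eq.1 (by simpa using h)⟩
    · rintro ⟨rfl, h⟩
      rw [QuotientGroup.eq.2 h]
  exact key _ _ _ _

/-- The homomorphism on the free group on all letters, for given homomorphisms `ρ` on the vertex
groups and images `σ` of the stable letters.  Letters which do not occur are sent to `1`. -/
def GraphCode.letterHom (g : GraphCode) {G : Type*} [Group G]
    (ρ : ∀ v : {v // v < g.1.length}, (g.vert v).1.Pres →* G) (σ : {e // e < g.2.length} → G) :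
    FreeGroup Letter →* G :=
  FreeGroup.lift fun s => match s with
    | Sum.inl (v, k) => if h : v < g.1.length then ρ ⟨v, h⟩ ((g.vert v).1.elt [(k, true)]) else 1
    | Sum.inr e => if h : e < g.2.length then σ ⟨e, h⟩ else 1

section LetterHom
variable {g : GraphCode} {G : Type*} [Group G]
    {ρ : ∀ v : {v // v < g.1.length}, (g.vert v).1.Pres →* G} {σ : {e // e < g.2.length} → G}

theorem GraphCode.letterHom_vertexWord {v : ℕ} (hv : v < g.1.length) (u : Word) :
    g.letterHom ρ σ (FreeGroup.mk (vertexWord v u)) = ρ ⟨v, hv⟩ ((g.vert v).1.elt u) := by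
  rw [mk_vertexWord, FinPres.map_elt]
  exact DFunLike.congr_fun (f := (g.letterHom ρ σ).comp (FreeGroup.lift _))
    (FreeGroup.ext_hom _ _ (by intro k; simp [letterHom, hv])) (FreeGroup.mk u)

theorem GraphCode.letterHom_stable {e : ℕ} (he : e < g.2.length) :
    g.letterHom ρ σ (FreeGroup.of (Sum.inr e)) = σ ⟨e, he⟩ := by
  simp [letterHom, he]

/-- The relations of a graph of groups hold if the stable letters intertwine the embeddings of the
edge groups. -/
theorem GraphCode.letterHom_eq_one_of_mem (h1 : ∀ e < g.2.length, g.src e < g.1.length)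
    (h2 : ∀ e < g.2.length, g.tgt e < g.1.length)
    (h : ∀ e (he : e < g.2.length) c,
      σ ⟨e, he⟩ * ρ ⟨g.tgt e, h2 e he⟩ ((g.vert (g.tgt e)).1.elt (g.tgtWord e c)) =
        ρ ⟨g.src e, h1 e he⟩ ((g.vert (g.src e)).1.elt (g.srcWord e c)) * σ ⟨e, he⟩)
    {x : FreeGroup Letter} (hx : x ∈ g.relations) : g.letterHom ρ σ x = 1 := by
  suffices g.relations ≤ (g.letterHom ρ σ).ker from this hx
  refine Subgroup.normalClosure_le_normal ?_
  rintro _ ⟨_, ⟨v, hv, u, hu, rfl⟩ | ⟨e, he, c, rfl⟩, rfl⟩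
  · change g.letterHom ρ σ _ = 1
    rw [letterHom_vertexWord hv, hu, FinPres.elt_nil, map_one]
  · change g.letterHom ρ σ _ = 1
    rw [mk_append, mk_append, mk_append, mk_invRev, mk_singleton_true, mk_singleton_false, map_mul,
      map_mul, map_mul, map_inv, map_inv, letterHom_stable he, letterHom_vertexWord (h2 e he),
      letterHom_vertexWord (h1 e he), h e he c]
    group

end LetterHom

/-- The image under a permutation representation of a word in the letters is computed by runs. -/
theorem PointCode.Run.apply_eq {q : PointCode} {g : GraphCode} {m : ℕ} {l : List (ℕ × ℕ × ℕ)}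
    {S : Type*} (A : FreeGroup Letter →* Equiv.Perm S) (j : ℕ → S)
    (hstep : ∀ s x y, x < m → y < m → q.Step g l s x y → A (FreeGroup.mk [s]) (j x) = j y)
    {w : List (Letter × Bool)} {x y : ℕ} (h : q.Run g m l w x y) :
    A (FreeGroup.mk w) (j x) = j y := by
  obtain ⟨o, rfl, rfl, hm, h⟩ := h
  suffices ∀ i ≤ w.length, A (FreeGroup.mk (w.drop i)) (j (o.getD w.length 0)) = j (o.getD i 0) by
    simpa using this 0 (Nat.zero_le _)
  intro i hi
  induction hi using Nat.decreasingInduction with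
  | self =>
    rw [List.drop_length]
    change A 1 _ = _
    simp
  | of_succ i hi ih =>
    have hi' : i < w.length := hi
    rw [List.drop_eq_getElem_cons hi', mk_cons, map_mul, Equiv.Perm.mul_apply, ih]
    have := h i hi'
    rw [List.getD_eq_getElem _ _ hi'] at this
    exact hstep _ _ _ (hm _ (by omega)) (hm _ (by omega)) this

/-- Soundness of certificates.  The partial permutation representation extends to a permutation
representation of the group with presentation `p`, in which the subgroup generated by `Y` fixes the
point `0`, whereas `z` does not. -/
theorem IsSeparated.not_mem {S : FinDecPres → Prop} (hS : ∀ d, S d → d.IsValid) {p : FinPres}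
    {Y : List Word} {z : Word} (h : IsSeparated S p Y z) : p.elt z ∉ p.gen Y := by
  obtain ⟨g, us, m, q, l, hg, ⟨hlen, hr⟩, ⟨f1, f2, f3⟩, hY, x, hx, hz⟩ := h
  have hE := fun e (he : e < g.2.length) => hg.exists_edgeHoms hS he
  choose α β hα hβ hα' hβ' _ _ using fun e : {e // e < g.2.length} => hE e.1 e.2
  let src : {e // e < g.2.length} → {v // v < g.1.length} :=
    fun e => ⟨g.src e, (hg.2 e e.2).1⟩
  let tgt : {e // e < g.2.length} → {v // v < g.1.length} :=
    fun e => ⟨g.tgt e, (hg.2 e e.2).2.1⟩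
  let Q : {v // v < g.1.length} → Type := fun v => Σ y, (g.vert v).1.Pres ⧸ q.grp g v y
  let ι : ∀ v, {x // x < m} → Q v := fun v x => ⟨q.rep v x, (q.pos g v x : (g.vert v).1.Pres)⟩
  have hι : ∀ (v : {v // v < g.1.length}) (x y : {x // x < m}) (u : Word),
      (g.vert v).1.elt u • ι v x = ι v y ↔ q.Rel g v x u y := by
    intro v x y u
    rw [PointCode.rel_iff]
    exact smul_sigma_mk_eq_iff (q.rep v) (q.pos g v) (q.grp g v) _ _ _
  obtain ⟨S', ρ, σ, j, hj, hσ, hρ, hσ'⟩ := exists_perm_extension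
    (M := fun v : {v // v < g.1.length} => (g.vert v).1.Pres)
    (H := fun e : {e // e < g.2.length} => (g.edgeGp e).Pres) (src := src) (tgt := tgt)
    α β hα hβ ι (by
      intro v x y h
      refine Subtype.ext (f1 v v.2 x x.2 y y.2 ((hι v x y []).1 ?_))
      rw [FinPres.elt_nil, one_smul, h])
    (fun e x x' => (e.1, x.1, x'.1) ∈ l) (by
      intro e x x' y y' c h h'
      obtain ⟨c, rfl⟩ := (g.edgeGp e).elt_surjective c
      have := f3 _ h _ h' rfl c
      rw [hα', hβ']
      exact (hι (tgt e) x y _).trans (this.trans (hι (src e) x' y' _).symm))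
  let A := g.letterHom ρ σ
  have hm : 0 < m := by
    obtain ⟨o, h1, -, h2, -⟩ := hz
    have := h2 _ (Nat.lt_succ_self _)
    omega
  let j' : ℕ → S' := fun x => if h : x < m then j ⟨x, h⟩ else j ⟨0, hm⟩
  have hj' : ∀ x (h : x < m), j' x = j ⟨x, h⟩ := fun x h => dif_pos h
  have hrun : ∀ {w : List (Letter × Bool)} {x y : ℕ}, q.Run g m l w x y →
      A (FreeGroup.mk w) (j' x) = j' y := by
    intro w x y h
    refine h.apply_eq A j' fun s x y hx hy hs => ?_
    rw [hj' x hx, hj' y hy]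
    rcases hs with ⟨v, k, b, rfl, ⟨hv, rfl⟩ | ⟨hv, hs⟩⟩ | ⟨e, b, rfl, ⟨he, rfl⟩ | ⟨he, hs⟩⟩
    · have : A (FreeGroup.of (Sum.inl (v, k))) = 1 := by
        simp [A, GraphCode.letterHom, not_lt.2 hv]
      cases b
      · rw [mk_singleton_false, map_inv, this]; rfl
      · rw [mk_singleton_true, this]; rfl
    · have : A (FreeGroup.mk [(Sum.inl (v, k), b)]) = ρ ⟨v, hv⟩ ((g.vert v).1.elt [(k, b)]) :=
        GraphCode.letterHom_vertexWord hv [(k, b)]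
      rw [this]
      exact hρ ⟨v, hv⟩ _ _ _ ((hι ⟨v, hv⟩ ⟨x, hx⟩ ⟨y, hy⟩ _).2 hs)
    · have : A (FreeGroup.of (Sum.inr e)) = 1 := by
        simp [A, GraphCode.letterHom, not_lt.2 he]
      cases b
      · rw [mk_singleton_false, map_inv, this]; rfl
      · rw [mk_singleton_true, this]; rfl
    · have : A (FreeGroup.of (Sum.inr e)) = σ ⟨e, he⟩ := GraphCode.letterHom_stable he
      rcases hs with ⟨rfl, hs⟩ | ⟨rfl, hs⟩
      · rw [mk_singleton_true, this]
        exact hσ' ⟨e, he⟩ ⟨x, hx⟩ ⟨y, hy⟩ hs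
      · rw [mk_singleton_false, map_inv, this, Equiv.Perm.inv_eq_iff_eq]
        exact (hσ' ⟨e, he⟩ ⟨y, hy⟩ ⟨x, hx⟩ hs).symm
  obtain ⟨f, hf⟩ := p.exists_hom (fun k => A (FreeGroup.mk (us.getD k []))) (by
      intro k hk
      rw [List.getD_eq_default _ _ (hlen.trans hk)]
      exact A.map_one) (by
      intro r hr'
      have e : FreeGroup.lift (fun k => A (FreeGroup.mk (us.getD k []))) (FreeGroup.mk r) =
          A (FreeGroup.mk (wordSubst (fun k => us.getD k []) r)) := (lift_mk_wordSubst _ _ _).symm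
      rw [e]
      refine GraphCode.letterHom_eq_one_of_mem (fun e he => (hg.2 e he).1)
        (fun e he => (hg.2 e he).2.1) (fun e he c => ?_) (hr r hr')
      have := hσ ⟨e, he⟩ ((g.edgeGp e).elt c)
      rw [hα', hβ'] at this
      exact this)
  have hf' : ∀ w, f (p.elt w) = A (FreeGroup.mk (wordSubst (fun k => us.getD k []) w)) :=
    fun w => (hf w).trans (lift_mk_wordSubst _ _ _).symm
  intro hmem
  have hstab : p.gen Y ≤ (MulAction.stabilizer (Equiv.Perm S') (j' 0)).comap f := by
    rw [FinPres.gen, Subgroup.closure_le]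
    rintro _ ⟨w, hw, rfl⟩
    change f _ (j' 0) = j' 0
    rw [hf']
    exact hrun (hY w hw)
  have h0 : f (p.elt z) (j' 0) = j' 0 := hstab hmem
  rw [hf', hrun hz] at h0
  obtain ⟨o, -, h1, h2, -⟩ := hz
  have hxm : x < m := h1 ▸ h2 0 (Nat.succ_pos _)
  rw [hj' x hxm, hj' 0 hm] at h0
  exact hx (congrArg Subtype.val (hj h0))

/-! ### Existence of certificates -/

/-- A finite set can be enumerated without repetitions, starting from a given element. -/
theorem Set.Finite.exists_enum {A : Type*} {s : Set A} (hs : s.Finite) {a : A} (ha : a ∈ s) :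
    ∃ (m : ℕ) (hm : 0 < m) (j : Fin m → A), Function.Injective j ∧ j ⟨0, hm⟩ = a ∧
      ∀ b ∈ s, ∃ i, j i = b := by
  have := hs.to_subtype
  obtain ⟨m, ⟨e⟩⟩ := Finite.exists_equiv_fin s
  have hm : 0 < m := Nat.lt_of_le_of_lt (Nat.zero_le _) (e ⟨a, ha⟩).2
  refine ⟨m, hm, fun i => (e.symm (Equiv.swap ⟨0, hm⟩ (e ⟨a, ha⟩) i) : s),
    Subtype.val_injective.comp (e.symm.injective.comp (Equiv.injective _)), ?_, fun b hb => ?_⟩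
  · simp
  · exact ⟨Equiv.swap ⟨0, hm⟩ (e ⟨a, ha⟩) (e ⟨b, hb⟩), by simp⟩

theorem FinPres.exists_gen_eq (p : FinPres) {K : Subgroup p.Pres} (hK : K.FG) :
    ∃ Y, p.gen Y = K := by
  obtain ⟨s, rfl⟩ := hK
  choose u hu using p.elt_surjective
  refine ⟨s.toList.map u, ?_⟩
  rw [gen]
  congr 1
  ext x
  simp only [List.mem_map, Finset.mem_toList, Set.mem_ofPred_eq, Finset.mem_coe]
  constructor
  · rintro ⟨_, ⟨y, hy, rfl⟩, rfl⟩
    rwa [hu]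
  · intro hx
    exact ⟨_, ⟨x, hx, rfl⟩, (hu x).symm⟩

/-- If the group of the graph of groups acts on some set in such a way that `Y` fixes the point `o`
and `z` does not, then there is a certificate.  It consists of the points through which the words
`Y` and `z` move the point `o`. -/
theorem isSeparated_of_action {S : FinDecPres → Prop} (hS : ∀ d, S d → d.IsValid) {g : GraphCode}
    (hg : g.ValidIn S) (hsl : ∀ e < g.2.length, IsSlender (g.edgeGp e).Pres) {G A : Type*} [Group G]
    [MulAction G A] (ρ : ∀ v : {v // v < g.1.length}, (g.vert v).1.Pres →* G)
    (σ : {e // e < g.2.length} → G)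
    (hσ : ∀ e (he : e < g.2.length) c, σ ⟨e, he⟩ * ρ ⟨g.tgt e, (hg.2 e he).2.1⟩
        ((g.vert (g.tgt e)).1.elt (g.tgtWord e c)) =
      ρ ⟨g.src e, (hg.2 e he).1⟩ ((g.vert (g.src e)).1.elt (g.srcWord e c)) * σ ⟨e, he⟩)
    {p : FinPres} {Y : List Word} {z : Word} (us : List (List (Letter × Bool)))
    (hlen : us.length ≤ p.1)
    (hr : ∀ r ∈ p.2, FreeGroup.mk (wordSubst (fun k => us.getD k []) r) ∈ g.relations) (o : A)
    (hY : ∀ w ∈ Y, g.letterHom ρ σ (FreeGroup.mk (wordSubst (fun k => us.getD k []) w)) • o = o)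
    (hz : g.letterHom ρ σ (FreeGroup.mk (wordSubst (fun k => us.getD k []) z)) • o ≠ o) :
    IsSeparated S p Y z := by
  let Φ := g.letterHom ρ σ
  let Ws : List (List (Letter × Bool)) := (z :: Y).map (wordSubst fun k => us.getD k [])
  -- the orbit of `o` under the suffixes of the words
  have hpts : {a : A | ∃ W ∈ Ws, ∃ i < W.length + 1,
      a = Φ (FreeGroup.mk (W.drop i)) • o}.Finite := by
    have : {a : A | ∃ W ∈ Ws, ∃ i < W.length + 1, a = Φ (FreeGroup.mk (W.drop i)) • o} =
        ⋃ W ∈ {W | W ∈ Ws}, (fun i => Φ (FreeGroup.mk (W.drop i)) • o) ''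
          Set.Iio (W.length + 1) := by
      ext a
      simp [eq_comm]
    rw [this]
    exact (List.finite_toSet Ws).biUnion fun W _ => (Set.finite_Iio _).image _
  obtain ⟨m, hm, j, hj, hj0, hjs⟩ := hpts.exists_enum (a := o)
    ⟨_, List.mem_map.2 ⟨z, List.mem_cons_self, rfl⟩, _, Nat.lt_succ_self _, by
      rw [List.drop_length]
      change o = Φ 1 • o
      rw [map_one, one_smul]⟩
  let Ls : Set (Letter × Bool) := {s | s ∈ Ws.flatten}
  have hLs : Ls.Finite := List.finite_toSet _
  choose α β hα hβ hα' hβ' _ _ using fun e : {e // e < g.2.length} => hg.exists_edgeHoms hS e.2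
  -- the relations between the points that are witnessed by letters of the words
  let St : ∀ v : {v // v < g.1.length}, Set (Fin m × (g.vert v).1.Pres × Fin m) := fun v =>
    {t | ∃ k b, (Sum.inl (v.1, k), b) ∈ Ls ∧ t.2.1 = (g.vert v).1.elt [(k, b)] ∧
      ρ v t.2.1 • j t.1 = j t.2.2}
  have hSt : ∀ v, (St v).Finite := by
    intro v
    refine ((Set.finite_univ (α := Fin m)).prod ((hLs.image fun s => (g.vert v).1.elt
      [(Sum.elim Prod.snd id s.1, s.2)]).prod (Set.finite_univ (α := Fin m)))).subset ?_
    rintro ⟨x, _, y⟩ ⟨k, b, hs, rfl, -⟩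
    exact ⟨trivial, ⟨_, hs, rfl⟩, trivial⟩
  let L : {e // e < g.2.length} → Fin m → Fin m → Prop := fun e x y => σ e • j x = j y
  obtain ⟨r, t, B, hB, h1, h2, h3⟩ := exists_finitely_generated_partial_perm
    (M := fun v : {v // v < g.1.length} => (g.vert v).1.Pres)
    (H := fun e : {e // e < g.2.length} => (g.edgeGp e).Pres)
    (src := fun e => ⟨g.src e, (hg.2 e e.2).1⟩) (tgt := fun e => ⟨g.tgt e, (hg.2 e e.2).2.1⟩)
    (α := α) (β := β) (St := St) (L := L) (fun e => hsl e e.2) hSt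
    (fun v => (MulAction.toPermHom G A).comp (ρ v)) (fun e => MulAction.toPermHom G A (σ e)) j hj
    (by
      intro e c
      obtain ⟨c, rfl⟩ := (g.edgeGp e).elt_surjective c
      rw [hα', hβ', MonoidHom.comp_apply, MonoidHom.comp_apply, ← map_mul, ← map_mul, hσ e e.2])
    (fun v x m y ⟨_, _, _, _, h⟩ => h) (fun e x y h => h)
  choose u hu using fun v : {v // v < g.1.length} => (g.vert v).1.elt_surjective
  choose Z hZ using fun (v : {v // v < g.1.length}) y => (g.vert v).1.exists_gen_eq (hB v y)
  -- the code of the finitely generated partial representation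
  let q : PointCode :=
    (List.ofFn fun v : Fin g.1.length => List.ofFn fun x : Fin m =>
      ((r ⟨v.1, v.2⟩ x : ℕ), u ⟨v.1, v.2⟩ (t ⟨v.1, v.2⟩ x)),
    List.ofFn fun v : Fin g.1.length => List.ofFn fun x : Fin m => Z ⟨v.1, v.2⟩ x)
  have hrep : ∀ v (hv : v < g.1.length) (x : Fin m), q.rep v x = r ⟨v, hv⟩ x := by
    intro v hv x
    simp [PointCode.rep, q, hv]
  have hshift : ∀ v (hv : v < g.1.length) (x : Fin m),
      q.shift v x = u ⟨v, hv⟩ (t ⟨v, hv⟩ x) := by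
    intro v hv x
    simp [PointCode.shift, q, hv]
  have hstab : ∀ v (hv : v < g.1.length) (x : Fin m), q.stab v x = Z ⟨v, hv⟩ x := by
    intro v hv x
    simp [PointCode.stab, q, hv]
  have hrel : ∀ v (hv : v < g.1.length) (x : Fin m) w (y : Fin m), q.Rel g v x w y ↔
      CosetRel (r ⟨v, hv⟩) (t ⟨v, hv⟩) (B ⟨v, hv⟩) x ((g.vert v).1.elt w) y := by
    intro v hv x w y
    rw [PointCode.Rel, CosetRel, hrep v hv, hrep v hv, hshift v hv, hshift v hv, hstab v hv,
      FinPres.elt_append, FinPres.elt_invRev, FinPres.elt_append, hu ⟨v, hv⟩, hu ⟨v, hv⟩,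
      hZ ⟨v, hv⟩, Fin.val_inj]
  classical
  let _ : Fintype {e // e < g.2.length} := Fintype.ofFinite _
  let l : List (ℕ × ℕ × ℕ) := ((Finset.univ : Finset ({e // e < g.2.length} × Fin m × Fin m)).filter
    fun a => L a.1 a.2.1 a.2.2).toList.map fun a => (a.1.1, a.2.1.1, a.2.2.1)
  have hl : ∀ a, a ∈ l ↔ ∃ e x x', L e x x' ∧ a = (e.1, x.1, x'.1) := by
    intro a
    simp only [l, List.mem_map, Finset.mem_toList, Finset.mem_filter, Finset.mem_univ, true_and]
    constructor
    · rintro ⟨⟨e, x, x'⟩, h, rfl⟩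
      exact ⟨e, x, x', h, rfl⟩
    · rintro ⟨e, x, x', h, rfl⟩
      exact ⟨⟨e, x, x'⟩, h, rfl⟩
  have hrun : ∀ W ∈ Ws, ∀ y : Fin m, Φ (FreeGroup.mk W) • o = j y → q.Run g m l W 0 y := by
    intro W hW y hy
    choose i hi using fun n : Fin (W.length + 1) => hjs _ ⟨W, hW, n, n.2, rfl⟩
    have hget : ∀ n (hn : n < W.length + 1),
        (List.ofFn fun n => (i n : ℕ)).getD n 0 = i ⟨n, hn⟩ := by
      intro n hn
      rw [List.getD_eq_getElem _ _ (by simpa using hn), List.getElem_ofFn]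
    refine ⟨List.ofFn fun n => (i n : ℕ), ?_, ?_, fun n hn => ?_, fun n hn => ?_⟩
    · rw [hget _ (Nat.lt_succ_self _)]
      have h := hi ⟨W.length, Nat.lt_succ_self _⟩
      rw [List.drop_length] at h
      have : Φ (FreeGroup.mk []) • o = o := by
        change Φ 1 • o = o
        rw [map_one, one_smul]
      rw [this, ← hj0] at h
      rw [hj h]
    · rw [hget _ (Nat.succ_pos _)]
      have h := hi ⟨0, Nat.succ_pos _⟩
      rw [List.drop_zero, hy] at h
      rw [hj h]
    · rw [hget _ hn]
      exact (i _).2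
    · rw [hget _ (Nat.succ_lt_succ hn), hget n (Nat.lt_succ_of_lt hn), List.getD_eq_getElem _ _ hn]
      have hs : W[n] ∈ Ls := List.mem_flatten.2 ⟨W, hW, List.getElem_mem hn⟩
      have h : Φ (FreeGroup.mk [W[n]]) • j (i ⟨n + 1, Nat.succ_lt_succ hn⟩) =
          j (i ⟨n, Nat.lt_succ_of_lt hn⟩) := by
        rw [hi, hi, ← mul_smul, ← map_mul, ← mk_cons, ← List.drop_eq_getElem_cons]
      generalize i ⟨n + 1, Nat.succ_lt_succ hn⟩ = x at h
      generalize i ⟨n, Nat.lt_succ_of_lt hn⟩ = y at h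
      generalize W[n] = s at h hs
      obtain ⟨⟨v, k⟩ | e, b⟩ := s
      · refine Or.inl ⟨v, k, b, rfl, ?_⟩
        by_cases hv : v < g.1.length
        · refine Or.inr ⟨hv, (hrel v hv x _ y).2 (h1 ⟨v, hv⟩ _ _ _ ⟨k, b, hs, rfl, ?_⟩)⟩
          rw [← g.letterHom_vertexWord (ρ := ρ) (σ := σ) hv]
          exact h
        · refine Or.inl ⟨not_lt.1 hv, ?_⟩
          have e1 : Φ (FreeGroup.of (Sum.inl (v, k))) = 1 := by
            simp [Φ, GraphCode.letterHom, hv]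
          have : Φ (FreeGroup.mk [(Sum.inl (v, k), b)]) = 1 := by
            cases b
            · rw [mk_singleton_false, map_inv, e1, inv_one]
            · rw [mk_singleton_true, e1]
          rw [this, one_smul] at h
          rw [hj h]
      · refine Or.inr ⟨e, b, rfl, ?_⟩
        by_cases he : e < g.2.length
        · refine Or.inr ⟨he, ?_⟩
          have e1 : Φ (FreeGroup.of (Sum.inr e)) = σ ⟨e, he⟩ := g.letterHom_stable he
          cases b
          · rw [mk_singleton_false, map_inv, e1, inv_smul_eq_iff] at h
            exact Or.inr ⟨rfl, (hl _).2 ⟨⟨e, he⟩, y, x, h.symm, rfl⟩⟩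
          · rw [mk_singleton_true, e1] at h
            exact Or.inl ⟨rfl, (hl _).2 ⟨⟨e, he⟩, x, y, h, rfl⟩⟩
        · refine Or.inl ⟨not_lt.1 he, ?_⟩
          have e1 : Φ (FreeGroup.of (Sum.inr e)) = 1 := by
            simp [Φ, GraphCode.letterHom, he]
          have : Φ (FreeGroup.mk [(Sum.inr e, b)]) = 1 := by
            cases b
            · rw [mk_singleton_false, map_inv, e1, inv_one]
            · rw [mk_singleton_true, e1]
          rw [this, one_smul] at h
          rw [hj h]
  have hzW : wordSubst (fun k => us.getD k []) z ∈ Ws := List.mem_map.2 ⟨z, List.mem_cons_self, rfl⟩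
  refine ⟨g, us, m, q, l, hg, ⟨hlen, hr⟩, ⟨?_, ?_, ?_⟩, ?_, ?_⟩
  · intro v hv x hx y hy h
    have := (hrel v hv ⟨x, hx⟩ [] ⟨y, hy⟩).1 h
    rw [FinPres.elt_nil] at this
    exact congrArg Fin.val (h2 _ _ _ this)
  · intro a ha
    obtain ⟨e, x, x', -, rfl⟩ := (hl a).1 ha
    exact ⟨e.2, x.2, x'.2⟩
  · intro a ha b hb hab c
    obtain ⟨e, x, x', h, rfl⟩ := (hl a).1 ha
    obtain ⟨e', y, y', h', rfl⟩ := (hl b).1 hb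
    obtain rfl : e = e' := Subtype.ext hab
    have := h3 e x x' y y' ((g.edgeGp e).elt c) h h'
    rw [hα', hβ'] at this
    rw [hrel _ (hg.2 e e.2).1, hrel _ (hg.2 e e.2).2.1]
    exact this
  · intro w hw
    exact hrun _ (List.mem_map.2 ⟨w, List.mem_cons_of_mem _ hw, rfl⟩) ⟨0, hm⟩
      (by rw [hj0]; exact hY w hw)
  · obtain ⟨x, hx⟩ := hjs _ ⟨_, hzW, 0, Nat.succ_pos _, rfl⟩
    rw [List.drop_zero] at hx
    refine ⟨x, fun h => hz ?_, hrun _ hzW x hx.symm⟩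
    have hx0 : x = ⟨0, hm⟩ := Fin.ext h
    rw [hx0, hj0] at hx
    exact hx.symm

/-! ### Codes of graphs of groups based on a class -/

theorem IsSlender.of_injective {G : Type*} {G' : Type*} [Group G] [Group G'] (h : IsSlender G')
    (f : G →* G') (hf : Function.Injective f) : IsSlender G := by
  intro K
  have h1 : Group.FG (K.map f) := (Group.fg_iff_subgroup_fg _).2 (h _)
  exact (Group.fg_iff_subgroup_fg _).1
    (Group.fg_of_surjective (f := (K.equivMapOfInjective f hf).symm.toMonoidHom)
      (K.equivMapOfInjective f hf).symm.surjective)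

/-- The edge groups of a presentation are isomorphic to edge groups of the presented decorated
group, as these differ from their images by conjugation. -/
theorem FinDecPres.PresentsIn.isSlender_edgePres {P : Set DecoratedGroup.{u}}
    (hP : ∀ D ∈ P, ∀ i : D.I, IsSlender (D.H i)) {d : FinDecPres} (hd : d.PresentsIn P) {i : ℕ}
    (hi : i < d.2.length) : IsSlender (d.edgePres i).Pres := by
  obtain ⟨hv, D, hD, φ, ψ, k, h⟩ := hd
  obtain ⟨f, hf, -, hr⟩ := hv.exists_edgeHom hi
  have h' := h ⟨i, hi⟩
  change (d.edgeSubgroup i).map φ.toMonoidHom = _ at h'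
  rw [← hr] at h'
  let F : (d.edgePres i).Pres →* D.G :=
    (MulAut.conj (k (ψ ⟨i, hi⟩))).symm.toMonoidHom.comp (φ.toMonoidHom.comp f)
  refine (hP D hD (ψ ⟨i, hi⟩)).of_injective (F.codRestrict _ fun c => ?_)
    ((MonoidHom.injective_codRestrict _ _ _).2
      ((MulAut.conj (k (ψ ⟨i, hi⟩))).symm.injective.comp (φ.injective.comp hf)))
  obtain ⟨y, hy, hy'⟩ : φ (f c) ∈ (D.H (ψ ⟨i, hi⟩)).map (MulAut.conj (k (ψ ⟨i, hi⟩))).toMonoidHom :=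
    h' ▸ ⟨f c, ⟨c, rfl⟩, rfl⟩
  have : F c = y := by
    change (MulAut.conj (k (ψ ⟨i, hi⟩))).symm (φ (f c)) = y
    rw [← hy']
    exact (MulAut.conj (k (ψ ⟨i, hi⟩))).symm_apply_apply y
  rw [this]
  exact hy

/-- Injective homomorphisms with the same image differ by an isomorphism of their sources. -/
theorem MonoidHom.exists_mulEquiv_of_range_eq {A B G : Type*} [Group A] [Group B] [Group G]
    {f : A →* G} {g : B →* G} (hf : Function.Injective f) (hg : Function.Injective g)
    (h : f.range = g.range) : ∃ a : A ≃* B, ∀ b, f (a.symm b) = g b := by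
  refine ⟨(MonoidHom.ofInjective hf).trans
    ((MulEquiv.subgroupCongr h).trans (MonoidHom.ofInjective hg).symm), fun b => ?_⟩
  have := MonoidHom.apply_ofInjective_symm hf ((MulEquiv.subgroupCongr h).symm
    (MonoidHom.ofInjective hg b))
  exact this

/-- A subgroup of a decorated group which is conjugate to the `n`-th edge group of a presentation
has the presentation of that edge group. -/
theorem FinDecPres.IsValid.exists_edgeEquiv {d : FinDecPres} (hd : d.IsValid) {n : ℕ}
    (hn : n < d.2.length) {G H : Type*} [Group G] [Group H] (φ : G ≃* d.1.Pres) {f : H →* G}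
    (hf : Function.Injective f) {k : d.1.Pres} (h : f.range.map φ.toMonoidHom =
      (d.edgeSubgroup n).map (MulAut.conj k).toMonoidHom) :
    ∃ a : H ≃* (d.edgePres n).Pres, ∀ c, φ (f (a.symm ((d.edgePres n).elt c))) =
      k * d.1.elt (d.edgeWord n c) * k⁻¹ := by
  obtain ⟨α, h1, h2, h3⟩ := hd.exists_edgeHom hn
  obtain ⟨a, ha⟩ := MonoidHom.exists_mulEquiv_of_range_eq (f := φ.toMonoidHom.comp f)
    (g := (MulAut.conj k).toMonoidHom.comp α) (φ.injective.comp hf)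
    ((MulAut.conj k).injective.comp h1) (by rw [MonoidHom.range_comp, MonoidHom.range_comp, h, h3])
  refine ⟨a, fun c => ?_⟩
  rw [← h2]
  exact ha _

theorem Subgroup.mem_iff_of_map_eq_map_conj {A B : Type*} [Group A] [Group B] {φ : A ≃* B}
    {H : Subgroup A} {L : Subgroup B} {k : B}
    (h : H.map φ.toMonoidHom = L.map (MulAut.conj k).toMonoidHom) (x : A) :
    x ∈ H ↔ k⁻¹ * φ x * k ∈ L := by
  have h1 : φ x ∈ H.map φ.toMonoidHom ↔ x ∈ H := by
    rw [Subgroup.mem_map_equiv, MulEquiv.symm_apply_apply]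
  rw [← h1, h, Subgroup.mem_map_equiv, MulAut.conj_symm_apply]

/-- Composition of an isomorphism to a subdecoration with the inverse of an isomorphism from a
presented decorated group. -/
theorem DecoratedGroup.Isomorphic.exists_conj {D : DecoratedGroup.{u}} {D' : DecoratedGroup.{v}}
    {J : Set D'.I} (h : D.Isomorphic (D'.sub J)) {d : FinDecPres}
    (hd : d.toDecoratedGroup.Isomorphic D') : ∃ φ : D.G ≃* d.1.Pres, ∀ i, ∃ n < d.2.length, ∃ k,
      (D.H i).map φ.toMonoidHom = (d.edgeSubgroup n).map (MulAut.conj k).toMonoidHom := by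
  obtain ⟨φ₁, ψ₁, k₁, h₁⟩ := h
  obtain ⟨φ₂, ψ₂, k₂, h₂⟩ := hd
  let φ₁' : D.G ≃* D'.G := φ₁
  let φ₂' : d.1.Pres ≃* D'.G := φ₂
  refine ⟨φ₁'.trans φ₂'.symm, fun i => ?_⟩
  let j : D'.I := (ψ₁ i).1
  let n : Fin d.2.length := ψ₂.symm j
  let l₁ : D'.G := k₁ (ψ₁ i)
  let l₂ : D'.G := k₂ j
  have e₁ : ∀ x, x ∈ D.H i ↔ l₁⁻¹ * φ₁' x * l₁ ∈ D'.H j :=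
    Subgroup.mem_iff_of_map_eq_map_conj (φ := φ₁') (h₁ i)
  have e₂ : ∀ x, x ∈ d.edgeSubgroup n ↔ l₂⁻¹ * φ₂' x * l₂ ∈ D'.H j := by
    have := h₂ n
    rw [show ψ₂ n = j from ψ₂.apply_symm_apply j] at this
    exact Subgroup.mem_iff_of_map_eq_map_conj (φ := φ₂') this
  refine ⟨n, n.2, φ₂'.symm (l₁ * l₂⁻¹), ?_⟩
  ext x
  rw [Subgroup.mem_map_equiv, Subgroup.mem_map_equiv, e₁, e₂, MulAut.conj_symm_apply]
  simp [mul_assoc]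

/-- A finite graph of groups based on the class of decorated groups presented by the elements of
`S` has a code.  Vertex groups are identified with presented groups by means of `φ`, and edge groups
by means of `a`, compatibly up to conjugation. -/
theorem GraphOfGroups.exists_graphCode (Γ : GraphOfGroups.{u}) {S : FinDecPres → Prop}
    (hS : ∀ d, S d → d.IsValid) (hΓ : ∀ x, ∃ d, S d ∧ ∃ φ : Γ.G x ≃* d.1.Pres,
      ∀ i, ∃ n < d.2.length, ∃ k, ((Γ.decoratedGroupAt x).H i).map φ.toMonoidHom =
        (d.edgeSubgroup n).map (MulAut.conj k).toMonoidHom) :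
    ∃ (g : GraphCode) (ν : Γ.V ≃ {v // v < g.1.length}) (ε : Γ.E ≃ {e // e < g.2.length})
      (φ : ∀ x, Γ.G x ≃* (g.vert (ν x)).1.Pres), g.ValidIn S ∧
      (∀ e, (ν (Γ.src e) : ℕ) = g.src (ε e)) ∧ (∀ e, (ν (Γ.tgt e) : ℕ) = g.tgt (ε e)) ∧
      ∀ e, ∃ (ks kt : Word) (a : (g.edgeGp (ε e)).Pres ≃* Γ.H e),
        (∀ c, φ _ (Γ.incSrc e (a ((g.edgeGp (ε e)).elt c))) =
          (g.vert (ν (Γ.src e))).1.elt (ks ++ g.srcWord (ε e) c ++ FreeGroup.invRev ks)) ∧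
        ∀ c, φ _ (Γ.incTgt e (a ((g.edgeGp (ε e)).elt c))) =
          (g.vert (ν (Γ.tgt e))).1.elt (kt ++ g.tgtWord (ε e) c ++ FreeGroup.invRev kt) := by
  choose d hd φ hφ using hΓ
  have hs : ∀ e, ∃ n < (d (Γ.src e)).2.length, ∃ k, (Γ.incSrc e).range.map (φ _).toMonoidHom =
      ((d (Γ.src e)).edgeSubgroup n).map (MulAut.conj k).toMonoidHom :=
    fun e => hφ (Γ.src e) (Sum.inl ⟨e, rfl⟩)
  have ht : ∀ e, ∃ n < (d (Γ.tgt e)).2.length, ∃ k, (Γ.incTgt e).range.map (φ _).toMonoidHom =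
      ((d (Γ.tgt e)).edgeSubgroup n).map (MulAut.conj k).toMonoidHom :=
    fun e => hφ (Γ.tgt e) (Sum.inr ⟨e, rfl⟩)
  choose n hn ks hks using hs
  choose m hm kt hkt using ht
  choose a ha using fun e =>
    (hS _ (hd _)).exists_edgeEquiv (hn e) (φ _) (Γ.incSrc_injective e) (hks e)
  choose b hb using fun e =>
    (hS _ (hd _)).exists_edgeEquiv (hm e) (φ _) (Γ.incTgt_injective e) (hkt e)
  have hab : ∀ e, ∃ us : List Word, ∀ c,
      ((a e).symm.trans (b e)) (((d (Γ.src e)).edgePres (n e)).elt c) =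
        ((d (Γ.tgt e)).edgePres (m e)).elt (wordSubst (fun k => us.getD k []) c) := by
    intro e
    choose u hu using fun k : Fin ((d (Γ.src e)).edgePres (n e)).1 =>
      ((d (Γ.tgt e)).edgePres (m e)).elt_surjective
        (((a e).symm.trans (b e)) (((d (Γ.src e)).edgePres (n e)).elt [((k : ℕ), true)]))
    exact ⟨List.ofFn u,
      FinPres.map_elt_of_ofFn _ _ ((a e).symm.trans (b e)).toMonoidHom u hu⟩
  choose us hab using hab
  obtain ⟨N, ⟨ν⟩⟩ := Finite.exists_equiv_fin Γ.V
  obtain ⟨M, ⟨ε⟩⟩ := Finite.exists_equiv_fin Γ.E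
  let g : GraphCode := (List.ofFn fun v => d (ν.symm v), List.ofFn fun i => let e := ε.symm i
    ((ν (Γ.src e), n e), (ν (Γ.tgt e), m e), us e))
  have hN : g.1.length = N := List.length_ofFn
  have hM : g.2.length = M := List.length_ofFn
  have hvert : ∀ x, g.vert (ν x) = d x := by
    intro x
    simp [GraphCode.vert, g]
  have hedge : ∀ e, g.edge (ε e) =
      (((ν (Γ.src e) : ℕ), n e), ((ν (Γ.tgt e) : ℕ), m e), us e) := by
    intro e
    simp [GraphCode.edge, g]
  have hsrc : ∀ e, g.src (ε e) = ν (Γ.src e) := fun e => by rw [GraphCode.src, hedge]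
  have htgt : ∀ e, g.tgt (ε e) = ν (Γ.tgt e) := fun e => by rw [GraphCode.tgt, hedge]
  have hsrcI : ∀ e, g.srcIdx (ε e) = n e := fun e => by rw [GraphCode.srcIdx, hedge]
  have htgtI : ∀ e, g.tgtIdx (ε e) = m e := fun e => by rw [GraphCode.tgtIdx, hedge]
  have hgp : ∀ e, g.edgeGp (ε e) = (d (Γ.src e)).edgePres (n e) := fun e => by
    rw [GraphCode.edgeGp, hsrc, hsrcI, hvert]
  let ν' : Γ.V ≃ {v // v < g.1.length} := ν.trans (Fin.equivSubtype.trans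
    (Equiv.subtypeEquivRight fun v => by rw [hN]))
  let ε' : Γ.E ≃ {e // e < g.2.length} := ε.trans (Fin.equivSubtype.trans
    (Equiv.subtypeEquivRight fun v => by rw [hM]))
  have hφ' : ∀ x, ∃ φ' : Γ.G x ≃* (g.vert (ν' x)).1.Pres, ∀ y w, φ x y = (d x).1.elt w →
      φ' y = (g.vert (ν' x)).1.elt w := by
    intro x
    rw [show g.vert (ν' x) = d x from hvert x]
    exact ⟨φ x, fun _ _ h => h⟩
  choose φ' hφ' using hφ'
  refine ⟨g, ν', ε', φ', ⟨fun v hv => ?_, fun e he => ?_⟩, fun e => (hsrc e).symm,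
    fun e => (htgt e).symm, fun e => ?_⟩
  · obtain ⟨x, hx⟩ := ν'.surjective ⟨v, hv⟩
    obtain rfl : (ν x : ℕ) = v := congrArg Subtype.val hx
    rw [hvert]
    exact hd x
  · obtain ⟨e, hx⟩ := ε'.surjective ⟨e, he⟩
    obtain rfl : (ε e : ℕ) = _ := congrArg Subtype.val hx
    rw [hgp, hsrc, htgt, hsrcI, htgtI, hvert, hvert, hedge]
    exact ⟨(ν' _).2, (ν' _).2, hn e, hm e, (a e).symm.trans (b e), hab e⟩
  · obtain ⟨ks', hks'⟩ := (d (Γ.src e)).1.elt_surjective (ks e)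
    obtain ⟨kt', hkt'⟩ := (d (Γ.tgt e)).1.elt_surjective (kt e)
    obtain ⟨a', ha'⟩ : ∃ a' : (g.edgeGp (ε' e)).Pres ≃* Γ.H e, ∀ c,
        a' ((g.edgeGp (ε' e)).elt c) = (a e).symm (((d (Γ.src e)).edgePres (n e)).elt c) := by
      rw [show g.edgeGp (ε' e) = _ from hgp e]
      exact ⟨(a e).symm, fun _ => rfl⟩
    refine ⟨ks', kt', a', fun c => hφ' _ _ _ ?_, fun c => hφ' _ _ _ ?_⟩
    · rw [ha', ha, FinPres.elt_append, FinPres.elt_append, FinPres.elt_invRev, hks',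
        show g.srcWord (ε' e) c = (d (Γ.src e)).edgeWord (n e) c by
          change g.srcWord (ε e) c = _
          rw [GraphCode.srcWord, hsrc, hvert, hsrcI]]
    · have h1 : (a e).symm (((d (Γ.src e)).edgePres (n e)).elt c) =
          (b e).symm (((d (Γ.tgt e)).edgePres (m e)).elt
            (wordSubst (fun k => (us e).getD k []) c)) := by
        rw [← hab]
        exact ((b e).symm_apply_apply _).symm
      rw [ha', h1, hb, FinPres.elt_append, FinPres.elt_append, FinPres.elt_invRev, hkt',
        show g.tgtWord (ε' e) c = (d (Γ.tgt e)).edgeWord (m e)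
            (wordSubst (fun k => (us e).getD k []) c) by
          change g.tgtWord (ε e) c = _
          rw [GraphCode.tgtWord, htgt, hvert, htgtI, hedge]]

/-! ### Certificates for fundamental groups -/

/-- The fundamental group of a graph of groups with the code `g` is, up to conjugation, a retract of
the group defined by the letters and the relations of `g`, in which the stable letters of the
spanning tree survive. -/
theorem GraphOfGroups.IsSpanningTree.exists_letterHom {Γ : GraphOfGroups.{u}} {T : Set Γ.E}
    (hT : Γ.IsSpanningTree T) {S : FinDecPres → Prop} {g : GraphCode} (hg : g.ValidIn S)
    (ν : Γ.V ≃ {v // v < g.1.length}) (ε : Γ.E ≃ {e // e < g.2.length})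
    (φ : ∀ x, Γ.G x ≃* (g.vert (ν x)).1.Pres)
    (hsrc : ∀ e, (ν (Γ.src e) : ℕ) = g.src (ε e)) (htgt : ∀ e, (ν (Γ.tgt e) : ℕ) = g.tgt (ε e))
    (hE : ∀ e, ∃ (ks kt : Word) (a : (g.edgeGp (ε e)).Pres ≃* Γ.H e),
        (∀ c, φ _ (Γ.incSrc e (a ((g.edgeGp (ε e)).elt c))) =
          (g.vert (ν (Γ.src e))).1.elt (ks ++ g.srcWord (ε e) c ++ FreeGroup.invRev ks)) ∧
        ∀ c, φ _ (Γ.incTgt e (a ((g.edgeGp (ε e)).elt c))) =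
          (g.vert (ν (Γ.tgt e))).1.elt (kt ++ g.tgtWord (ε e) c ++ FreeGroup.invRev kt)) :
    ∃ (ρ : ∀ v : {v // v < g.1.length}, (g.vert v).1.Pres →* Γ.fundamentalGroup T)
      (σ : {e // e < g.2.length} → Γ.fundamentalGroup T),
      (∀ e (he : e < g.2.length) c, σ ⟨e, he⟩ * ρ ⟨g.tgt e, (hg.2 e he).2.1⟩
          ((g.vert (g.tgt e)).1.elt (g.tgtWord e c)) =
        ρ ⟨g.src e, (hg.2 e he).1⟩ ((g.vert (g.src e)).1.elt (g.srcWord e c)) * σ ⟨e, he⟩) ∧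
      ∃ (Ψ : Γ.fundamentalGroup T →* FreeGroup Letter ⧸ g.relations) (c : Γ.fundamentalGroup T),
        ∀ γ u, Ψ γ = QuotientGroup.mk' g.relations u → g.letterHom ρ σ u = c * γ * c⁻¹ := by
  choose ks kt a hs ht using hE
  have hρ : ∀ v : {v // v < g.1.length}, ∃ ρ : (g.vert v).1.Pres →* Γ.fundamentalGroup T,
      ∀ x, ν x = v → ∀ y w, φ x y = (g.vert (ν x)).1.elt w →
        ρ ((g.vert v).1.elt w) = Γ.vertexHom T x y := by
    intro v
    obtain ⟨x, rfl⟩ := ν.surjective v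
    refine ⟨(Γ.vertexHom T x).comp (φ x).symm.toMonoidHom, fun y hy z w h => ?_⟩
    obtain rfl := ν.injective hy
    rw [← h]
    exact congrArg (Γ.vertexHom T y) ((φ y).symm_apply_apply z)
  choose ρ hρ using hρ
  -- the elements of the vertex groups by which the identifications of edge groups are conjugated
  let Vs : ∀ e, Γ.G (Γ.src e) := fun e => (φ _).symm ((g.vert (ν (Γ.src e))).1.elt (ks e))
  let Vt : ∀ e, Γ.G (Γ.tgt e) := fun e => (φ _).symm ((g.vert (ν (Γ.tgt e))).1.elt (kt e))
  let σ : {e // e < g.2.length} → Γ.fundamentalGroup T := fun e =>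
    (Γ.vertexHom T _ (Vs (ε.symm e)))⁻¹ * Γ.stableElt T (ε.symm e) *
      Γ.vertexHom T _ (Vt (ε.symm e))
  have hσ' : ∀ e, σ (ε e) =
      (Γ.vertexHom T _ (Vs e))⁻¹ * Γ.stableElt T e * Γ.vertexHom T _ (Vt e) := by
    intro e
    have key : ∀ e' e, e' = e → (Γ.vertexHom T _ (Vs e'))⁻¹ * Γ.stableElt T e' *
        Γ.vertexHom T _ (Vt e') =
        (Γ.vertexHom T _ (Vs e))⁻¹ * Γ.stableElt T e * Γ.vertexHom T _ (Vt e) := by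
      rintro e _ rfl
      rfl
    exact key _ _ (ε.symm_apply_apply e)
  have hs' : ∀ e h c, h = a e ((g.edgeGp (ε e)).elt c) → φ _ ((Vs e)⁻¹ * Γ.incSrc e h * Vs e) =
      (g.vert (ν (Γ.src e))).1.elt (g.srcWord (ε e) c) := by
    rintro e _ c rfl
    rw [map_mul, map_mul, map_inv, hs, MulEquiv.apply_symm_apply, FinPres.elt_append,
      FinPres.elt_append, FinPres.elt_invRev]
    group
  have ht' : ∀ e h c, h = a e ((g.edgeGp (ε e)).elt c) → φ _ ((Vt e)⁻¹ * Γ.incTgt e h * Vt e) =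
      (g.vert (ν (Γ.tgt e))).1.elt (g.tgtWord (ε e) c) := by
    rintro e _ c rfl
    rw [map_mul, map_mul, map_inv, ht, MulEquiv.apply_symm_apply, FinPres.elt_append,
      FinPres.elt_append, FinPres.elt_invRev]
    group
  have hσ : ∀ e (he : e < g.2.length) c, σ ⟨e, he⟩ * ρ ⟨g.tgt e, (hg.2 e he).2.1⟩
        ((g.vert (g.tgt e)).1.elt (g.tgtWord e c)) =
      ρ ⟨g.src e, (hg.2 e he).1⟩ ((g.vert (g.src e)).1.elt (g.srcWord e c)) * σ ⟨e, he⟩ := by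
    intro e he c
    obtain ⟨e, hx⟩ := ε.surjective ⟨e, he⟩
    obtain rfl : (ε e : ℕ) = _ := congrArg Subtype.val hx
    rw [hρ ⟨g.tgt (ε e), _⟩ (Γ.tgt e) (Subtype.ext (htgt e)) _ _ (ht' e _ c rfl),
      hρ ⟨g.src (ε e), _⟩ (Γ.src e) (Subtype.ext (hsrc e)) _ _ (hs' e _ c rfl)]
    change σ (ε e) * _ = _ * σ (ε e)
    rw [hσ', map_mul, map_mul, map_inv, map_mul, map_mul, map_inv]
    have := Γ.stableElt_mul (T := T) e (a e ((g.edgeGp (ε e)).elt c))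
    calc _ = (Γ.vertexHom T _ (Vs e))⁻¹ * (Γ.stableElt T e * Γ.vertexHom T _
          (Γ.incTgt e (a e ((g.edgeGp (ε e)).elt c)))) * Γ.vertexHom T _ (Vt e) := by group
      _ = _ := by rw [this]; group
  -- the group defined by the code, to which the vertex groups map by `τ`
  let F := FreeGroup Letter ⧸ g.relations
  let π : FreeGroup Letter →* F := QuotientGroup.mk' g.relations
  have hπ : ∀ u, g.Relator u → π (FreeGroup.mk u) = 1 := fun u hu =>
    (QuotientGroup.eq_one_iff _).2 (Subgroup.subset_normalClosure ⟨u, hu, rfl⟩)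
  have hτ : ∀ v : {v // v < g.1.length}, ∃ τ : (g.vert v).1.Pres →* F,
      ∀ w, τ ((g.vert v).1.elt w) = π (FreeGroup.mk (vertexWord v w)) := by
    intro v
    have e : ∀ w, FreeGroup.lift (fun k => π (FreeGroup.of (Sum.inl (v.1, k)))) (FreeGroup.mk w) =
        π (FreeGroup.mk (vertexWord v w)) := by
      intro w
      rw [mk_vertexWord]
      exact (DFunLike.congr_fun (f := π.comp (FreeGroup.lift _))
        (FreeGroup.ext_hom _ _ (by intro k; simp)) (FreeGroup.mk w)).symm
    have h1 : ∀ w, (g.vert v).1.elt w = 1 → π (FreeGroup.mk (vertexWord v w)) = 1 :=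
      fun w hw => hπ _ (Or.inl ⟨v, v.2, w, by rw [hw, FinPres.elt_nil], rfl⟩)
    obtain ⟨τ, hτ⟩ := (g.vert v).1.exists_hom (fun k => π (FreeGroup.of (Sum.inl (v.1, k))))
      (fun k hk => h1 [(k, true)] (FinPres.elt_eq_one_of_le _ hk))
      (fun r hr => (e r).trans (h1 r (FinPres.elt_eq_one_of_mem _ hr)))
    exact ⟨τ, fun w => (hτ w).trans (e w)⟩
  choose τ hτ using hτ
  have hrel : ∀ e c, π (FreeGroup.of (Sum.inr (ε e))) *
        π (FreeGroup.mk (vertexWord (ν (Γ.tgt e)) (g.tgtWord (ε e) c))) =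
      π (FreeGroup.mk (vertexWord (ν (Γ.src e)) (g.srcWord (ε e) c))) *
        π (FreeGroup.of (Sum.inr (ε e))) := by
    intro e c
    have := hπ _ (Or.inr ⟨ε e, (ε e).2, c, rfl⟩)
    rw [mk_append, mk_append, mk_append, mk_invRev, mk_singleton_true, mk_singleton_false, map_mul,
      map_mul, map_mul, map_inv, map_inv, mul_inv_eq_one, mul_inv_eq_iff_eq_mul] at this
    rw [hsrc, htgt]
    exact this
  let A : FreeGroup Letter →* Γ.fundamentalGroup T := g.letterHom ρ σ
  let Φ : F →* Γ.fundamentalGroup T := QuotientGroup.lift g.relations A fun x hx =>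
    GraphCode.letterHom_eq_one_of_mem (fun e he => (hg.2 e he).1)
      (fun e he => (hg.2 e he).2.1) hσ hx
  have hΦ : ∀ x, Φ (π x) = A x := fun _ => rfl
  have hAv : ∀ x w, A (FreeGroup.mk (vertexWord (ν x) w)) =
      Γ.vertexHom T x ((φ x).symm ((g.vert (ν x)).1.elt w)) := by
    intro x w
    rw [← hρ (ν x) x rfl _ w (MulEquiv.apply_symm_apply _ _)]
    exact GraphCode.letterHom_vertexWord (ν x).2 w
  obtain ⟨Ψ, c, h⟩ := hT.exists_section (fun x => (τ (ν x)).comp (φ x).toMonoidHom)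
    (fun e => τ _ ((g.vert (ν (Γ.src e))).1.elt (ks e)) * π (FreeGroup.of (Sum.inr (ε e))) *
      (τ _ ((g.vert (ν (Γ.tgt e))).1.elt (kt e)))⁻¹)
    (by
      intro e h
      obtain ⟨h, rfl⟩ := (a e).surjective h
      obtain ⟨c, rfl⟩ := (g.edgeGp (ε e)).elt_surjective h
      have h1 : ((τ _).comp (φ _).toMonoidHom) (Γ.incSrc e (a e ((g.edgeGp (ε e)).elt c))) = _ :=
        congrArg (τ _) (hs e c)
      have h2 : ((τ _).comp (φ _).toMonoidHom) (Γ.incTgt e (a e ((g.edgeGp (ε e)).elt c))) = _ :=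
        congrArg (τ _) (ht e c)
      have h3 := hrel e c
      rw [← hτ, ← hτ] at h3
      rw [h1, h2, FinPres.elt_append, FinPres.elt_append, FinPres.elt_invRev, FinPres.elt_append,
        FinPres.elt_append, FinPres.elt_invRev, map_mul, map_mul, map_inv, map_mul, map_mul,
        map_inv]
      simp only [mul_assoc, inv_mul_cancel_left, mul_right_inj]
      rw [← mul_assoc (π _), h3, mul_assoc])
    Φ (by
      intro x y
      obtain ⟨w, hw⟩ := (g.vert (ν x)).1.elt_surjective (φ x y)
      have h1 : ((τ _).comp (φ x).toMonoidHom) y = _ := congrArg (τ _) hw.symm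
      rw [h1, hτ, hΦ, hAv, hw, MulEquiv.symm_apply_apply])
    (by
      intro e
      have h1 : A (FreeGroup.of (Sum.inr (ε e))) = σ (ε e) := GraphCode.letterHom_stable (ε e).2
      rw [map_mul, map_mul, map_inv, hτ, hτ, hΦ, hΦ, hΦ, hAv, hAv, h1, hσ']
      change Γ.vertexHom T _ (Vs e) * _ * (Γ.vertexHom T _ (Vt e))⁻¹ = _
      group)
  exact ⟨ρ, σ, hσ, Ψ, c, fun γ u hu => by rw [← h, hu]; rfl⟩

/-- Completeness of certificates.  The group of letters acts on the cosets of the subgroup generated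
by `Y`; the conjugation by `c` is compensated by taking the coset of `c` as the base point. -/
theorem GraphOfGroups.IsSpanningTree.isSeparated {Γ : GraphOfGroups.{u}} {T : Set Γ.E}
    (hT : Γ.IsSpanningTree T) {S : FinDecPres → Prop} (hS : ∀ d, S d → d.IsValid)
    (hsl : ∀ d, S d → ∀ i < d.2.length, IsSlender (d.edgePres i).Pres)
    (hΓ : ∀ x, ∃ d, S d ∧ ∃ φ : Γ.G x ≃* d.1.Pres,
      ∀ i, ∃ n < d.2.length, ∃ k, ((Γ.decoratedGroupAt x).H i).map φ.toMonoidHom =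
        (d.edgeSubgroup n).map (MulAut.conj k).toMonoidHom)
    {p : FinPres} (ω : p.Pres ≃* Γ.fundamentalGroup T) {Y : List Word} {z : Word}
    (h : p.elt z ∉ p.gen Y) : IsSeparated S p Y z := by
  obtain ⟨g, ν, ε, φ, hg, hsrc, htgt, hE⟩ := Γ.exists_graphCode hS hΓ
  obtain ⟨ρ, σ, hσ, Ψ, c, hΨ⟩ := hT.exists_letterHom hg ν ε φ hsrc htgt hE
  have hu : ∀ k : Fin p.1, ∃ u : List (Letter × Bool),
      Ψ (ω (p.elt [((k : ℕ), true)])) = QuotientGroup.mk' g.relations (FreeGroup.mk u) := by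
    intro k
    obtain ⟨x, hx⟩ := QuotientGroup.mk'_surjective g.relations (Ψ (ω (p.elt [((k : ℕ), true)])))
    obtain ⟨u, rfl⟩ := exists_mk_eq x
    exact ⟨u, hx.symm⟩
  choose u hu using hu
  have hw : ∀ w, Ψ (ω (p.elt w)) = QuotientGroup.mk' g.relations
      (FreeGroup.mk (wordSubst (fun k => (List.ofFn u).getD k []) w)) := by
    intro w
    have e : ∀ k, (Ψ.comp ω.toMonoidHom) (p.elt [(k, true)]) =
        QuotientGroup.mk' g.relations (FreeGroup.mk ((List.ofFn u).getD k [])) := by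
      intro k
      by_cases hk : k < p.1
      · rw [List.getD_eq_getElem _ _ (by simpa using hk), List.getElem_ofFn]
        exact hu ⟨k, hk⟩
      · rw [List.getD_eq_default _ _ (by simpa using hk), p.elt_eq_one_of_le (not_lt.1 hk), map_one]
        exact (map_one (QuotientGroup.mk' g.relations)).symm
    rw [mk_wordSubst]
    refine (p.map_elt (Ψ.comp ω.toMonoidHom) w).trans ?_
    simp only [e]
    exact DFunLike.congr_fun (g := (QuotientGroup.mk' g.relations).comp (FreeGroup.lift _))
      (FreeGroup.ext_hom _ _ (by intro k; simp)) (FreeGroup.mk w)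
  let U : Subgroup (Γ.fundamentalGroup T) := (p.gen Y).map ω.toMonoidHom
  have hact : ∀ w, g.letterHom ρ σ
      (FreeGroup.mk (wordSubst (fun k => (List.ofFn u).getD k []) w)) •
        (c : Γ.fundamentalGroup T ⧸ U) = c ↔ p.elt w ∈ p.gen Y := by
    intro w
    rw [hΨ _ _ (hw w), MulAction.Quotient.smul_coe, smul_eq_mul, inv_mul_cancel_right, eq_comm,
      QuotientGroup.eq, inv_mul_cancel_left, Subgroup.mem_map_equiv, MulEquiv.symm_apply_apply]
  refine isSeparated_of_action hS hg (fun e he => hsl _ (hg.1 _ (hg.2 e he).1) _ (hg.2 e he).2.2.1)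
    ρ σ hσ (List.ofFn u) (by rw [List.length_ofFn]) (fun r hr => ?_)
    (c : Γ.fundamentalGroup T ⧸ U)
    (fun w hw' => (hact w).2 (Subgroup.subset_closure ⟨w, hw', rfl⟩)) (fun h' => h ((hact z).1 h'))
  have := hw r
  rw [p.elt_eq_one_of_mem hr, map_one, map_one] at this
  exact (QuotientGroup.eq_one_iff _).1 this.symm

/-! ### The membership problem -/

theorem mainTheorem6 (P : Set DecoratedGroup.{u})
    -- membership in double cosets `⟨f_i(X_i)⟩⟨Y⟩`
    (hI : DecidableOn
      (fun x : FinDecPres × ℕ × List Word × Word => x.1.PresentsIn P ∧ x.2.1 < x.1.2.length)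
      (fun x => ∃ a ∈ x.1.edgeSubgroup x.2.1, ∃ b ∈ x.1.1.gen x.2.2.1,
        x.1.1.elt x.2.2.2 = a * b))
    (hII : MembershipProblemSolvable (DecoratedGroup.vertexGroups P))
    (hIII : ∀ D ∈ P, ∀ i : D.I, IsSlender (D.H i))
    (hIV : MembershipProblemSolvable (DecoratedGroup.edgeGroups P))
    -- finite generating sets of intersections `⟨f_i(X_i)⟩ ∩ ⟨Y⟩`
    (hV : AlgorithmFor
      (fun x : FinDecPres × ℕ × List Word => x.1.PresentsIn P ∧ x.2.1 < x.1.2.length)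
      (fun x (Z : List Word) =>
        x.1.1.gen Z = x.1.edgeSubgroup x.2.1 ⊓ x.1.1.gen x.2.2))
    (hVI : DecoratedGroup.RecursivelyEnumerable P) :
    MembershipProblemSolvable (fundamentalGroupsBasedOn P) := by
  obtain ⟨f, hf, hf₁, hf₂⟩ := hVI
  obtain ⟨f₁, hc₁, h₁⟩ := hI
  obtain ⟨f₂, hc₂, h₂⟩ := hII
  obtain ⟨f₅, hc₅, h₅⟩ := hV
  let S : FinDecPres → Prop := fun d => ∃ n, f n = some d
  have hSP : ∀ d, S d → d.PresentsIn P := fun d ⟨n, hn⟩ => hf₁ n d hn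
  have hSv : ∀ d, S d → d.IsValid := fun d hd => (hSP d hd).1
  have hS : RecEnum S := by
    have h : RecEnum fun x : FinDecPres × ℕ => some x.1 ∈ (f x.2 : Part (Option FinDecPres)) :=
      RecEnum.comp (f := fun x : FinDecPres × ℕ => (x.2, some x.1)) (RecEnum.of_partrec hf)
        (by fun_prop)
    exact (RecEnum.ex (p := fun d n => some d ∈ (f n : Part (Option FinDecPres))) h).of_iff
      fun d => exists_congr fun n => by rw [Part.coe_some, Part.mem_some_iff, eq_comm]
  -- a decision procedure enumerates the complement of the set that it decides
  have hfalse : ∀ {α : Type} [Primcodable α] {f : α →. Bool}, Partrec f →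
      RecEnum fun x => false ∈ f x := fun hf =>
    RecEnum.comp (f := fun x => (x, false)) (RecEnum.of_partrec hf) (by fun_prop)
  have hneg : ∀ {α : Type} {f : α →. Bool} {q : Prop} {a : α}, (∃ b ∈ f a, (b = true ↔ q)) →
      (false ∈ f a ↔ ¬ q) := by
    rintro α f q a ⟨b, hb, h⟩
    constructor
    · intro h' hq
      cases (Part.mem_unique h' hb).trans (h.2 hq)
    · intro hq
      rwa [← Bool.eq_false_iff.2 fun h' => hq (h.1 h')]
  have hR := exists_recEnum_folded hSv (hfalse hc₂)
    (fun d hd Y z => hneg (h₂ (d.1, Y, z) (by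
      obtain ⟨-, D, hD, φ, -⟩ := hSP d hd
      exact ⟨GrpCat.of D.G, ⟨D, hD, ⟨MulEquiv.refl _⟩⟩, ⟨φ⟩⟩)))
    (hfalse hc₁) (fun d hd i hi Y z => hneg (h₁ (d, i, Y, z) ⟨hSP d hd, hi⟩))
    (RecEnum.of_partrec hc₅)
    (fun d hd i hi Y => by
      obtain ⟨Z, hZ, -⟩ := h₅ (d, i, Y) ⟨hSP d hd, hi⟩
      exact ⟨Z, hZ⟩)
    (fun d hd i hi Y Z hZ => by
      obtain ⟨Z', hZ', h⟩ := h₅ (d, i, Y) ⟨hSP d hd, hi⟩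
      obtain rfl := Part.mem_unique hZ hZ'
      exact h)
  refine RecEnum.decidableOn
    (p := fun x : FinPres × List Word × Word => x.1.elt x.2.2 ∈ x.1.gen x.2.1)
    (r := fun x => IsSeparated S x.1 x.2.1 x.2.2) (by fun_prop) (recEnum_isSeparated hS hR)
    (fun _ _ => Iff.rfl) ?_
  rintro ⟨p, Y, z⟩ ⟨K, ⟨Γ, T, hΓ, hT, ⟨ω⟩⟩, ⟨ω'⟩⟩
  refine ⟨fun h => h.not_mem hSv, fun h => hT.isSeparated hSv
    (fun d hd i hi => (hSP d hd).isSlender_edgePres hIII hi) (fun x => ?_) (ω'.trans ω) h⟩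
  obtain ⟨D, hD, J, hJ⟩ := hΓ x
  obtain ⟨n, d, hd, hd'⟩ := hf₂ D hD
  exact ⟨d, ⟨n, hd⟩, hJ.exists_conj hd'⟩
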